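/- For a finite set system $S=(U,\mathcal F)$, where $\mathcal F$ is a set of subsets of $U$, let $\pi_{\mathcal F}(k)=\max_{A\subseteq U,\,|A|\le k}|\{X\cap A : X\in\mathcal F\}|$ be its shatter function, and let $\pi^*_{\mathcal F}$ be the shatter function of the dual set system $(\mathcal F,\{X^*_u : u\in U\})$, $X^*_u=\{X\in\mathcal F : u\in X\}$. Let $\|S\|=|U|+\sum_{X\in\mathcal F}|X|$. The crossing number of a total order on $U$ is the maximum over $X\in\mathcal F$ of the number of pairs of adjacent elements of the order of which exactly one belongs to $X$. Write $\log$ for the base-$2$ logarithm, with the convention $\log 0=0$. Theorem. There is a randomized algorithm (on a random access machine with words of $O(\log\|S\|)$ bits, unit-cost word operations and unit-cost uniform random choices from $\{0,\dots,x\}$ for a word $x$) with the following property. Let $S=(U,\mathcal F)$ be a finite set system and let $c\ge 1$ be a real number such that $\pi_{\mathcal F}(k)\le c\cdot k$ and $\pi^*_{\mathcal F}(k)\le c\cdot k$ for all integers $k\ge 1$. Given $S$ (as any listing of the sets in $\mathcal F$ by their elements) and $c$ (through unit-cost comparisons of $c$ with quotients of two words), the algorithm always halts within $O(\|S\|\log|U|+1)$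 steps, hence in time $O(\|S\|\log\|S\|)$ for $\|S\|\ge 2$, where the constants are absolute, and with probability at least $2/3$ its output is a total order on $U$ with crossing number at most $12c^2\log^2|U|$. -/

import Mathlib

namespace WelzlOrder

/-! ### Set systems -/

/-- The shatter function of a family `F` of subsets of a finite ground set `α`:
the maximum of `|{X ∩ A : X ∈ F}|` over all `A ⊆ α` with `|A| ≤ k`. -/
def shatterFunction {α : Type} [Fintype α] [DecidableEq α]
    (F : Finset (Finset α)) (k : ℕ) : ℕ :=
  (Finset.univ.filter fun A : Finset α => A.card ≤ k).sup
    fun A => (F.image fun X => X ∩ A).card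

/-- The family of the dual set system: its ground set is `F`, and its members are the sets
`{X ∈ F | u ∈ X}` for `u : α`. -/
def dualFamily {α : Type} [Fintype α] [DecidableEq α]
    (F : Finset (Finset α)) : Finset (Finset {X // X ∈ F}) :=
  Finset.univ.image fun u : α => Finset.univ.filter fun X : {X // X ∈ F} => u ∈ X.1

/-- The dual shatter function of `F`. -/
def dualShatterFunction {α : Type} [Fintype α] [DecidableEq α]
    (F : Finset (Finset α)) (k : ℕ) : ℕ :=
  shatterFunction (dualFamily F) k

/-- The size `|U| + ∑_{X ∈ F} |X|` of a set system with ground set `U = Fin n`. -/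
def size {n : ℕ} (F : Finset (Finset (Fin n))) : ℕ :=
  n + ∑ X ∈ F, X.card

/-- A total order on `Fin n` is given by its increasing enumeration `e 0, e 1, …, e (n - 1)`.
This is the number of pairs of adjacent elements `e i`, `e (i + 1)` of which exactly one
belongs to `X`. -/
def crossings {n : ℕ} (e : Equiv.Perm (Fin n)) (X : Finset (Fin n)) : ℕ :=
  (Finset.univ.filter fun i : Fin n =>
    ∃ h : i.1 + 1 < n, ¬(e i ∈ X ↔ e ⟨i.1 + 1, h⟩ ∈ X)).card

/-- The crossing number of the order enumerated by `e`: the maximum number of crossings with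
a member of `F`. -/
def crossingNumber {n : ℕ} (F : Finset (Finset (Fin n))) (e : Equiv.Perm (Fin n)) : ℕ :=
  F.sup (crossings e)

/-! ### Representation of the input -/

/-- `L` lists the members of `F`, each of them exactly once, and each of them as a list of its
elements without repetitions. Nothing is assumed on the order of the lists. -/
def Represents {n : ℕ} (L : List (List (Fin n))) (F : Finset (Finset (Fin n))) : Prop :=
  (∀ l ∈ L, l.Nodup) ∧ (L.map List.toFinset).Nodup ∧ (L.map List.toFinset).toFinset = F

/-- The input array: the size of the ground set, the number of sets, and then for every set its
cardinality followed by its elements. -/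
def encode {n : ℕ} (L : List (List (Fin n))) : List ℕ :=
  n :: L.length :: L.flatMap fun l => l.length :: l.map Fin.val

/-! ### Randomized random access machines

A machine has word-valued variables and a finite number of arrays of words (each program mentions
only finitely many of both). A program is a structured composition of elementary instructions;
each elementary instruction and each evaluation of a test takes one step. Words are natural numbers
whose size is restricted in the statement that uses the model. The machine also has a
real parameter `c`, which it can only access by comparing it with a quotient of two words. -/

/-- An operand of an instruction: a constant or a variable. -/
inductive Operand
  | const (v : ℕ)
  | var (i : ℕ)

/-- The arithmetic operations (truncated subtraction and integer division). -/
inductive BinOp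
  | add
  | sub
  | mul
  | div

/-- The tests: `lt x y` is `x < y`, and `leParam x y` is `x ≤ c * y` for the real parameter
`c`. -/
inductive Test
  | lt (x y : Operand)
  | leParam (x y : Operand)

/-- Programs. -/
inductive Cmd
  /-- do nothing -/
  | skip
  /-- `dst := x o y` -/
  | op (dst : ℕ) (o : BinOp) (x y : Operand)
  /-- `dst := a[i]` for the array with name `a` -/
  | load (dst : ℕ) (a : ℕ) (i : Operand)
  /-- `a[i] := x` for the array with name `a` -/
  | store (a : ℕ) (i x : Operand)
  /-- `dst :=` a uniformly random element of `{0, …, x}`, independent of everything before -/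
  | rand (dst : ℕ) (x : Operand)
  /-- first `p`, then `q` -/
  | seq (p q : Cmd)
  /-- if `t` then `p` else `q` -/
  | ite (t : Test) (p q : Cmd)
  /-- while `t` do `p` -/
  | loop (t : Test) (p : Cmd)

/-- The contents of the variables and arrays. -/
structure State where
  var : ℕ → ℕ
  arr : ℕ → ℕ → ℕ

/-- The value of an operand. -/
def Operand.eval (s : State) : Operand → ℕ
  | .const v => v
  | .var i => s.var i

/-- The result of an arithmetic operation. -/
def BinOp.eval : BinOp → ℕ → ℕ → ℕ
  | .add, x, y => x + y
  | .sub, x, y => x - y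
  | .mul, x, y => x * y
  | .div, x, y => x / y

/-- Whether a test succeeds, for the real parameter `c`. -/
def Test.Holds (c : ℝ) (s : State) : Test → Prop
  | .lt x y => x.eval s < y.eval s
  | .leParam x y => (x.eval s : ℝ) ≤ c * (y.eval s : ℝ)

/-- Assign the value `v` to the variable `i`. -/
def State.setVar (s : State) (i v : ℕ) : State :=
  { s with var := Function.update s.var i v }

/-- Assign the value `v` to the cell `i` of the array `a`. -/
def State.setArr (s : State) (a i v : ℕ) : State :=
  { s with arr := Function.update s.arr a (Function.update (s.arr a) i v) }

/-- A configuration: what remains to be executed, and the current state. -/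
structure Config where
  todo : List Cmd
  state : State

/-- The machine has halted when nothing remains to be executed. -/
def Config.Halted (x : Config) : Prop :=
  x.todo = []

open Classical in
/-- One step of the machine with real parameter `c`: the distribution of the next configuration.
A machine that has halted stays as it is. -/
noncomputable def step (c : ℝ) : Config → PMF Config
  | ⟨[], s⟩ => PMF.pure ⟨[], s⟩
  | ⟨.skip :: r, s⟩ => PMF.pure ⟨r, s⟩
  | ⟨.op d o x y :: r, s⟩ => PMF.pure ⟨r, s.setVar d (o.eval (x.eval s) (y.eval s))⟩
  | ⟨.load d a i :: r, s⟩ => PMF.pure ⟨r, s.setVar d (s.arr a (i.eval s))⟩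
  | ⟨.store a i x :: r, s⟩ => PMF.pure ⟨r, s.setArr a (i.eval s) (x.eval s)⟩
  | ⟨.rand d x :: r, s⟩ =>
      (PMF.uniformOfFintype (Fin (x.eval s + 1))).map fun v => ⟨r, s.setVar d v.1⟩
  | ⟨.seq p q :: r, s⟩ => PMF.pure ⟨p :: q :: r, s⟩
  | ⟨.ite t p q :: r, s⟩ => PMF.pure ⟨(if t.Holds c s then p else q) :: r, s⟩
  | ⟨.loop t p :: r, s⟩ => PMF.pure ⟨if t.Holds c s then p :: .loop t p :: r else r, s⟩

/-- The initial configuration of the program `P`: the array `0` holds the input, and everything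
else is `0`. -/
def initial (P : Cmd) (input : List ℕ) : Config :=
  ⟨[P], ⟨fun _ => 0, fun a i => if a = 0 then input.getD i 0 else 0⟩⟩

/-- The distribution of the configuration of the program `P` after `t` steps. -/
noncomputable def run (P : Cmd) (c : ℝ) (input : List ℕ) : ℕ → PMF Config
  | 0 => PMF.pure (initial P input)
  | t + 1 => (run P c input t).bind (step c)

/-- All words in the configuration are at most `M`. -/
def Config.WordsLE (x : Config) (M : ℕ) : Prop :=
  (∀ i, x.state.var i ≤ M) ∧ ∀ a i, x.state.arr a i ≤ M

/-- The first `n` cells of the array `1` hold the increasing enumeration `e` of an order on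
`Fin n`. -/
def Config.Outputs {n : ℕ} (x : Config) (e : Equiv.Perm (Fin n)) : Prop :=
  ∀ i : Fin n, x.state.arr 1 i.1 = (e i).1

end WelzlOrder

/-! The order is built by merging cycles of a permutation `σ` of the ground set, starting from the
identity; a single cycle, cut open anywhere, is a total order. Suppose that m > 1 cycles remain,
each with one representative, and let R be the set of representatives. With k slightly above 8c,
draw b = ⌊32m/k²⌋ representatives with replacement to form a sample B. Group the sets by their
traces on B, keep one set per trace, and group the elements by their membership in the kept sets.
The primal shatter bound leaves at most cb kept sets, and the dual one at most c²b ≤ m/2 classes of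
representatives. Cycles whose representatives share a class are merged. So the number of cycles
halves in every round, whatever is drawn: there are at most log n rounds, and partition refinement
makes each of them linear in the size of the system.

For the crossings, let X be a member and Y the kept set with the same trace on B. Merging multiplies
`σ` by a permutation τ that moves only representatives and respects membership in Y. A new crossing
of X therefore uses an element of XΔY ∩ R, and X gains at most 2|XΔY ∩ R| crossings. There are at
most (cm)² such differences, and by a union bound the sample hits all those with more than 8c² log m
elements, except with probability at most 1/(64m). As XΔY misses B, the gain is then at most 16c²
log m. With m halving, these gains telescope to at most 8c²ℓ(ℓ+1) for ℓ = log n. Once m < k², where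
k² ≤ 81c², all cycles are merged at once, at a cost of at most 81c². For ℓ ≥ 6 the sum is at most
12c²ℓ²; for smaller n the trivial bound n-1 is good enough. The failure probabilities form a
geometric series, absorbed by the success bound 2/3 + 1/(3m).

No sample space for the whole run is ever analysed. `Spec` carries a lower bound for the conditional
probability of success through the program; at a random draw its average must be at least the old
value. During sampling this is the method of conditional expectations, applied to the number of
large differences still missed. The ideas are carried by `classes_of_sample`, `drawSample_spec`,
`mergeCycles_spec`, `fail_bound` and `budget_step`, and are assembled in `mergeRound_spec`. -/

namespace WelzlOrder

/-! ### Runs from an arbitrary configuration -/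

/-- The distribution of the configuration `t` steps after `x`. -/
noncomputable def runFrom (c : ℝ) (x : Config) : ℕ → PMF Config
  | 0 => PMF.pure x
  | t + 1 => (runFrom c x t).bind (step c)

theorem run_eq_runFrom (P : Cmd) (c : ℝ) (input : List ℕ) (t : ℕ) :
    run P c input t = runFrom c (initial P input) t := by
  induction t with
  | zero => rfl
  | succ t ih => rw [run, runFrom, ih]

/-- The definition adds steps at the end, whereas the program logic removes the first step;
associativity of `bind` reconciles the two. -/
theorem runFrom_succ (c : ℝ) (x : Config) (t : ℕ) :
    runFrom c x (t + 1) = (step c x).bind fun y => runFrom c y t := by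
  induction t with
  | zero => simp [runFrom]
  | succ t ih =>
    rw [runFrom, ih, PMF.bind_bind]
    rfl

theorem runFrom_halted (c : ℝ) (s : State) (t : ℕ) :
    runFrom c ⟨[], s⟩ t = PMF.pure ⟨[], s⟩ := by
  induction t with
  | zero => rfl
  | succ t ih => rw [runFrom, ih, PMF.pure_bind, step]

def State.WordsLE (s : State) (M : ℕ) : Prop :=
  (∀ i, s.var i ≤ M) ∧ ∀ a i, s.arr a i ≤ M

theorem State.WordsLE.setVar {s : State} {M : ℕ} (h : s.WordsLE M) (i : ℕ) {v : ℕ}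
    (hv : v ≤ M) : (s.setVar i v).WordsLE M := by
  refine ⟨fun j => ?_, h.2⟩
  by_cases hj : j = i
  · subst hj; simpa [State.setVar] using hv
  · simpa [State.setVar, hj] using h.1 j

theorem State.WordsLE.setArr {s : State} {M : ℕ} (h : s.WordsLE M) (a i : ℕ) {v : ℕ}
    (hv : v ≤ M) : (s.setArr a i v).WordsLE M := by
  refine ⟨h.1, fun b j => ?_⟩
  by_cases hb : b = a
  · subst hb
    by_cases hj : j = i
    · subst hj; simpa [State.setArr] using hv
    · simpa [State.setArr, hj] using h.2 b j
  · simpa [State.setArr, hb] using h.2 b j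

/-- From `x` the machine surely halts within `T` steps, uses only words up to `M`, and with
probability at least `p` it ends in a state satisfying `G`. -/
structure Ensures (c : ℝ) (M : ℕ) (G : State → Prop) (T : ℕ) (p : ℝ) (x : Config) : Prop where
  halts : ∀ y ∈ (runFrom c x T).support, y.Halted
  words : ∀ t, ∀ y ∈ (runFrom c x t).support, y.WordsLE M
  prob : p ≤ ((runFrom c x T).toOuterMeasure {y | G y.state}).toReal

section Ensures

variable {c : ℝ} {M : ℕ} {G : State → Prop}

/-- A failed run is allowed if its bound has dropped to zero or below. Bounds are never truncated,
and unlucky samples do make them negative. -/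
theorem Ensures.of_halted {s : State} {p : ℝ} (hs : s.WordsLE M) (hp : p ≤ 1)
    (hG : G s ∨ p ≤ 0) : Ensures c M G 0 p ⟨[], s⟩ := by
  refine ⟨?_, ?_, ?_⟩
  · intro y hy
    simp only [runFrom_halted, PMF.support_pure, Set.mem_singleton_iff] at hy
    subst hy; rfl
  · intro t y hy
    simp only [runFrom_halted, PMF.support_pure, Set.mem_singleton_iff] at hy
    subst hy; exact hs
  · rw [runFrom_halted, PMF.toOuterMeasure_pure_apply]
    rcases hG with hG | hG
    · simpa [hG] using hp
    · exact hG.trans ENNReal.toReal_nonneg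

theorem Ensures.mono_prob {T : ℕ} {p q : ℝ} {x : Config} (h : Ensures c M G T p x)
    (hq : q ≤ p) : Ensures c M G T q x :=
  ⟨h.halts, h.words, hq.trans h.prob⟩

/-- Halted configurations are fixed points of `step`, so waiting longer does not change the
distribution. This lets all time bounds be rounded up. -/
theorem Ensures.succ_time {T : ℕ} {p : ℝ} {x : Config} (h : Ensures c M G T p x) :
    Ensures c M G (T + 1) p x := by
  have key : runFrom c x (T + 1) = runFrom c x T := by
    have : ∀ y ∈ (runFrom c x T).support, step c y = PMF.pure y := by
      rintro ⟨todo, s⟩ hy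
      have := h.halts _ hy
      simp only [Config.Halted] at this
      subst this
      rfl
    rw [runFrom]
    conv_rhs => rw [← PMF.bind_pure (runFrom c x T)]
    ext y
    simp only [PMF.bind_apply]
    refine tsum_congr fun a => ?_
    by_cases ha : a ∈ (runFrom c x T).support
    · rw [this a ha]
    · rw [PMF.mem_support_iff, not_not] at ha
      simp [ha]
  exact ⟨by rw [key]; exact h.halts, h.words, by rw [key]; exact h.prob⟩

theorem Ensures.mono_time {T T' : ℕ} {p : ℝ} {x : Config} (h : Ensures c M G T p x)
    (hT : T ≤ T') : Ensures c M G T' p x := by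
  induction hT with
  | refl => exact h
  | step _ ih => exact ih.succ_time

theorem PMF.toOuterMeasure_ne_top {α : Type*} (p : PMF α) (s : Set α) :
    p.toOuterMeasure s ≠ ⊤ := by
  have h : p.toOuterMeasure s ≤ 1 := by
    rw [PMF.toOuterMeasure_apply, ← p.tsum_coe]
    exact ENNReal.tsum_le_tsum fun a => Set.indicator_le_self _ _ _
  exact ne_top_of_le_ne_top ENNReal.one_ne_top h

theorem Ensures.of_pure_step {T : ℕ} {p : ℝ} {x y : Config} (hstep : step c x = PMF.pure y)
    (hx : x.WordsLE M) (h : Ensures c M G T p y) : Ensures c M G (T + 1) p x := by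
  have key : ∀ t, runFrom c x (t + 1) = runFrom c y t := fun t => by
    rw [runFrom_succ, hstep, PMF.pure_bind]
  refine ⟨by rw [key]; exact h.halts, fun t => ?_, by rw [key]; exact h.prob⟩
  cases t with
  | zero =>
    intro z hz
    simp only [runFrom, PMF.support_pure, Set.mem_singleton_iff] at hz
    subst hz; exact hx
  | succ t => rw [key]; exact h.words t

/-- Conditioning on the drawn value `v`, with conditional bound `f v`, which may be negative; the
inequality on averages is multiplied through by the number of values. -/
theorem Ensures.of_rand_step {T : ℕ} {p : ℝ} {s : State} {d : ℕ} {x : Operand} {r : List Cmd}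
    (hs : s.WordsLE M) (f : ℕ → ℝ)
    (h : ∀ v ≤ x.eval s, Ensures c M G T (f v) ⟨r, s.setVar d v⟩)
    (hp : p * (x.eval s + 1 : ℕ) ≤ ∑ v ∈ Finset.range (x.eval s + 1), f v) :
    Ensures c M G (T + 1) p ⟨.rand d x :: r, s⟩ := by
  set N := x.eval s + 1 with hN
  have key : ∀ t, runFrom c ⟨.rand d x :: r, s⟩ (t + 1) =
      (PMF.uniformOfFintype (Fin N)).bind fun v => runFrom c ⟨r, s.setVar d v.1⟩ t := fun t => by
    rw [runFrom_succ, step, PMF.bind_map]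
    rfl
  have mem : ∀ v : Fin N, v.1 ≤ x.eval s := fun v => by have := v.2; omega
  refine ⟨?_, fun t => ?_, ?_⟩
  · rw [key]
    intro y hy
    obtain ⟨v, -, hv⟩ := (PMF.mem_support_bind_iff _ _ _).1 hy
    exact (h v (mem v)).halts y hv
  · cases t with
    | zero =>
      intro z hz
      simp only [runFrom, PMF.support_pure, Set.mem_singleton_iff] at hz
      subst hz; exact hs
    | succ t =>
      rw [key]
      intro y hy
      obtain ⟨v, -, hv⟩ := (PMF.mem_support_bind_iff _ _ _).1 hy
      exact (h v (mem v)).words t y hv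
  · have hN0 : (0 : ℝ) < (N : ℝ) := by rw [hN]; positivity
    rw [key, PMF.toOuterMeasure_bind_apply, tsum_fintype, ENNReal.toReal_sum]
    · have : ∀ v : Fin N, f v / N ≤ (PMF.uniformOfFintype (Fin N) v *
          (runFrom c ⟨r, s.setVar d v.1⟩ T).toOuterMeasure {y | G y.state}).toReal := by
        intro v
        rw [PMF.uniformOfFintype_apply, ENNReal.toReal_mul, div_eq_inv_mul]
        simp only [Fintype.card_fin, ENNReal.toReal_inv, ENNReal.toReal_natCast]
        exact mul_le_mul_of_nonneg_left (h v (mem v)).prob (by positivity)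
      refine le_trans ?_ (Finset.sum_le_sum fun v _ => this v)
      rw [← Finset.sum_div, le_div_iff₀ hN0, Fin.sum_univ_eq_sum_range]
      exact hp
    · intro v _
      refine ENNReal.mul_ne_top ?_ (PMF.toOuterMeasure_ne_top _ _)
      rw [PMF.uniformOfFintype_apply]
      simp

end Ensures

/-! ### A program logic -/

/-- Whether the program may write to the variable `v`. -/
def Cmd.writesVar : Cmd → ℕ → Bool
  | .skip, _ => false
  | .op d _ _ _, v => d == v
  | .load d _ _, v => d == v
  | .store _ _ _, _ => false
  | .rand d _, v => d == v
  | .seq p q, v => p.writesVar v || q.writesVar v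
  | .ite _ p q, v => p.writesVar v || q.writesVar v
  | .loop _ p, v => p.writesVar v

/-- Whether the program may write to the array `a`. -/
def Cmd.writesArr : Cmd → ℕ → Bool
  | .skip, _ => false
  | .op _ _ _ _, _ => false
  | .load _ _ _, _ => false
  | .store b _ _, a => b == a
  | .rand _ _, _ => false
  | .seq p q, a => p.writesArr a || q.writesArr a
  | .ite _ p q, a => p.writesArr a || q.writesArr a
  | .loop _ p, a => p.writesArr a

/-- `s'` differs from `s` only in variables and arrays to which `C` may write. -/
structure Frame (C : Cmd) (s s' : State) : Prop where
  var : ∀ v, C.writesVar v = false → s'.var v = s.var v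
  arr : ∀ a, C.writesArr a = false → s'.arr a = s.arr a

theorem Frame.refl (C : Cmd) (s : State) : Frame C s s := ⟨fun _ _ => rfl, fun _ _ => rfl⟩

theorem Frame.trans {C : Cmd} {s s' s'' : State} (h : Frame C s s') (h' : Frame C s' s'') :
    Frame C s s'' :=
  ⟨fun v hv => (h'.var v hv).trans (h.var v hv), fun a ha => (h'.arr a ha).trans (h.arr a ha)⟩

theorem Frame.mono {C D : Cmd} {s s' : State} (h : Frame C s s')
    (hv : ∀ v, D.writesVar v = false → C.writesVar v = false)
    (ha : ∀ a, D.writesArr a = false → C.writesArr a = false) : Frame D s s' :=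
  ⟨fun v h1 => h.var v (hv v h1), fun a h1 => h.arr a (ha a h1)⟩

/-- Started in the state `s`, the program `C` surely halts within `t` steps, without exceeding
the word bound `M`. The real number `p` is a lower bound for the probability of success of the
whole run, as known before the execution of `C`; it is replaced by `p'` afterwards, in such a
way that the average of `p'` over the random choices in `C` is at least `p`, and the final state
and `p'` surely satisfy `Post`. -/
def Spec (c : ℝ) (M : ℕ) (C : Cmd) (s : State) (p : ℝ) (t : ℕ) (Post : State → ℝ → Prop) : Prop :=
  s.WordsLE M → ∀ (G : State → Prop) (T : ℕ) (r : List Cmd),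
    (∀ s' p', Post s' p' → s'.WordsLE M → Frame C s s' → Ensures c M G T p' ⟨r, s'⟩) →
    Ensures c M G (T + t) p ⟨C :: r, s⟩

section Spec

variable {c : ℝ} {M : ℕ}

theorem Spec.mono {C : Cmd} {s : State} {p : ℝ} {t t' : ℕ} {Post Post' : State → ℝ → Prop}
    (h : Spec c M C s p t Post) (ht : t ≤ t')
    (hP : ∀ s' p', Post s' p' → s'.WordsLE M → Frame C s s' → Post' s' p') :
    Spec c M C s p t' Post' :=
  fun hs G T r hk => (h hs G T r fun s' p' h1 h2 h3 =>
    hk s' p' (hP s' p' h1 h2 h3) h2 h3).mono_time (by omega)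

theorem Spec.with_words {C : Cmd} {s : State} {p : ℝ} {t : ℕ} {Post : State → ℝ → Prop}
    (h : s.WordsLE M → Spec c M C s p t Post) : Spec c M C s p t Post :=
  fun hs => h hs hs

theorem Spec.mono_prob {C : Cmd} {s : State} {p q : ℝ} {t : ℕ} {Post : State → ℝ → Prop}
    (h : Spec c M C s p t Post) (hq : q ≤ p) : Spec c M C s q t Post :=
  fun hs G T r hk => (h hs G T r hk).mono_prob hq

theorem Spec.seq {C D : Cmd} {s : State} {p : ℝ} {t₁ t₂ : ℕ} {Mid Post : State → ℝ → Prop}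
    (h₁ : Spec c M C s p t₁ Mid)
    (h₂ : ∀ s' p', Mid s' p' → Frame C s s' → Spec c M D s' p' t₂ Post) :
    Spec c M (.seq C D) s p (t₁ + t₂ + 1) Post := by
  intro hs G T r hk
  have : Ensures c M G (T + t₂ + t₁) p ⟨C :: D :: r, s⟩ := by
    refine h₁ hs G _ _ fun s' p' hm hw hF => ?_
    refine h₂ s' p' hm hF hw G _ _ fun s'' p'' hp hw' hF' => hk s'' p'' hp hw' ?_
    exact (hF.mono (by simp +contextual [Cmd.writesVar]) (by simp +contextual [Cmd.writesArr])).trans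
      (hF'.mono (by simp +contextual [Cmd.writesVar]) (by simp +contextual [Cmd.writesArr]))
  exact (Ensures.of_pure_step (x := ⟨.seq C D :: r, s⟩) (by rw [step]) hs this).mono_time (by omega)

theorem Spec.ite {t : Test} {C D : Cmd} {s : State} {p : ℝ} {t₁ : ℕ}
    {Post : State → ℝ → Prop}
    (h₁ : t.Holds c s → Spec c M C s p t₁ Post) (h₂ : ¬t.Holds c s → Spec c M D s p t₁ Post) :
    Spec c M (.ite t C D) s p (t₁ + 1) Post := by
  intro hs G T r hk
  by_cases ht : t.Holds c s
  · refine Ensures.of_pure_step (x := ⟨.ite t C D :: r, s⟩) (T := T + t₁) (y := ⟨C :: r, s⟩) (by rw [step, if_pos ht]) hs ?_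
    exact h₁ ht hs G T r fun s' p' hp hw hF => hk s' p' hp hw
      (hF.mono (by simp +contextual [Cmd.writesVar]) (by simp +contextual [Cmd.writesArr]))
  · refine Ensures.of_pure_step (x := ⟨.ite t C D :: r, s⟩) (T := T + t₁) (y := ⟨D :: r, s⟩) (by rw [step, if_neg ht]) hs ?_
    exact h₂ ht hs G T r fun s' p' hp hw hF => hk s' p' hp hw
      (hF.mono (by simp +contextual [Cmd.writesVar]) (by simp +contextual [Cmd.writesArr]))

theorem Spec.loop_false {t : Test} {C : Cmd} {s : State} {p : ℝ} {Post : State → ℝ → Prop}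
    (ht : ¬t.Holds c s) (h : Post s p) : Spec c M (.loop t C) s p 1 Post := by
  intro hs G T r hk
  exact Ensures.of_pure_step (x := ⟨.loop t C :: r, s⟩) (y := ⟨r, s⟩) (by rw [step, if_neg ht]) hs
    (hk s p h hs (Frame.refl _ _))

theorem Spec.loop_true {t : Test} {C : Cmd} {s : State} {p : ℝ} {t₁ t₂ : ℕ}
    {Mid Post : State → ℝ → Prop} (ht : t.Holds c s) (h₁ : Spec c M C s p t₁ Mid)
    (h₂ : ∀ s' p', Mid s' p' → Frame C s s' → Spec c M (.loop t C) s' p' t₂ Post) :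
    Spec c M (.loop t C) s p (t₁ + t₂ + 1) Post := by
  intro hs G T r hk
  have : Ensures c M G (T + t₂ + t₁) p ⟨C :: .loop t C :: r, s⟩ := by
    refine h₁ hs G _ _ fun s' p' hm hw hF => ?_
    refine h₂ s' p' hm hF hw G _ _ fun s'' p'' hp hw' hF' => hk s'' p'' hp hw' ?_
    exact (hF.mono (D := .loop t C) (fun _ h => h) (fun _ h => h)).trans hF'
  exact (Ensures.of_pure_step (x := ⟨.loop t C :: r, s⟩) (by rw [step, if_pos ht]) hs this).mono_time (by omega)

theorem Spec.rand {d : ℕ} {x : Operand} {s : State} {p : ℝ} {Post : State → ℝ → Prop}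
    (f : ℕ → ℝ) (h : ∀ v ≤ x.eval s, Post (s.setVar d v) (f v))
    (hx : x.eval s ≤ M)
    (hp : p * (x.eval s + 1 : ℕ) ≤ ∑ v ∈ Finset.range (x.eval s + 1), f v) :
    Spec c M (.rand d x) s p 1 Post := by
  intro hs G T r hk
  refine Ensures.of_rand_step hs f (fun v hv => hk _ _ (h v hv) ?_ ?_) hp
  · exact hs.setVar d (hv.trans hx)
  · refine ⟨fun w hw => ?_, fun _ _ => rfl⟩
    have : w ≠ d := by rintro rfl; simp [Cmd.writesVar] at hw
    simp [State.setVar, this]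

/-- The number of steps of a program without loops. -/
def Cmd.cost : Cmd → ℕ
  | .seq p q => p.cost + q.cost + 1
  | .ite _ p q => max p.cost q.cost + 1
  | _ => 1

/-- Variables obey the word bound by assumption on the state, so only constants need checking. -/
def Operand.ConstLE (M : ℕ) : Operand → Prop
  | .const v => v ≤ M
  | .var _ => True

theorem Operand.eval_le {x : Operand} {s : State} (hs : s.WordsLE M) (hx : x.ConstLE M) :
    x.eval s ≤ M := by
  cases x with
  | const v => exact hx
  | var i => exact hs.1 i

/-- The weakest precondition of a deterministic program without loops. -/
def Cmd.wp (c : ℝ) (M : ℕ) : Cmd → (State → Prop) → State → Prop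
  | .skip, Q, s => Q s
  | .op d o x y, Q, s => (match o with
      | .add => x.eval s + y.eval s ≤ M
      | .sub => x.ConstLE M
      | .mul => x.eval s * y.eval s ≤ M
      | .div => x.ConstLE M) ∧ Q (s.setVar d (o.eval (x.eval s) (y.eval s)))
  | .load d a i, Q, s => Q (s.setVar d (s.arr a (i.eval s)))
  | .store a i x, Q, s => x.ConstLE M ∧ Q (s.setArr a (i.eval s) (x.eval s))
  | .rand _ _, _, _ => False
  | .seq p q, Q, s => p.wp c M (q.wp c M Q) s
  | .ite t p q, Q, s => (t.Holds c s → p.wp c M Q s) ∧ (¬t.Holds c s → q.wp c M Q s)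
  | .loop _ _, _, _ => False

theorem Spec.of_wp {C : Cmd} {s : State} {p : ℝ} {Q : State → Prop} (h : C.wp c M Q s) :
    Spec c M C s p C.cost fun s' p' => p' = p ∧ Q s' := by
  induction C generalizing s Q with
  | skip =>
    intro hs G T r hk
    exact Ensures.of_pure_step (x := ⟨.skip :: r, s⟩) (y := ⟨r, s⟩) (by rw [step]) hs
      (hk s p ⟨rfl, h⟩ hs (Frame.refl _ _))
  | op d o x y =>
    intro hs G T r hk
    have hv : o.eval (x.eval s) (y.eval s) ≤ M := by
      cases o with
      | add => exact h.1
      | mul => exact h.1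
      | sub => exact (Nat.sub_le _ _).trans (Operand.eval_le hs h.1)
      | div => exact (Nat.div_le_self _ _).trans (Operand.eval_le hs h.1)
    refine Ensures.of_pure_step (x := ⟨.op d o x y :: r, s⟩) (by rw [step]) hs
      (hk _ p ⟨rfl, h.2⟩ (hs.setVar d hv) ?_)
    refine ⟨fun w hw => ?_, fun _ _ => rfl⟩
    have : w ≠ d := by rintro rfl; simp [Cmd.writesVar] at hw
    simp [State.setVar, this]
  | load d a i =>
    intro hs G T r hk
    refine Ensures.of_pure_step (x := ⟨.load d a i :: r, s⟩) (by rw [step]) hs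
      (hk _ p ⟨rfl, h⟩ (hs.setVar d (hs.2 _ _)) ?_)
    refine ⟨fun w hw => ?_, fun _ _ => rfl⟩
    have : w ≠ d := by rintro rfl; simp [Cmd.writesVar] at hw
    simp [State.setVar, this]
  | store a i x =>
    intro hs G T r hk
    refine Ensures.of_pure_step (x := ⟨.store a i x :: r, s⟩) (by rw [step]) hs
      (hk _ p ⟨rfl, h.2⟩ (hs.setArr a _ (Operand.eval_le hs h.1)) ?_)
    refine ⟨fun _ _ => rfl, fun w hw => ?_⟩
    have : w ≠ a := by rintro rfl; simp [Cmd.writesArr] at hw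
    simp [State.setArr, this]
  | rand d x => exact h.elim
  | seq C D ihC ihD =>
    refine Spec.seq (ihC h) ?_
    rintro s' p' ⟨rfl, h'⟩ -
    exact ihD h'
  | ite t C D ihC ihD =>
    exact Spec.ite (fun ht => (ihC (h.1 ht)).mono (le_max_left _ _) fun _ _ h _ _ => h)
      (fun ht => (ihD (h.2 ht)).mono (le_max_right _ _) fun _ _ h _ _ => h)
  | loop t C => exact h.elim

theorem Spec.of_wp_le {C : Cmd} {s : State} {p : ℝ} {t : ℕ} {Post : State → ℝ → Prop}
    (h : C.wp c M (fun s' => Post s' p) s) (ht : C.cost ≤ t) : Spec c M C s p t Post :=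
  (Spec.of_wp h).mono ht fun _ _ h _ _ => h.1 ▸ h.2

/-- `for i := 0, …, b - 1 do C`, where `i` and `b` are variables. -/
def Cmd.forLoop (i b : ℕ) (C : Cmd) : Cmd :=
  .seq (.op i .add (.const 0) (.const 0))
    (.loop (.lt (.var i) (.var b)) (.seq C (.op i .add (.var i) (.const 1))))

/-- The three extra steps per iteration are the test, the sequencing and the increment; the final
three are the outer sequencing, the initialization and the failing test. -/
theorem Spec.forLoop {i b : ℕ} {C : Cmd} {s : State} {p : ℝ} (I : ℕ → State → ℝ → Prop)
    (t : ℕ → ℕ) (hi : C.writesVar i = false) (hb : C.writesVar b = false) (hib : i ≠ b)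
    (h0 : I 0 (s.setVar i 0) p)
    (hstep : ∀ j < s.var b, ∀ s' p', I j s' p' → s'.var i = j → s'.WordsLE M →
      Frame (.forLoop i b C) s s' →
      Spec c M C s' p' (t j) fun s'' p'' => I (j + 1) (s''.setVar i (j + 1)) p'') :
    Spec c M (.forLoop i b C) s p ((∑ j ∈ Finset.range (s.var b), (t j + 3)) + 3)
      fun s' p' => I (s.var b) s' p' := by
  apply Spec.with_words
  intro hs
  set R := s.var b with hR
  have loop : ∀ k j, j + k = R → ∀ s' p', I j s' p' → s'.var i = j →
      s'.WordsLE M → Frame (.forLoop i b C) s s' →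
      Spec c M (.loop (.lt (.var i) (.var b)) (.seq C (.op i .add (.var i) (.const 1)))) s' p'
        ((∑ l ∈ Finset.Ico j R, (t l + 3)) + 1) fun s' p' => I R s' p' := by
    intro k
    induction k with
    | zero =>
      intro j hj s' p' hI hij hw hF
      obtain rfl : j = R := by omega
      have hb' : s'.var b = s.var b := hF.var b (by simp [Cmd.forLoop, Cmd.writesVar, hb, hib])
      simp only [Finset.Ico_self, Finset.sum_empty, zero_add]
      refine Spec.loop_false ?_ hI
      simp [Test.Holds, Operand.eval, hij, hb', hR]
    | succ k ih =>
      intro j hj s' p' hI hij hw hF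
      have hb' : s'.var b = s.var b := hF.var b (by simp [Cmd.forLoop, Cmd.writesVar, hb, hib])
      have hlt : j < R := by omega
      have body : Spec c M (.seq C (.op i .add (.var i) (.const 1))) s' p' (t j + 1 + 1)
          fun s'' p'' => I (j + 1) s'' p'' ∧ s''.var i = j + 1 ∧ s''.WordsLE M := by
        refine Spec.seq (hstep j hlt s' p' hI hij hw hF) fun s1 p1 h1 hF1 => ?_
        have hi1 : s1.var i = j := (hF1.var i hi).trans hij
        refine (Spec.of_wp (Q := fun s'' => I (j + 1) s'' p1 ∧ s''.var i = j + 1) ?_).mono le_rfl ?_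
        · simp only [Cmd.wp, Operand.eval, BinOp.eval, hi1]
          refine ⟨le_trans (by omega) (hs.1 b), h1, ?_⟩
          simp [State.setVar]
        · rintro s2 p2 ⟨rfl, h2, h3⟩ hw2 -
          exact ⟨h2, h3, hw2⟩
      rw [Finset.sum_eq_sum_Ico_succ_bot hlt]
      refine (Spec.loop_true ?_ body ?_ (t₂ := (∑ l ∈ Finset.Ico (j + 1) R, (t l + 3)) + 1)
        ).mono (by omega) fun _ _ h _ _ => h
      · simp [Test.Holds, Operand.eval, hij, hb', ← hR, hlt]
      · rintro s2 p2 ⟨h1, h2, h3⟩ hF2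
        refine ih (j + 1) (by omega) s2 p2 h1 h2 h3 (hF.trans (hF2.mono ?_ ?_))
        · intro v; simp [Cmd.forLoop, Cmd.writesVar]
        · intro v; simp [Cmd.forLoop, Cmd.writesArr]
  refine (Spec.seq (t₁ := 1) (t₂ := (∑ l ∈ Finset.Ico 0 R, (t l + 3)) + 1)
    (Mid := fun s' p' => s' = s.setVar i 0 ∧ p' = p ∧ s'.WordsLE M) ?_ ?_).mono ?_
    fun _ _ h _ _ => h
  · refine (Spec.of_wp (Q := fun s' => s' = s.setVar i 0) ?_).mono le_rfl ?_
    · simp [Cmd.wp, Operand.eval, BinOp.eval]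
    · rintro s' p' ⟨h1, h2⟩ h3 -
      exact ⟨h2, h1, h3⟩
  · rintro s' p' ⟨rfl, rfl, hw⟩ hF
    refine loop R 0 (by omega) _ _ h0 (by simp [State.setVar]) hw (hF.mono ?_ ?_)
    · intro v; simp +contextual [Cmd.forLoop, Cmd.writesVar]
    · intro v; simp [Cmd.forLoop, Cmd.writesArr]
  · rw [Finset.range_eq_Ico]; omega

theorem Spec.for_le {i b : ℕ} {C : Cmd} {s : State} {p : ℝ} {T R : ℕ}
    {Post : State → ℝ → Prop} (I : ℕ → State → ℝ → Prop)
    (t : ℕ → ℕ) (hi : C.writesVar i = false) (hb : C.writesVar b = false) (hib : i ≠ b)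
    (hR : s.var b = R) (hT : (∑ j ∈ Finset.range R, (t j + 3)) + 3 ≤ T)
    (h0 : I 0 (s.setVar i 0) p)
    (hstep : ∀ j < R, ∀ s' p', I j s' p' → s'.var i = j → s'.WordsLE M →
      Frame (.forLoop i b C) s s' →
      Spec c M C s' p' (t j) fun s'' p'' => I (j + 1) (s''.setVar i (j + 1)) p'')
    (hpost : ∀ s' p', I R s' p' → s'.WordsLE M → Frame (.forLoop i b C) s s' → Post s' p') :
    Spec c M (.forLoop i b C) s p T Post := by
  subst hR
  exact (Spec.forLoop I t hi hb hib h0 hstep).mono hT hpost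

/-- Sequential composition of a list of programs. -/
def Cmd.block : List Cmd → Cmd
  | [] => .skip
  | C :: Cs => .seq C (Cmd.block Cs)

theorem Spec.nil {s : State} {p : ℝ} {t : ℕ} {Post : State → ℝ → Prop} (h : Post s p)
    (ht : 1 ≤ t) : Spec c M (.block []) s p t Post :=
  Spec.of_wp_le h ht

theorem Spec.cons {C : Cmd} {Cs : List Cmd} {s : State} {p : ℝ} {t : ℕ}
    {Post : State → ℝ → Prop} (t₁ t₂ : ℕ) (Mid : State → ℝ → Prop)
    (h₁ : Spec c M C s p t₁ Mid)
    (h₂ : ∀ s' p', Mid s' p' → s'.WordsLE M → Frame C s s' →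
      Spec c M (.block Cs) s' p' t₂ Post)
    (ht : t₁ + t₂ + 1 ≤ t) : Spec c M (.block (C :: Cs)) s p t Post :=
  (Spec.seq (h₁.mono (Post' := fun s' p' => Mid s' p' ∧ s'.WordsLE M) le_rfl
    fun _ _ h hw _ => ⟨h, hw⟩) fun s' p' h hF => h₂ s' p' h.1 h.2 hF).mono ht
    fun _ _ h _ _ => h

theorem Spec.cons_wp {C : Cmd} {Cs : List Cmd} {s : State} {p : ℝ} {t : ℕ}
    {Post : State → ℝ → Prop} (t₂ : ℕ)
    (h : C.wp c M (fun s' => Spec c M (.block Cs) s' p t₂ Post) s)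
    (ht : C.cost + t₂ + 1 ≤ t) : Spec c M (.block (C :: Cs)) s p t Post := by
  refine Spec.cons C.cost t₂ _ (Spec.of_wp h) ?_ ht
  rintro s' p' ⟨rfl, h'⟩ - -
  exact h'

theorem Spec.le_trans {C : Cmd} {s : State} {p : ℝ} {t t' : ℕ} {Post : State → ℝ → Prop}
    (h : Spec c M C s p t Post) (ht : t ≤ t') : Spec c M C s p t' Post :=
  h.mono ht fun _ _ h _ _ => h

/-- `C` writes to none of the given variables and arrays. -/
def Cmd.Keeps (C : Cmd) (vs as : List ℕ) : Bool :=
  vs.all (fun v => !C.writesVar v) && as.all fun a => !C.writesArr a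

theorem Frame.var_eq {C : Cmd} {s s' : State} (h : Frame C s s') {vs as : List ℕ}
    (hC : C.Keeps vs as = true) {v : ℕ} (hv : v ∈ vs) : s'.var v = s.var v := by
  simp only [Cmd.Keeps, Bool.and_eq_true, List.all_eq_true, Bool.not_eq_true'] at hC
  exact h.var v (hC.1 v hv)

theorem Frame.arr_eq {C : Cmd} {s s' : State} (h : Frame C s s') {vs as : List ℕ}
    (hC : C.Keeps vs as = true) {a : ℕ} (ha : a ∈ as) : s'.arr a = s.arr a := by
  simp only [Cmd.Keeps, Bool.and_eq_true, List.all_eq_true, Bool.not_eq_true'] at hC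
  exact h.arr a (hC.2 a ha)

@[simp] theorem State.setVar_var (s : State) (i v j : ℕ) :
    (s.setVar i v).var j = if j = i then v else s.var j := by
  simp [State.setVar, Function.update_apply]

@[simp] theorem State.setVar_arr (s : State) (i v : ℕ) : (s.setVar i v).arr = s.arr := rfl

@[simp] theorem State.setArr_var (s : State) (a i v : ℕ) : (s.setArr a i v).var = s.var := rfl

@[simp] theorem State.setArr_arr (s : State) (a i v b : ℕ) :
    (s.setArr a i v).arr b = if b = a then Function.update (s.arr a) i v else s.arr b := by
  by_cases h : b = a
  · subst h; simp [State.setArr]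
  · simp [State.setArr, h]

end Spec

/-! ### Merging cycles of permutations -/

section Perm

variable {α : Type*} [DecidableEq α]

/-- The new permutation sends `u` to `σ v` and then follows the old cycle of `v`, which never meets
`u`. After `orderOf σ` steps this walk is at `v`. -/
theorem sameCycle_mul_swap_self [Finite α] {σ : Equiv.Perm α} {u v : α} (h : ¬σ.SameCycle u v) :
    (σ * Equiv.swap u v).SameCycle u v := by
  have key : ∀ k : ℕ, (σ * Equiv.swap u v).SameCycle u ((σ ^ (k + 1)) v) := by
    intro k
    induction k with
    | zero => exact ⟨1, by simp⟩
    | succ k ih =>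
      set z := (σ ^ (k + 1)) v with hz
      have hσz : (σ ^ (k + 1 + 1)) v = σ z := by
        rw [pow_succ' σ (k + 1), Equiv.Perm.mul_apply]
      rw [hσz]
      have hzu : z ≠ u := by
        intro hzu
        exact h (Equiv.Perm.SameCycle.symm ⟨(k + 1 : ℕ), by rw [zpow_natCast, ← hz, hzu]⟩)
      by_cases hzv : z = v
      · rw [hzv]; exact ⟨1, by simp⟩
      · have : (σ * Equiv.swap u v) z = σ z := by
          rw [Equiv.Perm.mul_apply, Equiv.swap_apply_of_ne_of_ne hzu hzv]
        rw [← this]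
        exact Equiv.Perm.sameCycle_apply_right.2 ih
  have := key (orderOf σ - 1)
  rwa [Nat.sub_add_cancel (orderOf_pos σ), pow_orderOf_eq_one] at this

/-- It suffices that `x` and `σ x` stay together. The permutations differ only at `u` and `v`, whose
images are exchanged, and these two now share a cycle. -/
theorem sameCycle_mul_swap_of_sameCycle [Finite α] {σ : Equiv.Perm α} {u v x y : α}
    (h : ¬σ.SameCycle u v) (hxy : σ.SameCycle x y) : (σ * Equiv.swap u v).SameCycle x y := by
  have huv := sameCycle_mul_swap_self h
  have step : ∀ x, (σ * Equiv.swap u v).SameCycle x (σ x) := by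
    intro x
    by_cases hu : x = u
    · subst hu
      have : σ x = (σ * Equiv.swap x v) v := by simp
      rw [this]
      exact Equiv.Perm.sameCycle_apply_right.2 huv
    by_cases hv : x = v
    · subst hv
      have : σ x = (σ * Equiv.swap u x) u := by simp
      rw [this]
      exact Equiv.Perm.sameCycle_apply_right.2 huv.symm
    · have : σ x = (σ * Equiv.swap u v) x := by
        rw [Equiv.Perm.mul_apply, Equiv.swap_apply_of_ne_of_ne hu hv]
      rw [this]
      exact Equiv.Perm.sameCycle_apply_right.2 (Equiv.Perm.SameCycle.refl _ _)
  obtain ⟨k, rfl⟩ := hxy.exists_nat_pow_eq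
  clear hxy
  induction k with
  | zero => exact Equiv.Perm.SameCycle.refl _ _
  | succ k ih =>
    rw [pow_succ', Equiv.Perm.mul_apply]
    exact ih.trans (step _)

/-- Each cycle of `σ` contains exactly one element of `R`. -/
def CycleReps (σ : Equiv.Perm α) (R : Set α) : Prop :=
  ∃ f : α → α, (∀ x, f (σ x) = f x) ∧ (∀ r ∈ R, f r = r) ∧ ∀ x, f x ∈ R ∧ σ.SameCycle (f x) x

theorem cycleReps_one {β : Type*} : CycleReps (1 : Equiv.Perm β) Set.univ :=
  ⟨id, by simp⟩

/-- The map to representatives is constant on cycles and fixes `u ≠ v`, so these lie in different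
cycles; the swap merges them, and `v` takes over the cycle of `u`. -/
theorem CycleReps.mul_swap [Finite α] {σ : Equiv.Perm α} {R : Set α} (h : CycleReps σ R)
    {u v : α} (hu : u ∈ R) (hv : v ∈ R) (huv : u ≠ v) :
    CycleReps (σ * Equiv.swap u v) (R \ {u}) := by
  obtain ⟨f, hf, hR, hx⟩ := h
  have hpow : ∀ (k : ℕ) x, f ((σ ^ k) x) = f x := by
    intro k x
    induction k with
    | zero => rfl
    | succ k ih => rw [pow_succ', Equiv.Perm.mul_apply, hf, ih]
  have hns : ¬σ.SameCycle u v := by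
    intro hs
    obtain ⟨k, rfl⟩ := hs.exists_nat_pow_eq
    have := hR _ hv
    rw [hpow, hR _ hu] at this
    exact huv this
  refine ⟨fun x => if f x = u then v else f x, fun x => ?_, fun r hr => ?_, fun x => ?_⟩
  · have e : f ((σ * Equiv.swap u v) x) = f (Equiv.swap u v x) := hf _
    simp only [e]
    by_cases h1 : x = u
    · subst h1; simp [hR _ hu, hR _ hv]
    by_cases h2 : x = v
    · subst h2; simp [hR _ hu, hR _ hv]
    · rw [Equiv.swap_apply_of_ne_of_ne h1 h2]
  · have : r ≠ u := hr.2
    simp [hR _ hr.1, this]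
  · by_cases h1 : f x = u
    · have h2 : σ.SameCycle u x := h1 ▸ (hx x).2
      simp only [h1, if_true]
      exact ⟨⟨hv, huv.symm⟩,
        (sameCycle_mul_swap_self hns).symm.trans (sameCycle_mul_swap_of_sameCycle hns h2)⟩
    · simp only [h1, if_false]
      exact ⟨⟨(hx x).1, h1⟩, sameCycle_mul_swap_of_sameCycle hns (hx x).2⟩

theorem CycleReps.sameCycle {β : Type*} {σ : Equiv.Perm β} {R : Set β} (h : CycleReps σ R)
    (hR : R.Subsingleton) {r : β} (hr : r ∈ R) (x : β) : σ.SameCycle r x := by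
  obtain ⟨f, -, -, hx⟩ := h
  rw [hR hr (hx x).1]
  exact (hx x).2

end Perm

/-! ### Crossings of cyclic orders -/

/-- The number of crossings of `X` with the pairs `x`, `σ x`. -/
def cyclicCrossings {n : ℕ} (σ : Equiv.Perm (Fin n)) (X : Finset (Fin n)) : ℕ :=
  (Finset.univ.filter fun x => ¬(x ∈ X ↔ σ x ∈ X)).card

section Crossings

variable {n : ℕ}

theorem cyclicCrossings_one (X : Finset (Fin n)) : cyclicCrossings 1 X = 0 := by
  simp [cyclicCrossings]

/-- Going from `x` to `σ (τ x)` through `τ x`, a change of membership occurs in one of the two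
moves; reindexing by `τ` counts the second kind. -/
theorem cyclicCrossings_mul_le (σ τ : Equiv.Perm (Fin n)) (X : Finset (Fin n)) :
    cyclicCrossings (σ * τ) X ≤ cyclicCrossings σ X + cyclicCrossings τ X := by
  have h1 : cyclicCrossings σ X =
      (Finset.univ.filter fun x => ¬(τ x ∈ X ↔ σ (τ x) ∈ X)).card := by
    refine (Finset.card_equiv τ fun x => ?_).symm
    simp
  rw [h1, add_comm]
  refine le_trans (Finset.card_le_card fun x hx => ?_) (Finset.card_union_le _ _)
  have hx' : ¬(x ∈ X ↔ σ (τ x) ∈ X) := (Finset.mem_filter.1 hx).2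
  simp only [Finset.mem_filter, Finset.mem_univ, true_and, Finset.mem_union]
  tauto

/-- If `X` separates `x` from `τ x` and `Y` does not, exactly one of them lies in the symmetric
difference. An element is charged at most twice, once as `x` and once as `τ x`. -/
theorem cyclicCrossings_le_symmDiff {τ : Equiv.Perm (Fin n)} {R X Y : Finset (Fin n)}
    (h : ∀ x, τ x ≠ x → x ∈ R ∧ τ x ∈ R ∧ (x ∈ Y ↔ τ x ∈ Y)) :
    cyclicCrossings τ X ≤ 2 * (symmDiff X Y ∩ R).card := by
  have h1 : (Finset.univ.filter fun x => τ x ∈ symmDiff X Y ∩ R).card =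
      (symmDiff X Y ∩ R).card := Finset.card_equiv τ fun x => by simp
  rw [two_mul]
  conv_rhs => arg 2; rw [← h1]
  refine le_trans (Finset.card_le_card fun x hx => ?_) (Finset.card_union_le _ _)
  simp only [Finset.mem_filter, Finset.mem_univ, true_and, Finset.mem_union, Finset.mem_inter,
    Finset.mem_symmDiff] at hx ⊢
  have := h x (fun h => hx (by rw [h]))
  tauto

theorem cyclicCrossings_le_card {τ : Equiv.Perm (Fin n)} {R X : Finset (Fin n)}
    (h : ∀ x, τ x ≠ x → x ∈ R) : cyclicCrossings τ X ≤ R.card := by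
  refine Finset.card_le_card fun x hx => ?_
  simp only [Finset.mem_filter, Finset.mem_univ, true_and] at hx
  exact h x fun h => hx (by rw [h])

/-- A cyclic order can be cut into a linear one. -/
theorem exists_order_of_sameCycle {σ : Equiv.Perm (Fin n)} {r : Fin n}
    (h : ∀ x, σ.SameCycle r x) :
    ∃ e : Equiv.Perm (Fin n), (∀ i : Fin n, e i = (σ ^ i.1) r) ∧
      ∀ X, crossings e X ≤ cyclicCrossings σ X := by
  have hcyc : σ.IsCycleOn (Finset.univ : Finset (Fin n)) := by
    refine ⟨by simp, fun x _ y _ => (h x).symm.trans (h y)⟩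
  have hsurj : Function.Surjective fun i : Fin n => (σ ^ i.1) r := by
    intro y
    obtain ⟨k, hk, hky⟩ := hcyc.exists_pow_eq (Finset.mem_univ r) (Finset.mem_univ y)
    exact ⟨⟨k, by simpa using hk⟩, hky⟩
  let e : Equiv.Perm (Fin n) := Equiv.ofBijective _ (Finite.injective_iff_bijective.1
    (Finite.injective_iff_surjective.2 hsurj))
  have he : ∀ i : Fin n, e i = (σ ^ i.1) r := fun i => rfl
  refine ⟨e, he, fun X => ?_⟩
  -- An adjacent pair of the order is some `x`, `σ x`; only the pair that closes the cycle is lost.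
  refine Finset.card_le_card_of_injOn e (fun i hi => ?_) e.injective.injOn
  simp only [Finset.coe_filter, Finset.mem_univ, true_and, Set.mem_ofPred_eq] at hi ⊢
  obtain ⟨h1, h2⟩ := hi
  rw [he, he] at h2
  rw [he]
  rwa [pow_succ', Equiv.Perm.mul_apply] at h2

theorem crossings_le (e : Equiv.Perm (Fin n)) (X : Finset (Fin n)) : crossings e X ≤ n - 1 := by
  have h : ((Finset.range (n - 1)).card) = n - 1 := Finset.card_range _
  rw [← h]
  refine Finset.card_le_card_of_injOn Fin.val (fun i hi => ?_) Fin.val_injective.injOn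
  simp only [Finset.coe_filter, Finset.mem_univ, true_and, Set.mem_ofPred_eq, Finset.coe_range,
    Set.mem_Iio] at hi ⊢
  obtain ⟨h1, -⟩ := hi
  omega

end Crossings

/-! ### Random samples hitting sets -/

section Hitting

variable {α : Type*} [DecidableEq α]

/-- The number of members of `𝒟` that are disjoint from `B`. -/
def misses (𝒟 : Finset (Finset α)) (B : Finset α) : ℕ :=
  (𝒟.filter fun D => Disjoint D B).card

/-- Linearity of expectation, multiplied by `m`: a member still missed stays missed after one more
uniform draw with probability 1 - |D|/m ≤ `q`. -/
theorem sum_misses_insert_le {m : ℕ} {rep : ℕ → α} (hinj : Set.InjOn rep (Set.Iio m))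
    (𝒟 : Finset (Finset α)) (B : Finset α) {q : ℝ}
    (hsub : ∀ D ∈ 𝒟, D ⊆ (Finset.range m).image rep)
    (hq : ∀ D ∈ 𝒟, (m : ℝ) - D.card ≤ q * m) :
    ∑ v ∈ Finset.range m, (misses 𝒟 (insert (rep v) B) : ℝ) ≤ q * m * misses 𝒟 B := by
  have h1 : ∀ v, (misses 𝒟 (insert (rep v) B) : ℝ) =
      ∑ D ∈ 𝒟.filter (fun D => Disjoint D B), if rep v ∉ D then (1 : ℝ) else 0 := by
    intro v
    rw [misses, Finset.sum_boole, Finset.filter_filter]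
    congr 2
    ext D
    simp only [Finset.mem_filter, Finset.disjoint_insert_right]
    tauto
  simp only [h1]
  rw [Finset.sum_comm]
  have h2 : ∀ D ∈ 𝒟.filter (fun D => Disjoint D B),
      (∑ v ∈ Finset.range m, if rep v ∉ D then (1 : ℝ) else 0) ≤ q * m := by
    intro D hD
    have hD' := (Finset.mem_filter.1 hD).1
    refine le_trans (le_of_eq ?_) (hq D hD')
    rw [Finset.sum_boole]
    have hc : ((Finset.range m).filter fun v => rep v ∈ D).card = D.card := by
      rw [← Finset.card_image_of_injOn (s := (Finset.range m).filter fun v => rep v ∈ D) (f := rep)]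
      · congr 1
        ext x
        simp only [Finset.mem_image, Finset.mem_filter]
        constructor
        · rintro ⟨v, ⟨-, hv⟩, rfl⟩; exact hv
        · intro hx
          obtain ⟨v, hv, rfl⟩ := Finset.mem_image.1 (hsub D hD' hx)
          exact ⟨v, ⟨hv, hx⟩, rfl⟩
      · refine hinj.mono fun v hv => ?_
        simpa using (Finset.mem_filter.1 (Finset.mem_coe.1 hv)).1
    have := Finset.card_filter_add_card_filter_not (s := Finset.range m) (fun v => rep v ∈ D)
    rw [hc, Finset.card_range] at this
    have h3 : ((D.card + ((Finset.range m).filter fun v => rep v ∉ D).card : ℕ) : ℝ) = m := by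
      rw [this]
    push_cast at h3
    linarith
  refine (Finset.sum_le_sum h2).trans (le_of_eq ?_)
  rw [Finset.sum_const, nsmul_eq_mul, misses]
  ring

end Hitting

/-! ### Set systems with linear shatter functions -/

section Shatter

variable {n : ℕ}

theorem card_image_inter_le (F : Finset (Finset (Fin n))) (B : Finset (Fin n)) {k : ℕ}
    (hk : B.card ≤ k) : (F.image fun X => X ∩ B).card ≤ shatterFunction F k :=
  Finset.le_sup (f := fun A => (F.image fun X => X ∩ A).card) (by simpa using hk)

/-- The symmetric differences of more than `δ` elements of the traces on `R`. -/
noncomputable def largeDifferences (F : Finset (Finset (Fin n))) (R : Finset (Fin n)) (δ : ℝ) :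
    Finset (Finset (Fin n)) :=
  ((F.image fun X => X ∩ R) ×ˢ (F.image fun X => X ∩ R)).image (fun p => symmDiff p.1 p.2)
    |>.filter fun D => δ < D.card

theorem card_largeDifferences_le (F : Finset (Finset (Fin n))) (R : Finset (Fin n)) (δ : ℝ) :
    (largeDifferences F R δ).card ≤ shatterFunction F R.card ^ 2 := by
  refine (Finset.card_filter_le _ _).trans (Finset.card_image_le.trans ?_)
  rw [Finset.card_product, sq]
  exact Nat.mul_le_mul (card_image_inter_le F R le_rfl) (card_image_inter_le F R le_rfl)

theorem symmDiff_inter_eq (X Y R : Finset (Fin n)) :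
    symmDiff X Y ∩ R = symmDiff (X ∩ R) (Y ∩ R) := by
  ext x
  simp only [Finset.mem_inter, Finset.mem_symmDiff]
  tauto

theorem subset_of_mem_largeDifferences {F : Finset (Finset (Fin n))} {R : Finset (Fin n)} {δ : ℝ}
    {D : Finset (Fin n)} (h : D ∈ largeDifferences F R δ) : D ⊆ R := by
  obtain ⟨h, -⟩ := Finset.mem_filter.1 h
  obtain ⟨⟨S, T⟩, hST, rfl⟩ := Finset.mem_image.1 h
  obtain ⟨hS, hT⟩ := Finset.mem_product.1 hST
  obtain ⟨X, -, rfl⟩ := Finset.mem_image.1 hS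
  obtain ⟨Y, -, rfl⟩ := Finset.mem_image.1 hT
  dsimp only
  rw [← symmDiff_inter_eq]
  exact Finset.inter_subset_right

/-- Otherwise the difference on `R` would be one of the large ones, hence meet `B`, where the two
sets agree. -/
theorem card_symmDiff_le_of_misses_eq_zero {F : Finset (Finset (Fin n))} {R B : Finset (Fin n)}
    {δ : ℝ} (h : misses (largeDifferences F R δ) B = 0) {X Y : Finset (Fin n)}
    (hX : X ∈ F) (hY : Y ∈ F) (hXY : ∀ u ∈ B, u ∈ X ↔ u ∈ Y) :
    ((symmDiff X Y ∩ R).card : ℝ) ≤ δ := by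
  by_contra! hlt
  rw [misses, Finset.card_eq_zero, Finset.filter_eq_empty_iff] at h
  refine h (x := symmDiff X Y ∩ R) ?_ ?_
  · refine Finset.mem_filter.2 ⟨?_, hlt⟩
    refine Finset.mem_image.2 ⟨(X ∩ R, Y ∩ R), ?_, (symmDiff_inter_eq X Y R).symm⟩
    exact Finset.mem_product.2 ⟨Finset.mem_image_of_mem _ hX, Finset.mem_image_of_mem _ hY⟩
  · rw [Finset.disjoint_left]
    intro x hx hxB
    have := hXY x hxB
    simp only [Finset.mem_inter, Finset.mem_symmDiff] at hx
    tauto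

/-- Elements separated by sets with different traces on a small set are few. -/
theorem card_le_of_separated {F : Finset (Finset (Fin n))} {c : ℝ} (hc : 1 ≤ c)
    (hF : ∀ k : ℕ, 1 ≤ k → (shatterFunction F k : ℝ) ≤ c * k)
    (hF' : ∀ k : ℕ, 1 ≤ k → (dualShatterFunction F k : ℝ) ≤ c * k)
    {B R : Finset (Fin n)} {A : Finset (Finset (Fin n))} {b : ℕ} (hb : 1 ≤ b) (hB : B.card ≤ b)
    (hA : A ⊆ F) (hAB : Set.InjOn (fun X => X ∩ B) (A : Set (Finset (Fin n))))
    (hR : ∀ u ∈ R, ∀ v ∈ R, (∀ X ∈ A, u ∈ X ↔ v ∈ X) → u = v) :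
    (R.card : ℝ) ≤ c ^ 2 * b := by
  have hb' : (1 : ℝ) ≤ b := by exact_mod_cast hb
  have hAc : (A.card : ℝ) ≤ c * b := by
    refine le_trans ?_ (hF b hb)
    rw [← Finset.card_image_of_injOn hAB]
    exact_mod_cast (Finset.card_le_card (Finset.image_subset_image hA)).trans
      (card_image_inter_le F B hB)
  -- The dual bound says nothing for zero sets; but then no elements are separated, so `R` has at
  -- most one.
  rcases Finset.eq_empty_or_nonempty A with rfl | hne
  · have : R.card ≤ 1 := Finset.card_le_one.2 fun u hu v hv => hR u hu v hv (by simp)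
    have : (R.card : ℝ) ≤ 1 := by exact_mod_cast this
    nlinarith
  -- In the dual system `A` becomes a set of points, and distinct elements of `R` have distinct
  -- traces on it.
  · let A' : Finset {X // X ∈ F} := Finset.univ.filter fun X => X.1 ∈ A
    have hA' : A'.card = A.card := by
      refine Finset.card_bij (fun X _ => X.1) (fun X hX => (Finset.mem_filter.1 hX).2)
        (fun X _ Y _ h => Subtype.ext h) fun X hX => ⟨⟨X, hA hX⟩, ?_, rfl⟩
      exact Finset.mem_filter.2 ⟨Finset.mem_univ _, hX⟩
    have h1 : R.card ≤ dualShatterFunction F A.card := by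
      have h2 : ((dualFamily F).image fun X => X ∩ A').card ≤ dualShatterFunction F A.card :=
        Finset.le_sup (f := fun A => ((dualFamily F).image fun X => X ∩ A).card)
          (by simp [hA'])
      refine le_trans ?_ h2
      refine Finset.card_le_card_of_injOn
        (fun u => (Finset.univ.filter fun X : {X // X ∈ F} => u ∈ X.1) ∩ A') ?_ ?_
      · intro u _
        exact Finset.mem_image_of_mem _ (Finset.mem_image_of_mem _ (Finset.mem_univ u))
      · intro u hu v hv huv
        refine hR u hu v hv fun X hX => ?_
        have := Finset.ext_iff.1 huv ⟨X, hA hX⟩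
        simpa [A', hX] using this
    have h3 := hF' A.card (Finset.card_pos.2 hne)
    have h4 : (R.card : ℝ) ≤ dualShatterFunction F A.card := by exact_mod_cast h1
    calc (R.card : ℝ) ≤ c * A.card := h4.trans h3
      _ ≤ c * (c * b) := by gcongr
      _ = c ^ 2 * b := by ring

end Shatter

/-! ### Estimates -/

/-- The sample size. -/
def sampleSize (k m : ℕ) : ℕ := 32 * m / (k * k)

/-- Since k² ≥ 64c², the sample size is at most m/(2c²). This is what halves the number of cycles.
-/
theorem two_mul_le_of_le_sampleSize {c : ℝ} (hc : 1 ≤ c) {k m r : ℕ} (hk : 8 * c < k)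
    (hr : (r : ℝ) ≤ c ^ 2 * sampleSize k m) : 2 * r ≤ m := by
  have h1 : ((sampleSize k m * (k * k) : ℕ) : ℝ) ≤ (32 * m : ℕ) := by
    exact_mod_cast Nat.div_mul_le_self _ _
  push_cast at h1
  have h2 : 64 * c ^ 2 ≤ (k : ℝ) * k := by nlinarith
  have h3 : (64 : ℝ) * r ≤ 32 * m := by
    have : (0 : ℝ) ≤ sampleSize k m := Nat.cast_nonneg _
    nlinarith [mul_le_mul_of_nonneg_left h2 this]
  have : 64 * r ≤ 32 * m := by exact_mod_cast h3
  omega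

theorem one_le_sampleSize {k m : ℕ} (hk : 0 < k) (hm : k * k ≤ m) : 1 ≤ sampleSize k m :=
  (Nat.one_le_div_iff (by positivity)).2 (by omega)

/-- The size of symmetric differences that the sample is likely to hit. -/
noncomputable def hitSize (c : ℝ) (m : ℕ) : ℝ := 8 * c ^ 2 * Real.logb 2 m

/-- A union bound over `N` differences, each missed by all draws with probability at most m⁻⁴. The
result c²/m² is at most 1/(64m) because 64c² ≤ k² ≤ m. -/
theorem fail_bound {c : ℝ} (hc : 1 ≤ c) {k m : ℕ} (hk : 8 * c < k) (hk' : (k : ℝ) ≤ 9 * c)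
    (hm : k * k ≤ m) {N : ℕ} (hN : (N : ℝ) ≤ (c * m) ^ 2) :
    (N : ℝ) * Real.exp (-hitSize c m / m) ^ sampleSize k m ≤ 1 / (64 * m) := by
  have hk0 : 0 < k := by
    have : (0 : ℝ) < k := by linarith
    exact_mod_cast this
  have hm0 : 0 < m := lt_of_lt_of_le (by positivity) hm
  have hmR : (1 : ℝ) ≤ m := by exact_mod_cast hm0
  have hmk : (k : ℝ) * k ≤ m := by exact_mod_cast hm
  set b := sampleSize k m with hb
  -- Rounding down loses less than k² ≤ m out of 32m, and k² ≤ 81c².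
  have hbm : 31 * (m : ℝ) ≤ b * (81 * c ^ 2) := by
    have h1 : 32 * m < (b + 1) * (k * k) := by
      rw [hb, sampleSize, mul_comm (_ + 1)]
      exact Nat.lt_mul_div_succ (32 * m) (show 0 < k * k by positivity)
    have h2 : ((32 * m : ℕ) : ℝ) < ((b + 1) * (k * k) : ℕ) := by exact_mod_cast h1
    push_cast at h2
    have h3 : (k : ℝ) * k ≤ 81 * c ^ 2 := by nlinarith
    have : (0 : ℝ) ≤ b := Nat.cast_nonneg _
    nlinarith [mul_le_mul_of_nonneg_left h3 this]
  have hlog : 0 ≤ Real.log m := Real.log_nonneg hmR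
  -- The constants work because 8 · 31/81 > 4 ln 2.
  have hexp : 4 * Real.log m ≤ b * (hitSize c m / m) := by
    have hl2 : Real.log 2 < 0.6931471808 := Real.log_two_lt_d9
    have hl0 : 0 < Real.log 2 := Real.log_pos (by norm_num)
    have e : b * (hitSize c m / m) = (8 * b * c ^ 2 / (m * Real.log 2)) * Real.log m := by
      rw [hitSize, Real.logb]
      field_simp
    rw [e]
    refine mul_le_mul_of_nonneg_right ?_ hlog
    rw [le_div_iff₀ (by positivity)]
    nlinarith
  have hpow : Real.exp (-hitSize c m / m) ^ b ≤ ((m : ℝ) ^ 4)⁻¹ := by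
    rw [← Real.exp_nat_mul]
    have : ((m : ℝ) ^ 4)⁻¹ = Real.exp (-(4 * Real.log m)) := by
      rw [Real.exp_neg, show 4 * Real.log m = ((4 : ℕ) : ℝ) * Real.log m by norm_num,
        Real.exp_nat_mul, Real.exp_log (by linarith)]
    rw [this]
    refine Real.exp_le_exp.2 ?_
    rw [neg_div, mul_neg]
    linarith
  calc (N : ℝ) * Real.exp (-hitSize c m / m) ^ b ≤ (c * m) ^ 2 * ((m : ℝ) ^ 4)⁻¹ := by
        refine mul_le_mul hN hpow (by positivity) (by positivity)
    _ = c ^ 2 / m ^ 2 := by field_simp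
    _ ≤ 1 / (64 * m) := by
        rw [div_le_div_iff₀ (by positivity) (by positivity)]
        have : 64 * c ^ 2 ≤ m := by nlinarith
        nlinarith

/-- The crossings that are still to be expected when `m` cycles remain. -/
noncomputable def budget (c : ℝ) (m : ℕ) : ℝ :=
  if m ≤ 1 then 0 else 8 * c ^ 2 * (Real.logb 2 m * (Real.logb 2 m + 1)) + 81 * c ^ 2

/-- The success probability guaranteed when `m` cycles remain. -/
noncomputable def successBound (m : ℕ) : ℝ := 2 / 3 + 1 / (3 * m)

/-- Halving lowers ℓ = log m by at least one, and (ℓ-1)ℓ + 2ℓ = ℓ(ℓ+1): this determines the shape of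
the budget. -/
theorem budget_step {c : ℝ} {m m' : ℕ} (hm' : 1 ≤ m') (h : 2 * m' ≤ m) :
    budget c m' + 2 * hitSize c m ≤ budget c m := by
  have hm : ¬m ≤ 1 := by omega
  have hl1 : 1 ≤ Real.logb 2 m := by
    rw [Real.le_logb_iff_rpow_le (by norm_num) (by exact_mod_cast (by omega : 0 < m))]
    have : (2 : ℝ) ≤ m := by exact_mod_cast (by omega : 2 ≤ m)
    simpa using this
  rw [budget, budget, if_neg hm, hitSize]
  split_ifs with h1
  · nlinarith [sq_nonneg c, mul_nonneg (sq_nonneg c) (by nlinarith : 0 ≤ Real.logb 2 m *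
      (Real.logb 2 m - 1))]
  · have hl0 : 0 ≤ Real.logb 2 m' := Real.logb_nonneg (by norm_num) (by exact_mod_cast hm')
    have hl : Real.logb 2 m' + 1 ≤ Real.logb 2 m := by
      have h2 : Real.logb 2 (2 * m') = 1 + Real.logb 2 m' := by
        rw [Real.logb_mul (by norm_num) (by positivity), Real.logb_self_eq_one (by norm_num)]
      rw [add_comm, ← h2]
      exact Real.logb_le_logb_of_le (by norm_num) (by positivity) (by exact_mod_cast h)
    have h3 : Real.logb 2 m' * (Real.logb 2 m' + 1) + 2 * Real.logb 2 m ≤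
        Real.logb 2 m * (Real.logb 2 m + 1) := by nlinarith
    nlinarith [mul_le_mul_of_nonneg_left h3 (sq_nonneg c)]

/-- The constant term of the budget alone pays for merging all remaining cycles at once. -/
theorem le_budget {c : ℝ} {k m : ℕ} (hm : 2 ≤ m) (hc : 1 ≤ c) (hk' : (k : ℝ) ≤ 9 * c)
    (h : m ≤ k * k) : (m : ℝ) ≤ budget c m := by
  have h1 : (m : ℝ) ≤ k * k := by exact_mod_cast h
  have h2 : (k : ℝ) * k ≤ 81 * c ^ 2 := by nlinarith [(Nat.cast_nonneg k : (0 : ℝ) ≤ k)]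
  have hl0 : 0 ≤ Real.logb 2 m :=
    Real.logb_nonneg (by norm_num) (by exact_mod_cast (by omega : 1 ≤ m))
  rw [budget, if_neg (by omega)]
  have : 0 ≤ 8 * c ^ 2 * (Real.logb 2 m * (Real.logb 2 m + 1)) := by positivity
  linarith

/-- The success probability guaranteed after a good sample when `m` cycles remained before. -/
noncomputable def halvedBound (m : ℕ) : ℝ := 2 / 3 + 2 / (3 * m)

/-- Halving the number of cycles gains 1/(3m), while a failure probability of at most 1/(64m) costs
less. -/
theorem successBound_le_halvedBound {m : ℕ} (hm : 2 ≤ m) {φ : ℝ} (hφ : φ ≤ 1 / (64 * m)) :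
    successBound m ≤ halvedBound m * (1 - φ) := by
  have hm2 : (2 : ℝ) ≤ m := by exact_mod_cast hm
  have e1 : successBound m = 2 / 3 + (1 / m) / 3 := by rw [successBound]; field_simp
  have e2 : halvedBound m = 2 / 3 + 2 * (1 / m) / 3 := by rw [halvedBound]; field_simp
  have e3 : 1 / (64 * (m : ℝ)) = (1 / m) / 64 := by field_simp
  have h4 : 1 / (m : ℝ) ≤ 1 / 2 := one_div_le_one_div_of_le (by norm_num) hm2
  have h6 : 0 < 1 / (m : ℝ) := by positivity
  rw [e3] at hφ
  rw [e1, e2]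
  generalize 1 / (m : ℝ) = x at *
  nlinarith [mul_le_mul_of_nonneg_left hφ (by linarith : 0 ≤ 2 / 3 + 2 * x / 3)]

theorem halvedBound_le_successBound {m m' : ℕ} (hm' : 1 ≤ m') (h : 2 * m' ≤ m) :
    halvedBound m ≤ successBound m' := by
  have h0 : (0 : ℝ) < m' := by exact_mod_cast hm'
  have h1 : (0 : ℝ) < m := by exact_mod_cast (by omega : 0 < m)
  have h2 : (2 : ℝ) * m' ≤ m := by exact_mod_cast h
  have h3 : 2 / (3 * (m : ℝ)) ≤ 1 / (3 * m') := by
    rw [div_le_div_iff₀ (by positivity) (by positivity)]; linarith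
  rw [halvedBound, successBound]
  linarith

theorem halvedBound_nonneg (m : ℕ) : 0 ≤ halvedBound m := by
  rw [halvedBound]; positivity

theorem successBound_le_one {m : ℕ} (hm : 1 ≤ m) : successBound m ≤ 1 := by
  have h0 : (1 : ℝ) ≤ m := by exact_mod_cast hm
  have : 1 / (3 * (m : ℝ)) ≤ 1 / 3 := one_div_le_one_div_of_le (by norm_num) (by linarith)
  rw [successBound]; linarith

theorem two_thirds_le_successBound (m : ℕ) : 2 / 3 ≤ successBound m := by
  rw [successBound]
  have : (0 : ℝ) ≤ 1 / (3 * (m : ℝ)) := by positivity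
  linarith

/-- Either the required bound is trivial, or the budget satisfies it. -/
theorem budget_le {c : ℝ} {n : ℕ}
    (h : 12 * c ^ 2 * Real.logb 2 n ^ 2 < (n - 1 : ℕ)) (hc : 1 ≤ c) :
    budget c n ≤ 12 * c ^ 2 * Real.logb 2 n ^ 2 := by
  by_cases hn : n ≤ 1
  · rw [budget, if_pos hn]; positivity
  have hn1 : ((n - 1 : ℕ) : ℝ) ≤ n := by exact_mod_cast Nat.sub_le _ _
  have hlog : ∀ j : ℕ, 2 ^ j ≤ n → (j : ℝ) ≤ Real.logb 2 n := by
    intro j hj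
    rw [Real.le_logb_iff_rpow_le (by norm_num) (by exact_mod_cast (by omega : 0 < n)),
      Real.rpow_natCast]
    exact_mod_cast hj
  -- A bootstrap: `j = 1` gives n > 12, which allows `j = 3` and n > 108, which allows the bound 6 ≤
  -- log n.
  have hgrow : ∀ j : ℕ, 2 ^ j ≤ n → 12 * j ^ 2 < n := by
    intro j hj
    have h1 := hlog j hj
    have h0 : (0 : ℝ) ≤ j := Nat.cast_nonneg j
    have : (12 * (j : ℝ) ^ 2) < n := by
      refine lt_of_le_of_lt ?_ (h.trans_le hn1)
      have h2 : (j : ℝ) ^ 2 ≤ Real.logb 2 n ^ 2 := pow_le_pow_left₀ h0 h1 2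
      have h3 : 1 ≤ c ^ 2 := one_le_pow₀ hc
      nlinarith [sq_nonneg (Real.logb 2 n)]
    exact_mod_cast this
  have h13 := hgrow 1 (by omega)
  have h108 := hgrow 3 (by omega)
  have hL : (6 : ℝ) ≤ Real.logb 2 n := by exact_mod_cast hlog 6 (by omega)
  rw [budget, if_neg hn]
  generalize Real.logb 2 n = ℓ at *
  -- For ℓ ≥ 6 the difference 4ℓ² - 8ℓ is at least 96.
  have h3 : 8 * (ℓ * (ℓ + 1)) + 81 ≤ 12 * ℓ ^ 2 := by nlinarith
  nlinarith [mul_le_mul_of_nonneg_left h3 (sq_nonneg c)]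

/-! ### The program -/

local notation "v_n" => (0 : ℕ)
local notation "v_sets" => (1 : ℕ)
local notation "v_k" => (2 : ℕ)
local notation "v_i" => (3 : ℕ)
local notation "v_j" => (4 : ℕ)
local notation "v_pos" => (5 : ℕ)
local notation "v_len" => (6 : ℕ)
local notation "v_t" => (7 : ℕ)
local notation "v_u" => (8 : ℕ)
local notation "v_d" => (9 : ℕ)
local notation "v_start" => (10 : ℕ)
local notation "v_base" => (11 : ℕ)
local notation "v_fresh" => (12 : ℕ)
local notation "v_label" => (13 : ℕ)
local notation "v_cycles" => (14 : ℕ)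
local notation "v_draws" => (15 : ℕ)
local notation "v_kept" => (16 : ℕ)
local notation "v_square" => (17 : ℕ)
local notation "v_x" => (18 : ℕ)
local notation "v_last" => (19 : ℕ)
local notation "a_in" => (0 : ℕ)
local notation "a_out" => (1 : ℕ)
local notation "a_off" => (2 : ℕ)
local notation "a_len" => (3 : ℕ)
local notation "a_deg" => (4 : ℕ)
local notation "a_inc" => (5 : ℕ)
local notation "a_rep" => (6 : ℕ)
local notation "a_next" => (7 : ℕ)
local notation "a_mark" => (8 : ℕ)
local notation "a_elemLabel" => (9 : ℕ)
local notation "a_setLabel" => (10 : ℕ)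
local notation "a_newLabel" => (11 : ℕ)
local notation "a_seen" => (12 : ℕ)
local notation "a_lead" => (13 : ℕ)

/-- Refine the partition given by the labels in the array `l` by the set whose elements are
listed in the cells `v_start, …, v_start + v_len - 1` of the array `a`. -/
def refineBy (a l : ℕ) : Cmd :=
  .block [
    .op v_base .add (.var v_fresh) (.const 0),
    .forLoop v_j v_len (.block [
      .op v_t .add (.var v_start) (.var v_j),
      .load v_x a (.var v_t),
      .load v_label l (.var v_x),
      .load v_d a_newLabel (.var v_label),
      .ite (.lt (.var v_d) (.var v_base))
        (.block [
          .store a_newLabel (.var v_label) (.var v_fresh),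
          .op v_d .add (.var v_fresh) (.const 0),
          .op v_fresh .add (.var v_fresh) (.const 1)])
        .skip,
      .store l (.var v_x) (.var v_d)])]

/-- The least natural number above `8 * c`, unless that exceeds `n + 8`. -/
def approximateParam : Cmd :=
  .block [
    .op v_k .add (.const 8) (.const 0),
    .forLoop v_i v_n (.ite (.leParam (.var v_k) (.const 8))
      (.op v_k .add (.var v_k) (.const 1)) .skip),
    .op v_square .mul (.var v_k) (.var v_k)]

def initCycles : Cmd :=
  .block [
    .forLoop v_i v_n (.block [
      .store a_rep (.var v_i) (.var v_i),
      .store a_next (.var v_i) (.var v_i)]),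
    .op v_cycles .add (.var v_n) (.const 0),
    .op v_fresh .add (.const 1) (.const 0)]

/-- Locate the sets in the input, and list for every element the sets that contain it. -/
def parseInput : Cmd :=
  .block [
    .op v_pos .add (.const 2) (.const 0),
    .forLoop v_i v_sets (.block [
      .load v_len a_in (.var v_pos),
      .store a_len (.var v_i) (.var v_len),
      .op v_pos .add (.var v_pos) (.const 1),
      .store a_off (.var v_i) (.var v_pos),
      .forLoop v_j v_len (.block [
        .op v_t .add (.var v_pos) (.var v_j),
        .load v_u a_in (.var v_t),
        .load v_d a_deg (.var v_u),
        .op v_t .mul (.var v_u) (.var v_sets),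
        .op v_t .add (.var v_t) (.var v_d),
        .store a_inc (.var v_t) (.var v_i),
        .op v_d .add (.var v_d) (.const 1),
        .store a_deg (.var v_u) (.var v_d)]),
      .op v_pos .add (.var v_pos) (.var v_len)])]

def resetLabels : Cmd :=
  .block [
    .forLoop v_i v_n (.block [
      .store a_mark (.var v_i) (.const 0),
      .store a_elemLabel (.var v_i) (.var v_fresh)]),
    .forLoop v_i v_sets (.store a_setLabel (.var v_i) (.var v_fresh)),
    .op v_fresh .add (.var v_fresh) (.const 1)]

/-- Mark a random sample of the representatives. -/
def drawSample : Cmd :=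
  .forLoop v_i v_draws (.block [
    .rand v_x (.var v_last),
    .load v_u a_rep (.var v_x),
    .store a_mark (.var v_u) (.const 1)])

/-- Classify the sets by their intersections with the sample. -/
def classifySets : Cmd :=
  .forLoop v_i v_n (.block [
    .load v_t a_mark (.var v_i),
    .ite (.lt (.const 0) (.var v_t))
      (.block [
        .op v_start .mul (.var v_i) (.var v_sets),
        .load v_len a_deg (.var v_i),
        refineBy a_inc a_setLabel])
      .skip])

/-- Classify the elements by their membership in the first set of every class of sets. -/
def classifyElements : Cmd :=
  .forLoop v_i v_sets (.block [
    .load v_label a_setLabel (.var v_i),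
    .load v_t a_seen (.var v_label),
    .ite (.lt (.var v_t) (.const 1))
      (.block [
        .store a_seen (.var v_label) (.const 1),
        .load v_start a_off (.var v_i),
        .load v_len a_len (.var v_i),
        refineBy a_in a_elemLabel])
      .skip])

/-- Merge the cycles whose representatives have the same label. -/
def mergeCycles : Cmd :=
  .block [
    .op v_kept .add (.const 0) (.const 0),
    .forLoop v_i v_cycles (.block [
      .load v_u a_rep (.var v_i),
      .load v_label a_elemLabel (.var v_u),
      .load v_t a_lead (.var v_label),
      .ite (.lt (.var v_t) (.const 1))
        (.block [
          .op v_t .add (.var v_u) (.const 1),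
          .store a_lead (.var v_label) (.var v_t),
          .store a_rep (.var v_kept) (.var v_u),
          .op v_kept .add (.var v_kept) (.const 1)])
        (.block [
          .op v_t .sub (.var v_t) (.const 1),
          .load v_x a_next (.var v_u),
          .load v_d a_next (.var v_t),
          .store a_next (.var v_u) (.var v_d),
          .store a_next (.var v_t) (.var v_x)])]),
    .op v_cycles .add (.var v_kept) (.const 0)]

def sampleAndClassify : Cmd :=
  .block [
    .op v_draws .mul (.const 32) (.var v_cycles),
    .op v_draws .div (.var v_draws) (.var v_square),
    .op v_last .sub (.var v_cycles) (.const 1),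
    drawSample,
    classifySets,
    classifyElements]

def mergeRound : Cmd :=
  .block [
    resetLabels,
    .ite (.lt (.var v_cycles) (.var v_square)) .skip sampleAndClassify,
    mergeCycles]

def writeOrder : Cmd :=
  .block [
    .load v_x a_rep (.const 0),
    .forLoop v_i v_n (.block [
      .store a_out (.var v_i) (.var v_x),
      .load v_x a_next (.var v_x)])]

def orderProgram : Cmd :=
  .block [
    .load v_n a_in (.const 0),
    .load v_sets a_in (.const 1),
    approximateParam,
    initCycles,
    parseInput,
    .loop (.lt (.const 1) (.var v_cycles)) mergeRound,
    writeOrder]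

/-! ### Partition refinement -/

/-- The list `P` is stored in the array `a` from the cell `start` on. -/
def State.Lists (s : State) (a start : ℕ) (P : List ℕ) : Prop :=
  ∀ j (hj : j < P.length), s.arr a (start + j) = P[j]

/-- All labels in use are smaller than the next label to be issued. -/
structure LabelsBelow (l : ℕ) (s : State) : Prop where
  label : ∀ x, s.arr l x < s.var v_fresh
  new : ∀ x, s.arr a_newLabel x < s.var v_fresh

/-- Labels are never reused. An entry of `a_newLabel` below `v_base` is thus a leftover from an
earlier call, and the entries from `v_base` on send old labels injectively to new ones. No array has
to be cleared, so the time depends on `P` only. -/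
theorem refineBy_spec {c : ℝ} {M : ℕ} {a l : ℕ} (hal : a ≠ l) (ha : a ≠ a_newLabel)
    (hl : l ≠ a_newLabel) {s : State} {p : ℝ} {P : List ℕ} (hP : s.Lists a (s.var v_start) P)
    (hlen : s.var v_len = P.length) (hnd : P.Nodup) (hM : s.var v_start + P.length ≤ M)
    (hM' : s.var v_fresh + P.length ≤ M) (hlab : LabelsBelow l s) :
    Spec c M (refineBy a l) s p (30 * P.length + 30) fun s' p' => p' = p ∧
      LabelsBelow l s' ∧ s.var v_fresh ≤ s'.var v_fresh ∧
      s'.var v_fresh ≤ s.var v_fresh + P.length ∧ (∀ x, s.arr l x ≤ s'.arr l x) ∧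
      ∀ x y, s'.arr l x = s'.arr l y ↔ s.arr l x = s.arr l y ∧ (x ∈ P ↔ y ∈ P) := by
  set F := s.var v_fresh with hF
  let I : ℕ → State → ℝ → Prop := fun j s' p' => p' = p ∧ s'.var v_base = F ∧
    F ≤ s'.var v_fresh ∧ s'.var v_fresh ≤ F + j ∧
    (∀ x, s'.arr a_newLabel x < s'.var v_fresh) ∧
    (∀ x y, F ≤ s'.arr a_newLabel x → s'.arr a_newLabel x = s'.arr a_newLabel y → x = y) ∧
    (∀ x ∈ P.take j, s'.arr l x = s'.arr a_newLabel (s.arr l x) ∧ F ≤ s'.arr l x) ∧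
    ∀ x, x ∉ P.take j → s'.arr l x = s.arr l x
  refine Spec.cons 1 (30 * P.length + 10) (fun s' p' => p' = p ∧ s' = s.setVar v_base F)
    ?_ ?_ (by omega)
  · refine Spec.of_wp_le ?_ le_rfl
    simp only [Cmd.wp, Operand.eval, BinOp.eval, ← hF]
    exact ⟨by omega, trivial, rfl⟩
  rintro s1 p1 ⟨rfl, rfl⟩ - -
  refine Spec.cons (30 * P.length + 3) 1 (I P.length) ?_ ?_ (by omega)
  · refine Spec.for_le (R := P.length) I (fun _ => 20) rfl rfl (by decide) (by simp [hlen])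
      (by simp; omega) ?_ ?_ fun _ _ h _ _ => h
    · refine ⟨rfl, by simp, by simp [← hF], by simp [← hF], by simpa [← hF] using hlab.new,
        ?_, ?_, ?_⟩
      · intro x y hx
        have := hlab.new x
        simp at hx
        omega
      · simp
      · simp
    rintro j hj s' p' ⟨rfl, hb, hF1, hF2, hn, hinj, hin, hout⟩ hjv hw hfr
    have hst : s'.var v_start = s.var v_start := (hfr.var v_start rfl).trans (by simp)
    have hPj : s'.arr a (s.var v_start + j) = P[j] := by
      rw [← hP j hj, hfr.arr a]
      · simp
      · simp [Cmd.forLoop, Cmd.block, Cmd.writesArr, ha.symm, hal.symm]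
    have hnotin : P[j] ∉ P.take j := by
      intro hmem
      obtain ⟨i, hi, hij⟩ := List.getElem_of_mem hmem
      rw [List.getElem_take] at hij
      have := (List.Nodup.getElem_inj_iff hnd).1 hij
      simp at hi
      omega
    have htake : ∀ x, x ∈ P.take (j + 1) ↔ x ∈ P.take j ∨ x = P[j] := by
      intro x
      rw [← List.take_append_getElem hj, List.mem_append, List.mem_singleton]
    have hcl := hout _ hnotin
    have hclF := hlab.label P[j]
    rw [← hF] at hclF
    refine Spec.of_wp_le ?_ (by simp [Cmd.cost, Cmd.block])
    simp [Cmd.wp, Cmd.block, Operand.eval, BinOp.eval, Test.Holds, Operand.ConstLE, hst, hjv, hPj,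
      hb, hcl]
    have hne : ∀ x ∈ P.take j, x ≠ P[j] := fun x hx h => hnotin (h ▸ hx)
    refine ⟨by omega, fun hd => ⟨by omega, by omega, ?_⟩, fun hd => ?_⟩
    · refine ⟨rfl, by simp [hb], by simp; omega, by simp; omega, ?_, ?_, ?_, ?_⟩
      · intro x
        have := hn x
        by_cases hx : x = s.arr l P[j]
        · simp [hl.symm, hx]
        · simp [hl.symm, hx]; omega
      · intro x y
        have h1 := hn x
        have h2 := hn y
        by_cases hx : x = s.arr l P[j] <;> by_cases hy : y = s.arr l P[j]
        · simp [hx, hy]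
        · simp [hl.symm, hx, hy]; omega
        · simp [hl.symm, hx, hy]; omega
        · simpa [hl.symm, hx, hy] using hinj x y
      · intro x hx
        rcases (htake x).1 hx with hx | rfl
        · have h1 : s.arr l x ≠ s.arr l P[j] := by
            intro h
            have := hin x hx
            rw [h] at this
            omega
          simpa [hl, hl.symm, hne x hx, h1] using hin x hx
        · simpa [hl, hl.symm] using hF1
      · intro x hx
        rw [htake, not_or] at hx
        simpa [hl, hx.2] using hout x hx.1
    · refine ⟨rfl, by simp [hb], by simpa using hF1, by simp; omega, ?_, ?_, ?_, ?_⟩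
      · simpa [hl.symm] using hn
      · simpa [hl.symm] using hinj
      · intro x hx
        rcases (htake x).1 hx with hx | rfl
        · simpa [hl.symm, hne x hx] using hin x hx
        · simpa [hl.symm] using hd
      · intro x hx
        rw [htake, not_or] at hx
        simpa [hx.2] using hout x hx.1
  · rintro s' p' ⟨rfl, hb, hF1, hF2, hn, hinj, hin, hout⟩ hw hfr
    simp only [List.take_length] at hin hout
    have hlt : ∀ x, s.arr l x < F := fun x => hlab.label x
    refine Spec.nil ⟨rfl, ⟨fun x => ?_, hn⟩, hF1, hF2, fun x => ?_, fun x y => ?_⟩ le_rfl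
    · by_cases hx : x ∈ P
      · rw [(hin x hx).1]; exact hn _
      · rw [hout x hx]; exact (hlt x).trans_le hF1
    · by_cases hx : x ∈ P
      · exact (hlt x).le.trans (hin x hx).2
      · rw [hout x hx]
    · have := hlt x
      have := hlt y
      by_cases hx : x ∈ P <;> by_cases hy : y ∈ P <;> simp only [hx, hy, and_true, iff_true, iff_false,
        not_true_eq_false, and_false]
      · rw [(hin x hx).1, (hin y hy).1]
        refine ⟨hinj _ _ ?_, fun h => by rw [h]⟩
        rw [← (hin x hx).1]; exact (hin x hx).2
      · have := (hin x hx).2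
        rw [hout y hy]; omega
      · have := (hin y hy).2
        rw [hout x hx]; omega
      · rw [hout x hx, hout y hy]

/-! ### The representation of the set system -/

section Tables

variable {n : ℕ}

/-- The elements of the set number `i`. -/
def row (L : List (List (Fin n))) (i : ℕ) : List ℕ := (L.getD i []).map Fin.val

/-- The numbers of the sets that contain `u`. -/
def col (L : List (List (Fin n))) (u : ℕ) : List ℕ :=
  (List.range L.length).filter fun i => u ∈ row L i

theorem col_nodup (L : List (List (Fin n))) (u : ℕ) : (col L u).Nodup :=
  List.nodup_range.filter _

theorem row_nodup {L : List (List (Fin n))} (hL : ∀ l ∈ L, l.Nodup) (i : ℕ) :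
    (row L i).Nodup := by
  refine List.Nodup.map Fin.val_injective ?_
  by_cases hi : i < L.length
  · rw [List.getD_eq_getElem _ _ hi]
    exact hL _ (List.getElem_mem hi)
  · rw [List.getD_eq_default _ _ (by omega)]
    exact List.nodup_nil

theorem mem_row {L : List (List (Fin n))} {i : ℕ} (hi : i < L.length) (u : Fin n) :
    u.1 ∈ row L i ↔ u ∈ L[i].toFinset := by
  simp [row, List.getElem?_eq_getElem hi, Fin.val_inj]

theorem mem_col {L : List (List (Fin n))} {i u : ℕ} (hi : i < L.length) :
    i ∈ col L u ↔ u ∈ row L i := by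
  simp [col, hi]

theorem length_col_le (L : List (List (Fin n))) (u : ℕ) : (col L u).length ≤ L.length :=
  (List.length_filter_le _ _).trans (by simp)

/-- The total number of incidences. -/
def total (L : List (List (Fin n))) : ℕ := ∑ i ∈ Finset.range L.length, (row L i).length

theorem sum_length_col {L : List (List (Fin n))} (hL : ∀ l ∈ L, l.Nodup) :
    ∑ u ∈ Finset.range n, (col L u).length = total L := by
  have h1 : ∀ u, (col L u).length = ∑ i ∈ Finset.range L.length, if u ∈ row L i then 1 else 0 := by
    intro u
    rw [← List.toFinset_card_of_nodup (col_nodup L u), Finset.sum_boole, Nat.cast_id]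
    congr 1
    ext i
    simp [col]
  simp only [h1, total]
  rw [Finset.sum_comm]
  refine Finset.sum_congr rfl fun i _ => ?_
  rw [← List.toFinset_card_of_nodup (row_nodup hL i), Finset.sum_boole, Nat.cast_id]
  congr 1
  ext u
  simp only [Finset.mem_filter, Finset.mem_range, List.mem_toFinset, and_iff_right_iff_imp]
  intro hu
  obtain ⟨v, -, rfl⟩ := List.mem_map.1 hu
  exact v.2

/-- The tables that do not change during the rounds. -/
structure Tables (L : List (List (Fin n))) (k M : ℕ) (s : State) : Prop where
  n_eq : s.var v_n = n
  sets_eq : s.var v_sets = L.length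
  square_eq : s.var v_square = k * k
  len : ∀ i < L.length, s.arr a_len i = (row L i).length
  off_le : ∀ i < L.length, s.arr a_off i + (row L i).length ≤ M
  rows : ∀ i < L.length, s.Lists a_in (s.arr a_off i) (row L i)
  deg : ∀ u < n, s.arr a_deg u = (col L u).length
  cols : ∀ u < n, s.Lists a_inc (u * L.length) (col L u)
  inc_le : n * L.length ≤ M

theorem Tables.congr {L : List (List (Fin n))} {k M : ℕ} {s s' : State} (h : Tables L k M s)
    (hv : ∀ v ∈ [v_n, v_sets, v_square], s'.var v = s.var v)
    (ha : ∀ a ∈ [a_in, a_off, a_len, a_deg, a_inc], s'.arr a = s.arr a) : Tables L k M s' := by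
  simp only [List.mem_cons, List.not_mem_nil, or_false, forall_eq_or_imp, forall_eq] at hv ha
  obtain ⟨h1, h2, h3⟩ := hv
  obtain ⟨h4, h5, h6, h7, h8⟩ := ha
  exact ⟨by rw [h1, h.n_eq], by rw [h2, h.sets_eq], by rw [h3, h.square_eq], by rw [h6]; exact h.len,
    by rw [h5]; exact h.off_le, by unfold State.Lists; rw [h4, h5]; exact h.rows,
    by rw [h7]; exact h.deg, by unfold State.Lists; rw [h8]; exact h.cols, h.inc_le⟩

theorem Tables.frame {L : List (List (Fin n))} {k M : ℕ} {s s' : State} {C : Cmd}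
    (h : Tables L k M s) (hF : Frame C s s')
    (hC : C.Keeps [v_n, v_sets, v_square] [a_in, a_off, a_len, a_deg, a_inc] = true) :
    Tables L k M s' :=
  h.congr (fun _ hv => hF.var_eq hC hv) fun _ ha => hF.arr_eq hC ha

end Tables

/-! ### Classification of sets and elements -/

section Classify

variable {c : ℝ} {n k M : ℕ} {L : List (List (Fin n))}

theorem LabelsBelow.congr {l : ℕ} {s s' : State} (h : LabelsBelow l s)
    (h1 : s'.arr l = s.arr l) (h2 : s'.arr a_newLabel = s.arr a_newLabel)
    (h3 : s'.var v_fresh = s.var v_fresh) : LabelsBelow l s' :=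
  ⟨by rw [h1, h3]; exact h.label, by rw [h2, h3]; exact h.new⟩

/-- The loop runs over all elements and not over the draws, so an element drawn repeatedly refines
only once, and the total work is bounded by the number of incidences. -/
theorem classifySets_spec {s : State} {p : ℝ} (hs : Tables L k M s)
    (hlab : LabelsBelow a_setLabel s)
    (hM : s.var v_fresh + ∑ u ∈ Finset.range n, (col L u).length ≤ M) :
    Spec c M classifySets s p (∑ u ∈ Finset.range n, (30 * (col L u).length + 60) + 3)
      fun s' p' => p' = p ∧ LabelsBelow a_setLabel s' ∧ s.var v_fresh ≤ s'.var v_fresh ∧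
        s'.var v_fresh ≤ s.var v_fresh + ∑ u ∈ Finset.range n, (col L u).length ∧
        (∀ i, s.arr a_setLabel i ≤ s'.arr a_setLabel i) ∧
        ∀ i j, s'.arr a_setLabel i = s'.arr a_setLabel j ↔ s.arr a_setLabel i = s.arr a_setLabel j ∧
          ∀ u < n, 0 < s.arr a_mark u → (i ∈ col L u ↔ j ∈ col L u) := by
  refine Spec.for_le (R := n) (fun v s' p' => p' = p ∧ LabelsBelow a_setLabel s' ∧
      s.var v_fresh ≤ s'.var v_fresh ∧
      s'.var v_fresh ≤ s.var v_fresh + ∑ u ∈ Finset.range v, (col L u).length ∧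
      (∀ i, s.arr a_setLabel i ≤ s'.arr a_setLabel i) ∧
      ∀ i j, s'.arr a_setLabel i = s'.arr a_setLabel j ↔ s.arr a_setLabel i = s.arr a_setLabel j ∧
        ∀ u < v, 0 < s.arr a_mark u → (i ∈ col L u ↔ j ∈ col L u))
    (fun u => 30 * (col L u).length + 50) rfl rfl (by decide) hs.n_eq ?_ ?_ ?_
    fun _ _ h _ _ => h
  · refine Nat.add_le_add_right (Finset.sum_le_sum fun u _ => ?_) _
    omega
  · exact ⟨rfl, hlab.congr (by simp) (by simp) (by simp), by simp, by simp, by simp, by simp⟩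
  rintro v hv s1 p1 ⟨rfl, hl1, hf1, hf1', hm1, he1⟩ hvi hw hF
  have hs1 : Tables L k M s1 := hs.frame hF (by decide)
  have hmark : s1.arr a_mark = s.arr a_mark := hF.arr _ (by decide)
  have hsum : ∑ u ∈ Finset.range (v + 1), (col L u).length ≤
      ∑ u ∈ Finset.range n, (col L u).length :=
    Finset.sum_le_sum_of_subset (Finset.range_mono hv)
  rw [Finset.sum_range_succ] at hsum
  have hinc : v * L.length + L.length ≤ M :=
    le_trans (by rw [← Nat.succ_mul]; exact Nat.mul_le_mul_right _ hv) hs1.inc_le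
  have hcol := length_col_le L v
  refine Spec.cons_wp (30 * (col L v).length + 45) ?_ (by simp only [Cmd.cost]; omega)
  simp only [Cmd.wp, Operand.eval, hvi, hmark]
  refine Spec.cons (30 * (col L v).length + 41) 1 _ (Spec.ite (t₁ := 30 * (col L v).length + 40)
    ?_ ?_) (fun _ _ h _ _ => Spec.nil h le_rfl) (by omega)
  · intro ht
    simp [Test.Holds, Operand.eval] at ht
    refine Spec.cons_wp (30 * (col L v).length + 37) ?_ (by simp only [Cmd.cost]; omega)
    simp [Cmd.wp, Operand.eval, BinOp.eval, hvi, hs1.sets_eq]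
    refine ⟨by omega, ?_⟩
    refine Spec.cons_wp (30 * (col L v).length + 34) ?_ (by simp only [Cmd.cost]; omega)
    simp [Cmd.wp, Operand.eval, hvi, hs1.deg v hv]
    refine Spec.cons (30 * (col L v).length + 30) 1 _ (refineBy_spec (P := col L v) (by decide)
      (by decide) (by decide) ?_ (by simp) (col_nodup L v) ?_ ?_ ?_) ?_ (by omega)
    · simpa [State.Lists] using hs1.cols v hv
    · simp; omega
    · simp; omega
    · exact hl1.congr (by simp) (by simp) (by simp)
    rintro s2 p2 ⟨rfl, hl2, hf2, hf2', hm2, he2⟩ - -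
    simp at hf2 hf2' hm2 he2
    refine Spec.nil ⟨rfl, hl2.congr (by simp) (by simp) (by simp), ?_, ?_, ?_, ?_⟩ le_rfl
    · omega
    · rw [Finset.sum_range_succ]; omega
    · exact fun i => (hm1 i).trans (hm2 i)
    · intro i j
      rw [he2, he1, and_assoc, and_congr_right_iff]
      intro _
      constructor
      · rintro ⟨h1, h2⟩ u hu hmu
        rcases (show u < v ∨ u = v by omega) with hu | rfl
        · exact h1 u hu hmu
        · exact h2
      · exact fun h => ⟨fun u hu => h u (by omega), h v (by omega) ht⟩
  · intro ht
    simp [Test.Holds, Operand.eval] at ht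
    refine Spec.of_wp_le ?_ (by simp only [Cmd.cost]; omega)
    refine ⟨rfl, hl1.congr (by simp) (by simp) (by simp), ?_, ?_, ?_, ?_⟩
    · simpa using hf1
    · simp [Finset.sum_range_succ]; omega
    · simpa using hm1
    · intro i j
      simp only [State.setVar_arr]
      rw [he1, and_congr_right_iff]
      refine fun _ => ⟨fun h u hu hmu => ?_, fun h u hu => h u (by omega)⟩
      rcases (show u < v ∨ u = v by omega) with hu | rfl
      · exact h u hu hmu
      · omega

/-- The entry of `a_seen` at a label at least `f` is zero exactly until the first set with that
label has been treated. Labels issued later are still unseen at the end, which replaces clearing the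
array. -/
theorem classifyElements_spec {s : State} {p : ℝ} {f : ℕ} (hs : Tables L k M s)
    (hL : ∀ l ∈ L, l.Nodup) (hM : s.var v_fresh + total L ≤ M) (hM1 : 1 ≤ M)
    (hlab : LabelsBelow a_elemLabel s) (hf : ∀ i < L.length, f ≤ s.arr a_setLabel i)
    (hf' : ∀ i < L.length, s.arr a_setLabel i < s.var v_fresh)
    (hff : f ≤ s.var v_fresh) (hseen : ∀ l, f ≤ l → s.arr a_seen l = 0) :
    Spec c M classifyElements s p
      (∑ i ∈ Finset.range L.length, (30 * (row L i).length + 60) + 3)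
      fun s' p' => p' = p ∧ LabelsBelow a_elemLabel s' ∧ s.var v_fresh ≤ s'.var v_fresh ∧
        s'.var v_fresh ≤ s.var v_fresh + total L ∧
        (∀ x, s.arr a_elemLabel x ≤ s'.arr a_elemLabel x) ∧
        (∀ x y, s'.arr a_elemLabel x = s'.arr a_elemLabel y ↔
          s.arr a_elemLabel x = s.arr a_elemLabel y ∧ ∀ i < L.length,
            (∀ j < i, s.arr a_setLabel j ≠ s.arr a_setLabel i) → (x ∈ row L i ↔ y ∈ row L i)) ∧
        ∀ l, s.var v_fresh ≤ l → s'.arr a_seen l = 0 := by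
  refine Spec.for_le (R := L.length) (fun v s' p' => p' = p ∧ LabelsBelow a_elemLabel s' ∧
      s.var v_fresh ≤ s'.var v_fresh ∧
      s'.var v_fresh ≤ s.var v_fresh + ∑ i ∈ Finset.range v, (row L i).length ∧
      (∀ x, s.arr a_elemLabel x ≤ s'.arr a_elemLabel x) ∧
      (∀ x y, s'.arr a_elemLabel x = s'.arr a_elemLabel y ↔
        s.arr a_elemLabel x = s.arr a_elemLabel y ∧ ∀ i < v,
          (∀ j < i, s.arr a_setLabel j ≠ s.arr a_setLabel i) → (x ∈ row L i ↔ y ∈ row L i)) ∧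
      ∀ l, f ≤ l → (s'.arr a_seen l = 0 ↔ ∀ i < v, s.arr a_setLabel i ≠ l))
    (fun i => 30 * (row L i).length + 50) rfl rfl (by decide) hs.sets_eq ?_ ?_ ?_ ?_
  · refine Nat.add_le_add_right (Finset.sum_le_sum fun u _ => ?_) _
    omega
  · exact ⟨rfl, hlab.congr (by simp) (by simp) (by simp), by simp, by simp, by simp, by simp,
      by simpa using hseen⟩
  · rintro v hv s1 p1 ⟨rfl, hl1, hf1, hf1', hm1, he1, hseen1⟩ hvi hw hF
    have hs1 : Tables L k M s1 := hs.frame hF (by decide)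
    have hset : s1.arr a_setLabel = s.arr a_setLabel := hF.arr _ (by decide)
    have hsum : ∑ i ∈ Finset.range (v + 1), (row L i).length ≤ total L :=
      Finset.sum_le_sum_of_subset (Finset.range_mono hv)
    rw [Finset.sum_range_succ] at hsum
    have hoff := hs1.off_le v hv
    refine Spec.cons_wp (30 * (row L v).length + 47) ?_ (by simp only [Cmd.cost]; omega)
    simp only [Cmd.wp, Operand.eval, hvi, hset]
    refine Spec.cons_wp (30 * (row L v).length + 45) ?_ (by simp only [Cmd.cost]; omega)
    simp only [Cmd.wp, Operand.eval, State.setVar_var, if_true, State.setVar_arr]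
    refine Spec.cons (30 * (row L v).length + 43) 1 _ (Spec.ite (t₁ := 30 * (row L v).length + 42)
      ?_ ?_) (fun _ _ h _ _ => Spec.nil h le_rfl) (by omega)
    · intro ht
      simp [Test.Holds, Operand.eval] at ht
      have hfirst := (hseen1 _ (hf v hv)).1 ht
      refine Spec.cons_wp (30 * (row L v).length + 39) ?_ (by simp only [Cmd.cost]; omega)
      simp [Cmd.wp, Operand.eval, Operand.ConstLE]
      refine ⟨hM1, ?_⟩
      refine Spec.cons_wp (30 * (row L v).length + 36) ?_ (by simp only [Cmd.cost]; omega)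
      simp [Cmd.wp, Operand.eval, hvi]
      refine Spec.cons_wp (30 * (row L v).length + 33) ?_ (by simp only [Cmd.cost]; omega)
      simp [Cmd.wp, Operand.eval, hvi, hs1.len v hv]
      refine Spec.cons (30 * (row L v).length + 30) 1 _ ((refineBy_spec (P := row L v) (by decide)
        (by decide) (by decide) ?_ (by simp) (row_nodup hL v) ?_ ?_ ?_).mono le_rfl
        fun s2 p2 h _ hF2 => And.intro h (hF2.arr a_seen (by decide))) ?_ (by omega)
      · simpa [State.Lists] using hs1.rows v hv
      · simpa using hoff
      · simp; omega
      · exact hl1.congr (by simp) (by simp) (by simp)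
      rintro s2 p2 ⟨⟨rfl, hl2, hf2, hf2', hm2, he2⟩, hseen2⟩ - -
      simp at hf2 hf2' hm2 he2 hseen2
      refine Spec.nil ⟨rfl, hl2.congr (by simp) (by simp) (by simp), ?_, ?_, ?_, ?_, ?_⟩ le_rfl
      · omega
      · rw [Finset.sum_range_succ]; omega
      · exact fun i => (hm1 i).trans (hm2 i)
      · intro x y
        rw [he2, he1, and_assoc, and_congr_right_iff]
        intro _
        constructor
        · rintro ⟨h1, h2⟩ i hi hmi
          rcases (show i < v ∨ i = v by omega) with hi | rfl
          · exact h1 i hi hmi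
          · exact h2
        · exact fun h => ⟨fun i hi => h i (by omega), h v (by omega) hfirst⟩
      · intro l hl
        rw [hseen2]
        by_cases hlv : l = s.arr a_setLabel v
        · simp only [hlv, Function.update_self, one_ne_zero, false_iff, not_forall]
          exact ⟨v, by omega, by simp⟩
        · simp only [Function.update_of_ne hlv]
          rw [hseen1 l hl]
          refine ⟨fun h i hi => ?_, fun h i hi => h i (by omega)⟩
          rcases (show i < v ∨ i = v by omega) with hi | rfl
          · exact h i hi
          · exact Ne.symm hlv
    · intro ht
      simp [Test.Holds, Operand.eval] at ht
      have hnot : ∃ j < v, s.arr a_setLabel j = s.arr a_setLabel v := by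
        by_contra! hcon
        have := (hseen1 _ (hf v hv)).2 hcon
        omega
      obtain ⟨j, hj, hjv⟩ := hnot
      refine Spec.of_wp_le ?_ (by simp only [Cmd.cost]; omega)
      refine ⟨rfl, hl1.congr (by simp) (by simp) (by simp), ?_, ?_, ?_, ?_, ?_⟩
      · simpa using hf1
      · simp [Finset.sum_range_succ]; omega
      · simpa using hm1
      · intro x y
        simp only [State.setVar_arr]
        rw [he1, and_congr_right_iff]
        refine fun _ => ⟨fun h i hi hmi => ?_, fun h i hi => h i (by omega)⟩
        rcases (show i < v ∨ i = v by omega) with hi | rfl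
        · exact h i hi hmi
        · exact absurd hjv (hmi j hj)
      · intro l hl
        simp only [State.setVar_arr]
        rw [hseen1 l hl]
        refine ⟨fun h i hi => ?_, fun h i hi => h i (by omega)⟩
        rcases (show i < v ∨ i = v by omega) with hi | rfl
        · exact h i hi
        · exact hjv ▸ h j hj
  · rintro s1 p1 ⟨rfl, hl1, hf1, hf1', hm1, he1, hseen1⟩ - -
    refine ⟨rfl, hl1, hf1, hf1', hm1, he1, fun l hl => ?_⟩
    have hfl : ∀ i < L.length, s.arr a_setLabel i ≠ l := fun i hi h => by
      have := hf' i hi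
      omega
    exact (hseen1 l (hff.trans hl)).2 hfl

end Classify

/-! ### The phases of a round: resetting labels, sampling, merging -/

section Rounds

variable {c : ℝ} {n k M : ℕ} {L : List (List (Fin n))}

/-- Giving everything one fresh label restarts both partitions and makes old entries of `a_seen` and
`a_lead` harmless. -/
theorem resetLabels_spec {s : State} {p : ℝ} (hs : Tables L k M s)
    (hel : LabelsBelow a_elemLabel s) (hset : LabelsBelow a_setLabel s)
    (hM : s.var v_fresh + 1 ≤ M) :
    Spec c M resetLabels s p (10 * n + 10 * L.length + 20) fun s' p' => p' = p ∧
      s'.var v_fresh = s.var v_fresh + 1 ∧ (∀ u < n, s'.arr a_mark u = 0) ∧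
      (∀ u < n, s'.arr a_elemLabel u = s.var v_fresh) ∧
      (∀ i < L.length, s'.arr a_setLabel i = s.var v_fresh) ∧
      LabelsBelow a_elemLabel s' ∧ LabelsBelow a_setLabel s' := by
  set F := s.var v_fresh with hF
  refine Spec.cons (10 * n + 3) (10 * L.length + 15) (fun s' p' => p' = p ∧
    (∀ u < n, s'.arr a_mark u = 0 ∧ s'.arr a_elemLabel u = F) ∧ ∀ u, s'.arr a_elemLabel u ≤ F)
    ?_ ?_ (by omega)
  · refine Spec.for_le (R := n) (fun v s' p' => p' = p ∧
      (∀ u < v, s'.arr a_mark u = 0 ∧ s'.arr a_elemLabel u = F) ∧ ∀ u, s'.arr a_elemLabel u ≤ F)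
      (fun _ => 6) rfl rfl (by decide) hs.n_eq (by simp; omega) ?_ ?_ fun _ _ h _ _ => h
    · exact ⟨rfl, by simp, fun u => (hel.label u).le⟩
    rintro v hv s1 p1 ⟨rfl, h1, h2⟩ hvi hw hFr
    have hF1 : s1.var v_fresh = F := hFr.var _ rfl
    refine Spec.of_wp_le ?_ (by decide)
    simp [Cmd.wp, Cmd.block, Operand.eval, Operand.ConstLE, hvi, hF1]
    refine ⟨fun u hu => ?_, fun u => ?_⟩
    · by_cases huv : u = v
      · simp [huv]
      · simpa [huv] using h1 u (by omega)
    · by_cases huv : u = v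
      · simp [huv]
      · simpa [huv] using h2 u
  rintro s1 p1 ⟨rfl, h1, h2⟩ - hFr1
  have hs1 : Tables L k M s1 := hs.frame hFr1 (by decide)
  have hF1 : s1.var v_fresh = F := hFr1.var _ rfl
  refine Spec.cons (10 * L.length + 3) 5 (fun s' p' => p' = p1 ∧ s'.var v_fresh = F ∧
    s'.arr a_mark = s1.arr a_mark ∧ s'.arr a_elemLabel = s1.arr a_elemLabel ∧
    s'.arr a_newLabel = s.arr a_newLabel ∧
    (∀ i < L.length, s'.arr a_setLabel i = F) ∧ ∀ i, s'.arr a_setLabel i ≤ F) ?_ ?_ (by omega)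
  · refine Spec.for_le (R := L.length) (fun v s' p' => p' = p1 ∧
      (∀ i < v, s'.arr a_setLabel i = F) ∧ ∀ i, s'.arr a_setLabel i ≤ F)
      (fun _ => 6) rfl rfl (by decide) hs1.sets_eq (by simp; omega) ?_ ?_ ?_
    · refine ⟨rfl, by simp, fun u => ?_⟩
      rw [State.setVar_arr, hFr1.arr a_setLabel rfl]
      exact (hset.label u).le
    · rintro v hv s2 p2 ⟨rfl, h3, h4⟩ hvi hw hFr
      have hF2 : s2.var v_fresh = F := (hFr.var _ rfl).trans hF1
      refine Spec.of_wp_le ?_ (by decide)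
      simp [Cmd.wp, Operand.eval, Operand.ConstLE, hvi, hF2]
      refine ⟨fun i hi => ?_, fun i => ?_⟩
      · by_cases hiv : i = v
        · simp [hiv]
        · simpa [hiv] using h3 i (by omega)
      · by_cases hiv : i = v
        · simp [hiv]
        · simpa [hiv] using h4 i
    · rintro s2 p2 ⟨rfl, h3, h4⟩ - hFr2
      exact ⟨rfl, (hFr2.var _ rfl).trans hF1, hFr2.arr _ rfl, hFr2.arr _ rfl,
        (hFr2.arr _ rfl).trans (hFr1.arr _ rfl), h3, h4⟩
  rintro s2 p2 ⟨rfl, hf, hm, he, hn, h3, h4⟩ - -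
  have hnew : ∀ x, s.arr a_newLabel x < F := hel.new
  refine Spec.of_wp_le ?_ (by decide)
  simp [Cmd.wp, Cmd.block, Operand.eval, BinOp.eval, hf, hm, he]
  refine ⟨hM, fun u hu => (h1 u hu).1, fun u hu => (h1 u hu).2, h3, ⟨?_, ?_⟩, ⟨?_, ?_⟩⟩
  · intro x; have := h2 x; simp [he]; omega
  · intro x; have := hnew x; simp [hn]; omega
  · intro x; have := h4 x; simp; omega
  · intro x; have := hnew x; simp [hn]; omega

/-- The first `R.length` cells of the array of representatives hold `R`. -/
def State.HasReps (s : State) (R : List (Fin n)) : Prop :=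
  s.Lists a_rep 0 (R.map Fin.val)

theorem State.HasReps.get {s : State} {R : List (Fin n)} (h : s.HasReps R) {j : ℕ}
    (hj : j < R.length) : s.arr a_rep j = (R[j]).1 := by
  have := h j (by simpa using hj)
  simpa using this

/-- Conditional expectations: after `j` draws the bound is `g` times one minus an upper bound for
the expected number of members missed in the end, as each later draw contributes a factor `q`. At
the end any miss makes the bound nonpositive. -/
theorem drawSample_spec {s : State} {R : List (Fin n)} {b : ℕ} {g q : ℝ}
    (hR : s.HasReps R) (hnd : R.Nodup) (hR0 : R ≠ []) (hb : s.var v_draws = b) (hM : 1 ≤ M)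
    (hlast : s.var v_last = R.length - 1) (hmark : ∀ u < n, s.arr a_mark u = 0)
    {𝒟 : Finset (Finset (Fin n))} (hsub : ∀ D ∈ 𝒟, D ⊆ R.toFinset) (hg : 0 ≤ g) (hq0 : 0 ≤ q)
    (hq : ∀ D ∈ 𝒟, (R.length : ℝ) - D.card ≤ q * R.length) :
    Spec c M drawSample s (g * (1 - 𝒟.card * q ^ b)) (20 * b + 3) fun s' p' =>
      ∃ B : Finset (Fin n), B ⊆ R.toFinset ∧ B.card ≤ b ∧
        (∀ u : Fin n, 0 < s'.arr a_mark u ↔ u ∈ B) ∧ p' = g * (1 - misses 𝒟 B) := by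
  refine Spec.for_le (R := b) (fun j s' p' => ∃ B : Finset (Fin n), B ⊆ R.toFinset ∧ B.card ≤ j ∧
        (∀ u : Fin n, 0 < s'.arr a_mark u ↔ u ∈ B) ∧
        p' = g * (1 - misses 𝒟 B * q ^ (b - j)))
      (fun _ => 17) rfl rfl (by decide) hb (by simp; omega) ?_ ?_ ?_
  · exact ⟨∅, by simp, by simp, fun u => by simp [hmark u u.2], by simp [misses]⟩
  · rintro j hj s1 p1 ⟨B, hBR, hBj, hBm, rfl⟩ hji hw hF
    have hlast1 : s1.var v_last = R.length - 1 := (hF.var _ rfl).trans hlast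
    have hR1 : s1.HasReps R := by
      unfold State.HasReps State.Lists
      rw [hF.arr a_rep rfl]
      exact hR
    have hpos : 0 < R.length := List.length_pos_iff.2 hR0
    -- The default value is never drawn; it only makes the function total.
    let rep : ℕ → Fin n := fun v => R.getD v R[0]
    have hrep : ∀ v (hv : v < R.length), rep v = R[v] := fun v hv => List.getD_eq_getElem _ _ hv
    refine Spec.cons 1 10 (fun s2 p2 => ∃ v < R.length, s2 = s1.setVar v_x v ∧
      p2 = g * (1 - misses 𝒟 (insert (rep v) B) * q ^ (b - j - 1))) ?_ ?_ (by omega)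
    · have hxe : (Operand.var v_last).eval s1 + 1 = R.length := by
        simp only [Operand.eval, hlast1]; omega
      refine Spec.rand
        (fun v => g * (1 - misses 𝒟 (insert (rep v) B) * q ^ (b - j - 1))) ?_ ?_ ?_
      · exact fun v hv => ⟨v, by omega, rfl, rfl⟩
      · exact hw.1 _
      · rw [hxe, ← Finset.mul_sum, Finset.sum_sub_distrib, ← Finset.sum_mul]
        have hinj : Set.InjOn rep (Set.Iio R.length) := by
          intro v hv w hw h
          rw [hrep v hv, hrep w hw] at h
          exact (List.Nodup.getElem_inj_iff hnd).1 h
        have himg : (Finset.range R.length).image rep = R.toFinset := by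
          ext x
          simp only [Finset.mem_image, Finset.mem_range, List.mem_toFinset]
          constructor
          · rintro ⟨v, hv, rfl⟩
            rw [hrep v hv]; exact List.getElem_mem hv
          · intro hx
            obtain ⟨v, hv, rfl⟩ := List.getElem_of_mem hx
            exact ⟨v, hv, hrep v hv⟩
        have key := sum_misses_insert_le hinj 𝒟 B (by rw [himg]; exact hsub) hq
        have hpow : q ^ (b - j) = q * q ^ (b - j - 1) := by
          rw [← pow_succ']; congr 1; omega
        rw [hpow]
        have hk := mul_le_mul_of_nonneg_right key (pow_nonneg hq0 (b - j - 1))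
        simp only [Finset.sum_const, Finset.card_range, nsmul_eq_mul, mul_one]
        rw [mul_assoc]
        refine mul_le_mul_of_nonneg_left ?_ hg
        linarith
    · rintro s2 p2 ⟨v, hv, rfl, rfl⟩ - -
      refine Spec.of_wp_le ?_ (by decide)
      simp [Cmd.wp, Cmd.block, Operand.eval, Operand.ConstLE, hR1.get hv]
      refine ⟨hM, insert (rep v) B, ?_, ?_, ?_, ?_⟩
      · refine Finset.insert_subset ?_ hBR
        rw [hrep v hv]; simp
      · exact (Finset.card_insert_le _ _).trans (by omega)
      · intro u
        rw [hrep v hv, Finset.mem_insert]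
        by_cases huv : u = R[v]
        · simp [huv]
        · have : u.1 ≠ (R[v]).1 := fun h => huv (Fin.ext h)
          simpa [this, huv] using hBm u
      · rw [Nat.sub_sub]; exact Or.inl rfl
  · rintro s' p' ⟨B, h1, h2, h3, h4⟩ - -
    exact ⟨B, h1, h2, h3, by simpa using h4⟩

/-- Exchanging the successors of `u` and `v` multiplies the permutation by their transposition on
the right, which joins their cycles. The product `τ` of these transpositions preserves labels and
moves only elements of `R`; this is all that the crossing estimates need. -/
theorem mergeCycles_spec {s : State} {p : ℝ} {R : List (Fin n)} {σ : Equiv.Perm (Fin n)} {f : ℕ}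
    (hR : s.HasReps R) (hnd : R.Nodup) (hlen : s.var v_cycles = R.length)
    (hM : n + 1 ≤ M) (hσ : ∀ x : Fin n, s.arr a_next x = σ x)
    (hcyc : CycleReps σ {x | x ∈ R})
    (hf : ∀ u : Fin n, f ≤ s.arr a_elemLabel u)
    (hlead : ∀ l, f ≤ l → s.arr a_lead l = 0) :
    Spec c M mergeCycles s p (30 * R.length + 20) fun s' p' => p' = p ∧
      ∃ (K : List (Fin n)) (τ : Equiv.Perm (Fin n)),
        s'.var v_cycles = K.length ∧ s'.HasReps K ∧ K.Nodup ∧ (∀ x ∈ K, x ∈ R) ∧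
        (∀ x ∈ K, ∀ y ∈ K, s.arr a_elemLabel x = s.arr a_elemLabel y → x = y) ∧
        (∀ x : Fin n, s'.arr a_next x = (σ * τ) x) ∧ CycleReps (σ * τ) {x | x ∈ K} ∧
        (∀ x, s.arr a_elemLabel (τ x) = s.arr a_elemLabel x) ∧ (∀ x, x ∉ R → τ x = x) ∧
        ∀ l, (∀ x : Fin n, s.arr a_elemLabel x < l) → s'.arr a_lead l = s.arr a_lead l := by
  set E := s.arr a_elemLabel with hE
  -- The kept representatives `K` overwrite the start of the array, which is safe as there are at
  -- most `j` of them. An entry of `a_lead` is the kept representative plus one, so that zero means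
  -- that there is none yet.
  let I : ℕ → State → ℝ → Prop := fun j s' p' => p' = p ∧
      ∃ (K : List (Fin n)) (τ : Equiv.Perm (Fin n)),
        s'.var v_kept = K.length ∧ K.length ≤ j ∧ s'.HasReps K ∧
        (∀ i (_ : j ≤ i) (hi : i < R.length), s'.arr a_rep i = R[i]) ∧
        K.Nodup ∧ (∀ x ∈ K, x ∈ R.take j) ∧
        (∀ x ∈ K, ∀ y ∈ K, E x = E y → x = y) ∧
        (∀ x : Fin n, s'.arr a_next x = (σ * τ) x) ∧
        CycleReps (σ * τ) {x | x ∈ K ∨ x ∈ R.drop j} ∧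
        (∀ x, E (τ x) = E x) ∧ (∀ x, x ∉ R → τ x = x) ∧
        (∀ l, f ≤ l → s'.arr a_lead l = 0 ∨ ∃ x ∈ K, s'.arr a_lead l = x + 1 ∧ E x = l) ∧
        (∀ x ∈ K, s'.arr a_lead (E x) ≠ 0) ∧
        ∀ l, (∀ x : Fin n, E x < l) → s'.arr a_lead l = s.arr a_lead l
  refine Spec.cons_wp (30 * R.length + 16) ?_ (by simp only [Cmd.cost]; omega)
  simp [Cmd.wp, Operand.eval, BinOp.eval]
  refine Spec.cons (30 * R.length + 3) 5 (I R.length) ?_ ?_ (by omega)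
  · refine Spec.for_le (R := R.length) I (fun _ => 25) rfl rfl (by decide) (by simpa using hlen)
      (by simp; omega) ?_ ?_ fun _ _ h _ _ => h
    · refine ⟨rfl, [], 1, by simp, by simp, by simp [State.HasReps, State.Lists], ?_, by simp,
        by simp, by simp, by simpa using hσ, by simpa using hcyc, by simp, by simp,
        fun l hl => Or.inl (by simpa using hlead l hl), by simp, by simp⟩
      intro i _ hi
      simpa using hR.get hi
    rintro j hj s1 p1 ⟨rfl, K, τ, hK1, hK2, hK3, hrest, hKnd, hKR, hKE, hnx, hcy, hτE, hτR,
      hld, hld0, hldf⟩ hji hw hF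
    have hE1 : s1.arr a_elemLabel = E := (hF.arr _ rfl).trans (by simp [hE])
    have hrj := hrest j le_rfl hj
    set u := R[j] with hu
    have huR : u ∈ R := List.getElem_mem hj
    have hudrop : u ∈ R.drop j := by
      rw [hu, List.drop_eq_getElem_cons hj]; exact List.mem_cons_self
    have hsplit := List.take_append_drop j R
    have hdisj : ∀ x ∈ R.take j, x ∉ R.drop j := by
      have hnd' := hnd
      rw [← hsplit] at hnd'
      exact fun x hx hx' => (List.disjoint_of_nodup_append hnd') hx hx'
    have huK : u ∉ K := fun h => hdisj u (hKR u h) hudrop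
    have htake : ∀ x, x ∈ R.take (j + 1) ↔ x ∈ R.take j ∨ x = u := by
      intro x
      rw [← List.take_append_getElem hj, List.mem_append, List.mem_singleton]
    have hdropc : R.drop j = u :: R.drop (j + 1) := List.drop_eq_getElem_cons hj
    have hud : u ∉ R.drop (j + 1) := by
      have := hnd.sublist (List.drop_sublist j R)
      rw [hdropc] at this
      exact (List.nodup_cons.1 this).1
    have hun := u.2
    refine Spec.of_wp_le ?_ (by decide)
    simp [Cmd.wp, Cmd.block, Operand.eval, Operand.ConstLE, BinOp.eval, Test.Holds, hji, hE1,
      hrj, hK1]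
    have hRn : R.length ≤ n := by simpa using hnd.length_le_card
    refine ⟨fun h0 => ⟨by omega, by omega, rfl, K ++ [u], τ, by simp, by simp; omega, ?_, ?_, ?_,
      ?_, ?_, by simpa using hnx, ?_, hτE, hτR, ?_, ?_, ?_⟩, fun h0 => ?_⟩
    · intro i hi
      simp at hi
      by_cases hiK : i = K.length
      · simp [hiK]
      · have h1 := hK3.get (j := i) (by omega)
        have h2 : i < K.length := by omega
        have h3 : (List.map Fin.val (K ++ [u]))[i] = (K[i]).1 := by
          rw [List.getElem_map, List.getElem_append_left h2]
        rw [h3]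
        simp [hiK, h1]
    · intro i hij hi
      have : i ≠ K.length := by omega
      simpa [this] using hrest i (by omega) hi
    · simp [List.nodup_append, hKnd]
      exact fun x hx h => huK (h ▸ hx)
    · intro x hx
      rw [List.mem_append, List.mem_singleton] at hx
      exact (htake x).2 (hx.imp_left (hKR x))
    · intro x hx y hy hxy
      rw [List.mem_append, List.mem_singleton] at hx hy
      rcases hx with hx | rfl <;> rcases hy with hy | rfl
      · exact hKE x hx y hy hxy
      · exact absurd (hxy ▸ h0) (hld0 x hx)
      · exact absurd (hxy ▸ h0) (hld0 y hy)
      · rfl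
    · convert hcy using 2
      ext x
      simp only [List.mem_append, hdropc, List.mem_cons, List.not_mem_nil, or_false]
      tauto
    · intro l hl
      by_cases hlu : l = E u
      · exact Or.inr ⟨u, by simp, by simp [hlu], hlu.symm⟩
      · rcases hld l hl with h | ⟨x, hx, h1, h2⟩
        · exact Or.inl (by simpa [hlu] using h)
        · exact Or.inr ⟨x, by simp [hx], by simpa [hlu] using h1, h2⟩
    · intro x hx
      rw [List.mem_append, List.mem_singleton] at hx
      rcases hx with hx | rfl
      · have : E x ≠ E u := fun h => hld0 x hx (h ▸ h0)
        simpa [this] using hld0 x hx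
      · simp
    · intro l hl
      have : l ≠ E u := (hl u).ne'
      simpa [this] using hldf l hl
    obtain h | ⟨v, hvK, hv, hEv⟩ := hld (E u) (hf u)
    · exact absurd h h0
    have huv : u ≠ v := fun h => huK (h ▸ hvK)
    have hvR : v ∈ R := List.mem_of_mem_take (hKR v hvK)
    have hcy' := hcy.mul_swap (u := u) (v := v) (Or.inr hudrop) (Or.inl hvK) huv
    refine ⟨rfl, K, τ * Equiv.swap u v, by simpa using hK1, by omega, by simpa [State.HasReps,
      State.Lists] using hK3, ?_, hKnd, fun x hx => (htake x).2 (Or.inl (hKR x hx)), hKE, ?_, ?_,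
      ?_, ?_, by simpa using hld, by simpa using hld0, by simpa using hldf⟩
    · intro i hij hi
      simpa using hrest i (by omega) hi
    · intro x
      have hne : (v : ℕ) ≠ u := fun h => huv (Fin.ext h.symm)
      simp only [← mul_assoc, hv, Nat.add_sub_cancel]
      rw [Equiv.Perm.mul_apply]
      by_cases hxv : x = v
      · subst hxv
        simp [hnx]
      by_cases hxu : x = u
      · simp [hxu, hne.symm, hnx]
      · have h1 : (x : ℕ) ≠ v := fun h => hxv (Fin.ext h)
        have h2 : (x : ℕ) ≠ u := fun h => hxu (Fin.ext h)
        rw [Equiv.swap_apply_of_ne_of_ne hxu hxv]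
        simp [h1, h2, hnx]
    · rw [← mul_assoc]
      convert hcy' using 1
      ext x
      simp only [Set.mem_sdiff, Set.mem_singleton_iff, Set.mem_ofPred_eq, hdropc, List.mem_cons]
      constructor
      · rintro (h | h)
        · exact ⟨Or.inl h, fun hx => huK (hx ▸ h)⟩
        · exact ⟨Or.inr (Or.inr h), fun hx => hud (hx ▸ h)⟩
      · tauto
    · intro x
      rw [Equiv.Perm.mul_apply, hτE]
      by_cases hxv : x = v
      · rw [hxv, Equiv.swap_apply_right, hEv]
      by_cases hxu : x = u
      · rw [hxu, Equiv.swap_apply_left, hEv]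
      · rw [Equiv.swap_apply_of_ne_of_ne hxu hxv]
    · intro x hx
      have hxu : x ≠ u := fun h => hx (by rw [h]; exact huR)
      have hxv : x ≠ v := fun h => hx (by rw [h]; exact hvR)
      rw [Equiv.Perm.mul_apply, Equiv.swap_apply_of_ne_of_ne hxu hxv, hτR x hx]
  rintro s1 p1 ⟨rfl, K, τ, hK1, hK2, hK3, hrest, hKnd, hKR, hKE, hnx, hcy, hτE, hτR,
      hld, hld0, hldf⟩ hw hF
  refine Spec.of_wp_le ?_ (by decide)
  simp [Cmd.wp, Cmd.block, Operand.eval, BinOp.eval, hK1]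
  refine ⟨?_, K, rfl, hK3, hKnd, ?_, hKE, τ, hnx, ?_, hτE, hτR, hldf⟩
  · rw [← hK1]; exact hw.1 _
  · simpa using hKR
  · simpa using hcy

end Rounds

/-! ### What a sample guarantees -/

section Rounds

variable {c : ℝ} {n k M : ℕ} {L : List (List (Fin n))} {F : Finset (Finset (Fin n))}

theorem mem_of_represents (hL : Represents L F) {i : ℕ} (hi : i < L.length) :
    L[i].toFinset ∈ F := by
  rw [← hL.2.2, List.mem_toFinset]
  exact List.mem_map_of_mem (List.getElem_mem hi)

theorem exists_of_represents (hL : Represents L F) {X : Finset (Fin n)} (hX : X ∈ F) :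
    ∃ i, ∃ hi : i < L.length, L[i].toFinset = X := by
  rw [← hL.2.2, List.mem_toFinset] at hX
  obtain ⟨l, hl, rfl⟩ := List.mem_map.1 hX
  obtain ⟨i, hi, rfl⟩ := List.getElem_of_mem hl
  exact ⟨i, hi, rfl⟩

/-- The labels `E` classify the elements by a family `A` that contains exactly one set for each
trace on `B`. -/
theorem classes_of_sample (hL : Represents L F) (hc : 1 ≤ c)
    (hF : ∀ k : ℕ, 1 ≤ k → (shatterFunction F k : ℝ) ≤ c * k)
    (hF' : ∀ k : ℕ, 1 ≤ k → (dualShatterFunction F k : ℝ) ≤ c * k)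
    {B : Finset (Fin n)} {b : ℕ} (hb : 1 ≤ b) (hB : B.card ≤ b) {S : ℕ → ℕ} {E : Fin n → ℕ}
    (hS : ∀ i < L.length, ∀ j < L.length,
      (S i = S j ↔ ∀ u ∈ B, (u.1 ∈ row L i ↔ u.1 ∈ row L j)))
    (hE : ∀ x y, E x = E y ↔
      ∀ i < L.length, (∀ j < i, S j ≠ S i) → (x.1 ∈ row L i ↔ y.1 ∈ row L i)) :
    (∀ K : Finset (Fin n), Set.InjOn E K → (K.card : ℝ) ≤ c ^ 2 * b) ∧
      ∀ X ∈ F, ∃ Y ∈ F, (∀ u ∈ B, u ∈ X ↔ u ∈ Y) ∧ ∀ x y, E x = E y → (x ∈ Y ↔ y ∈ Y) := by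
  constructor
  · intro K hK
    -- The first listed set of each class; two of these with the same trace on `B` would share a
    -- label, so they coincide.
    let A : Finset (Finset (Fin n)) := F.filter fun X =>
      ∃ i, ∃ hi : i < L.length, (∀ j < i, S j ≠ S i) ∧ L[i].toFinset = X
    refine card_le_of_separated (B := B) (A := A) hc hF hF' hb hB (Finset.filter_subset _ _) ?_ ?_
    · intro X hX Y hY hXY
      obtain ⟨-, i, hi, hfi, rfl⟩ := Finset.mem_filter.1 hX
      obtain ⟨-, j, hj, hfj, rfl⟩ := Finset.mem_filter.1 hY
      have hij : S i = S j := by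
        rw [hS i hi j hj]
        intro u hu
        rw [mem_row hi, mem_row hj]
        have := Finset.ext_iff.1 hXY u
        simpa [hu] using this
      have : i = j := by
        rcases lt_trichotomy i j with h | h | h
        · exact absurd hij (hfj i h)
        · exact h
        · exact absurd hij.symm (hfi j h)
      subst this
      rfl
    · intro u hu v hv huv
      refine hK hu hv ((hE u v).2 fun i hi hfi => ?_)
      rw [mem_row hi, mem_row hi]
      exact huv _ (Finset.mem_filter.2 ⟨mem_of_represents hL hi, i, hi, hfi, rfl⟩)
  · intro X hX
    obtain ⟨i, hi, rfl⟩ := exists_of_represents hL hX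
    -- The set `Y` wanted is the first listed set with the label of `X`.
    have hex : ∃ j, S j = S i := ⟨i, rfl⟩
    classical
    have hle : Nat.find hex ≤ i := Nat.find_min' hex rfl
    have hSj := Nat.find_spec hex
    have hmin : ∀ l < Nat.find hex, S l ≠ S (Nat.find hex) := fun l hl => by
      rw [hSj]; exact Nat.find_min hex hl
    generalize Nat.find hex = j at hle hSj hmin
    have hj : j < L.length := by omega
    refine ⟨L[j].toFinset, mem_of_represents hL hj, fun u hu => ?_, fun x y hxy => ?_⟩
    · rw [← mem_row hi, ← mem_row hj]
      exact (hS i hi j hj).1 hSj.symm u hu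
    · rw [← mem_row hj, ← mem_row hj]
      exact (hE x y).1 hxy j hj hmin

/-- The bound on the number of classes holds for every sample; only the quality of the approximating
sets is random, and it enters through `p'`. -/
theorem sampleAndClassify_spec (hL : Represents L F) (hc : 1 ≤ c)
    (hF : ∀ k : ℕ, 1 ≤ k → (shatterFunction F k : ℝ) ≤ c * k)
    (hF' : ∀ k : ℕ, 1 ≤ k → (dualShatterFunction F k : ℝ) ≤ c * k)
    (hk8 : 8 ≤ k) {s : State} {R : List (Fin n)} {f : ℕ} {g : ℝ} (hg : 0 ≤ g)
    (hs : Tables L k M s) (hR : s.HasReps R) (hnd : R.Nodup)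
    (hlen : s.var v_cycles = R.length) (hkR : k * k ≤ R.length) (hM32 : 32 * n ≤ M)
    (hmark : ∀ u < n, s.arr a_mark u = 0) (hel : ∀ u < n, s.arr a_elemLabel u = f)
    (hset : ∀ i < L.length, s.arr a_setLabel i = f) (hlel : LabelsBelow a_elemLabel s)
    (hlset : LabelsBelow a_setLabel s) (hff : f < s.var v_fresh)
    (hseen : ∀ l, f ≤ l → s.arr a_seen l = 0) (hM : s.var v_fresh + 2 * total L ≤ M) :
    Spec c M sampleAndClassify s
      (g * (1 - (largeDifferences F R.toFinset (hitSize c R.length)).card *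
        Real.exp (-hitSize c R.length / R.length) ^ sampleSize k R.length))
      (100 * n + 100 * L.length + 100 * total L + 100) fun s' p' =>
      LabelsBelow a_elemLabel s' ∧ LabelsBelow a_setLabel s' ∧ s.var v_fresh ≤ s'.var v_fresh ∧
        s'.var v_fresh ≤ s.var v_fresh + 2 * total L ∧
        (∀ u : Fin n, f ≤ s'.arr a_elemLabel u) ∧
        (∀ l, s'.var v_fresh ≤ l → s'.arr a_seen l = 0) ∧
        (∀ K : Finset (Fin n), Set.InjOn (fun u : Fin n => s'.arr a_elemLabel u) K →
          (K.card : ℝ) ≤ c ^ 2 * sampleSize k R.length) ∧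
        ∃ B : Finset (Fin n),
          p' = g * (1 - misses (largeDifferences F R.toFinset (hitSize c R.length)) B) ∧
          ∀ X ∈ F, ∃ Y ∈ F, (∀ u ∈ B, u ∈ X ↔ u ∈ Y) ∧
            ∀ x y : Fin n, s'.arr a_elemLabel x = s'.arr a_elemLabel y → (x ∈ Y ↔ y ∈ Y) := by
  have hRpos : 0 < R.length := lt_of_lt_of_le (by positivity) hkR
  have hR0 : R ≠ [] := List.length_pos_iff.1 hRpos
  have hRn : R.length ≤ n := by simpa using hnd.length_le_card
  have hcolsum := sum_length_col hL.1
  set b := sampleSize k R.length with hb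
  have hb1 : 1 ≤ b := one_le_sampleSize (by omega) hkR
  -- Needed for linear time: k² ≥ 64 keeps the number of draws below that of the cycles.
  have hbn : b ≤ n := by
    refine le_trans (Nat.div_le_of_le_mul ?_) hRn
    have : 64 ≤ k * k := by nlinarith
    nlinarith
  set D := largeDifferences F R.toFinset (hitSize c R.length) with hD
  have t1 : ∑ u ∈ Finset.range n, (30 * (col L u).length + 60) + 3 = 30 * total L + 60 * n + 3 := by
    rw [Finset.sum_add_distrib, ← Finset.mul_sum, hcolsum]; simp; ring
  have t2 : ∑ i ∈ Finset.range L.length, (30 * (row L i).length + 60) + 3 =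
      30 * total L + 60 * L.length + 3 := by
    rw [Finset.sum_add_distrib, ← Finset.mul_sum, ← total]; simp; ring
  refine Spec.cons_wp (100 * n + 100 * L.length + 100 * total L + 95) ?_
    (by simp only [Cmd.cost]; omega)
  simp [Cmd.wp, Operand.eval, BinOp.eval, hlen]
  refine ⟨by omega, ?_⟩
  refine Spec.cons_wp (100 * n + 100 * L.length + 100 * total L + 90) ?_
    (by simp only [Cmd.cost]; omega)
  simp [Cmd.wp, Operand.eval, BinOp.eval, Operand.ConstLE, hs.square_eq]
  refine Spec.cons_wp (100 * n + 100 * L.length + 100 * total L + 85) ?_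
    (by simp only [Cmd.cost]; omega)
  simp [Cmd.wp, Operand.eval, BinOp.eval, Operand.ConstLE, hlen]
  set s0 := (((s.setVar v_draws (32 * R.length)).setVar v_draws
    (32 * R.length / (k * k))).setVar v_last (R.length - 1)) with hs0
  have hs0t : Tables L k M s0 := hs.congr (by simp [hs0]) (by simp [hs0])
  have hs0a : s0.arr = s.arr := rfl
  have hs0f : s0.var v_fresh = s.var v_fresh := by simp [hs0]
  refine Spec.cons (20 * b + 3) (80 * n + 100 * L.length + 100 * total L + 80) _
    (drawSample_spec (s := s0) (R := R) (b := b) (q := Real.exp (-hitSize c R.length / R.length)) (𝒟 := D)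
      hR hnd hR0 (by simp [hs0, hb, sampleSize]) (by omega) (by simp [hs0]) hmark
      (fun _ h => subset_of_mem_largeDifferences h) hg (Real.exp_nonneg _) ?_) ?_ (by omega)
  -- A large difference is avoided by one draw with probability less than 1 - δ/m ≤ exp(-δ/m), where
  -- δ is `hitSize` and m the number of cycles.
  · intro X hX
    have h1 : hitSize c R.length < X.card := (Finset.mem_filter.1 hX).2
    have h2 := Real.add_one_le_exp (-hitSize c R.length / R.length)
    have h3 : (0 : ℝ) < R.length := by exact_mod_cast hRpos
    have h4 := mul_le_mul_of_nonneg_right h2 h3.le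
    rw [add_mul, div_mul_cancel₀ _ h3.ne'] at h4
    linarith
  rintro s1 p1 ⟨B, hBR, hBb, hBm, rfl⟩ - hF1
  have hs1 : Tables L k M s1 := hs0t.frame hF1 (by decide)
  have hf1 : s1.var v_fresh = s.var v_fresh := (hF1.var _ rfl).trans hs0f
  have hn1 : s1.arr a_newLabel = s.arr a_newLabel := hF1.arr _ rfl
  have he1 : s1.arr a_elemLabel = s.arr a_elemLabel := hF1.arr _ rfl
  have hS1 : s1.arr a_setLabel = s.arr a_setLabel := hF1.arr _ rfl
  have hseen1 : s1.arr a_seen = s.arr a_seen := hF1.arr _ rfl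
  refine Spec.cons (30 * total L + 60 * n + 3) (20 * n + 100 * L.length + 70 * total L + 70) _
    ((classifySets_spec hs1 (hlset.congr hS1 hn1 hf1) (by omega)).le_trans t1.le) ?_ (by omega)
  rintro s2 p2 ⟨rfl, hl2, hfr2, hfr2', hm2, hiff2⟩ - hF2
  have hs2 : Tables L k M s2 := hs1.frame hF2 (by decide)
  have he2 : s2.arr a_elemLabel = s.arr a_elemLabel := (hF2.arr _ rfl).trans he1
  have hseen2 : s2.arr a_seen = s.arr a_seen := (hF2.arr _ rfl).trans hseen1
  rw [hf1] at hfr2 hfr2'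
  rw [hcolsum] at hfr2'
  refine Spec.cons (30 * total L + 60 * L.length + 3) 20 _
    ((classifyElements_spec (f := f) hs2 hL.1 (by omega) (by omega) ⟨fun x => ?_, hl2.new⟩ ?_ ?_
      (by omega) ?_).le_trans t2.le) ?_ (by omega)
  · rw [he2]; exact (hlel.label x).trans_le hfr2
  · intro i hi
    refine le_trans ?_ (hm2 i)
    rw [hS1, hset i hi]
  · exact fun i _ => hl2.label i
  · rw [hseen2]; exact hseen
  rintro s3 p3 ⟨rfl, hl3, hfr3, hfr3', hm3, hiff3, hseen3⟩ - hF3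
  have hS3 : s3.arr a_setLabel = s2.arr a_setLabel := hF3.arr _ rfl
  have hclass := classes_of_sample (c := c) (B := B) (b := b) (S := s2.arr a_setLabel)
    (E := fun u => s3.arr a_elemLabel u) hL hc hF hF' hb1 hBb ?_ ?_
  · refine Spec.nil ⟨hl3, ⟨fun x => ?_, hl3.new⟩, by omega, by omega, fun u => ?_, fun l hl => ?_,
      hclass.1, B, rfl, hclass.2⟩ (by norm_num)
    · rw [hS3]; exact (hl2.label x).trans_le hfr3
    · refine le_trans ?_ (hm3 u)
      rw [he2, hel u u.2]
    · exact hseen3 l (by omega)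
  · intro i hi j hj
    rw [hiff2, hS1, hset i hi, hset j hj]
    simp only [true_and]
    constructor
    · intro h u hu
      rw [← mem_col hi, ← mem_col hj]
      exact h u u.2 ((hBm u).2 hu)
    · intro h u hu hmu
      rw [mem_col hi, mem_col hj]
      exact h ⟨u, hu⟩ ((hBm ⟨u, hu⟩).1 hmu)
  · intro x y
    simp only [hiff3]
    rw [he2, hel x x.2, hel y y.2]
    simp

end Rounds

/-! ### Crossing budget, success guarantee and the main loop -/

section MainLoop

variable {c : ℝ} {n k M : ℕ} {L : List (List (Fin n))} {F : Finset (Finset (Fin n))}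

open Classical in
/-- The success probability that is guaranteed when the order consists of the `m` cycles of `σ`:
it is positive if the crossings do not exceed the budget spent so far. -/
noncomputable def guarantee (c : ℝ) (F : Finset (Finset (Fin n))) (σ : Equiv.Perm (Fin n))
    (m : ℕ) : ℝ :=
  if ∀ X ∈ F, cyclicCrossings σ X + budget c m ≤ budget c n then successBound m else 0

theorem guarantee_nonneg (σ : Equiv.Perm (Fin n)) (m : ℕ) : 0 ≤ guarantee c F σ m := by
  rw [guarantee]
  split_ifs
  · have := two_thirds_le_successBound m
    linarith
  · exact le_rfl

/-- The input is as in the theorem, `k` approximates `8 * c`, and the word bound is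
sufficient. -/
structure Admissible (c : ℝ) (k M : ℕ) (L : List (List (Fin n))) (F : Finset (Finset (Fin n))) :
    Prop where
  one_le : 1 ≤ c
  represents : Represents L F
  primal : ∀ k : ℕ, 1 ≤ k → (shatterFunction F k : ℝ) ≤ c * k
  dual : ∀ k : ℕ, 1 ≤ k → (dualShatterFunction F k : ℝ) ≤ c * k
  lt_or : 8 * c < k ∨ n + 8 ≤ k
  le_mul : (k : ℝ) ≤ 9 * c
  eight_le : 8 ≤ k
  words : 32 * n + 1 ≤ M

/-- The state between two rounds: the order consists of the cycles of `σ`, represented by the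
elements of `R`. -/
structure Cycles (L : List (List (Fin n))) (k M : ℕ) (R : List (Fin n)) (σ : Equiv.Perm (Fin n))
    (s : State) : Prop where
  tables : Tables L k M s
  reps : s.HasReps R
  nodup : R.Nodup
  count : s.var v_cycles = R.length
  next : ∀ x : Fin n, s.arr a_next x = σ x
  cycleReps : CycleReps σ {x | x ∈ R}
  elemLabels : LabelsBelow a_elemLabel s
  setLabels : LabelsBelow a_setLabel s
  seen : ∀ l, s.var v_fresh ≤ l → s.arr a_seen l = 0
  lead : ∀ l, s.var v_fresh ≤ l → s.arr a_lead l = 0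
  fresh : s.var v_fresh + R.length * (1 + 2 * total L) ≤ M

/-- Halving is certain, and only the guarantee is random. The state before merging is described by
what it implies for every possible outcome `K`, `τ`, so that merging is treated once for both
branches. -/
theorem mergeRound_spec (hA : Admissible c k M L F) {s : State} {R : List (Fin n)}
    {σ : Equiv.Perm (Fin n)} (hI : Cycles L k M R σ s) (hR2 : 2 ≤ R.length) :
    Spec c M mergeRound s (guarantee c F σ R.length)
      (200 * (n + L.length + total L) + 200) fun s' p' => ∃ (R' : List (Fin n))
        (σ' : Equiv.Perm (Fin n)), Cycles L k M R' σ' s' ∧ 1 ≤ R'.length ∧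
        2 * R'.length ≤ R.length ∧ p' ≤ guarantee c F σ' R'.length := by
  obtain ⟨hs, hR, hnd, hlen, hnext, hcyc, hlel, hlset, hseen, hlead, hfresh⟩ := hI
  have hRn : R.length ≤ n := by simpa using hnd.length_le_card
  have hR0 : R ≠ [] := by rintro rfl; simp at hR2
  have hMw := hA.words
  set p := guarantee c F σ R.length with hp
  set f := s.var v_fresh with hf
  have hfr1 : f + (1 + 2 * total L) ≤ M := by nlinarith
  refine Spec.cons (10 * n + 10 * L.length + 20)
    (190 * n + 190 * L.length + 200 * total L + 175) _
    (resetLabels_spec hs hlel hlset (by omega)) ?_ (by omega)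
  rintro s1 p1 ⟨rfl, hfr, hmark, hel, hset, hlel1, hlset1⟩ - hF1
  have hs1 : Tables L k M s1 := hs.frame hF1 (by decide)
  have hlen1 : s1.var v_cycles = R.length := (hF1.var _ rfl).trans hlen
  have hrep1 : s1.arr a_rep = s.arr a_rep := hF1.arr _ rfl
  have hR1 : s1.HasReps R := by
    unfold State.HasReps State.Lists; rw [hrep1]; exact hR
  have hseen1 : s1.arr a_seen = s.arr a_seen := hF1.arr _ rfl
  rw [← hf] at hfr hel hset
  refine Spec.cons (100 * n + 100 * L.length + 100 * total L + 101)
    (90 * n + 90 * L.length + 100 * total L + 70) (fun s2 p2 =>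
      LabelsBelow a_elemLabel s2 ∧ LabelsBelow a_setLabel s2 ∧ f + 1 ≤ s2.var v_fresh ∧
      s2.var v_fresh ≤ f + 1 + 2 * total L ∧ (∀ u : Fin n, f ≤ s2.arr a_elemLabel u) ∧
      (∀ l, s2.var v_fresh ≤ l → s2.arr a_seen l = 0) ∧
      ∀ (K : List (Fin n)) (τ : Equiv.Perm (Fin n)), K.Nodup → K ≠ [] →
        (∀ x ∈ K, ∀ y ∈ K, s2.arr a_elemLabel x = s2.arr a_elemLabel y → x = y) →
        (∀ x, s2.arr a_elemLabel (τ x) = s2.arr a_elemLabel x) → (∀ x, x ∉ R → τ x = x) →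
        2 * K.length ≤ R.length ∧ p2 ≤ guarantee c F (σ * τ) K.length) ?_ ?_ (by omega)
  · refine Spec.ite ?_ ?_
    · intro ht
      simp [Test.Holds, Operand.eval, hlen1, hs1.square_eq] at ht
      refine Spec.of_wp_le ⟨hlel1, hlset1, hfr.ge, by omega, fun u => (hel u u.2).ge, ?_, ?_⟩
        (by simp [Cmd.cost])
      · rw [hfr, hseen1]; exact fun l hl => hseen l (by omega)
      intro K τ hK hK0 hKE hτE hτR
      -- Without a sample all elements have the same label, so a single cycle remains.
      have hK1 : K.length = 1 := by
        refine le_antisymm ?_ (List.length_pos_iff.2 hK0)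
        rw [← List.toFinset_card_of_nodup hK]
        refine Finset.card_le_one.2 fun x hx y hy => hKE x (by simpa using hx) y (by simpa using hy) ?_
        rw [hel x x.2, hel y y.2]
      refine ⟨by omega, ?_⟩
      rw [hK1]
      by_cases hcr : ∀ X ∈ F, cyclicCrossings σ X + budget c R.length ≤ budget c n
      · rw [hp, guarantee, if_pos hcr, guarantee, if_pos ?_]
        · refine (successBound_le_one (by omega)).trans (le_of_eq ?_)
          rw [successBound]; norm_num
        · intro X hX
          have h1 : (cyclicCrossings (σ * τ) X : ℝ) ≤ cyclicCrossings σ X + R.length := by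
            have h2 := cyclicCrossings_mul_le σ τ X
            have h3 : cyclicCrossings τ X ≤ R.toFinset.card := cyclicCrossings_le_card
              fun x hx => by
                by_contra hxR
                exact hx (hτR x (by simpa using hxR))
            rw [List.toFinset_card_of_nodup hnd] at h3
            exact_mod_cast h2.trans (by omega)
          have h4 := le_budget hR2 hA.one_le hA.le_mul ht.le
          have h5 := hcr X hX
          have h6 : budget c 1 = 0 := by simp [budget]
          rw [h6]
          linarith
      · rw [hp, guarantee, if_neg hcr]
        exact guarantee_nonneg _ _
    · intro ht
      simp [Test.Holds, Operand.eval, hlen1, hs1.square_eq] at ht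
      -- The alternative n + 8 ≤ k contradicts k² ≤ `R.length` ≤ n: if the approximation of 8c
      -- stopped early, no sample is ever drawn.
      have hk8 : 8 * c < k := by
        refine hA.lt_or.resolve_right fun h => ?_
        nlinarith
      have hk8' := hA.eight_le
      set m := R.length with hm
      have hRc : R.toFinset.card = m := List.toFinset_card_of_nodup hnd
      set 𝒟 := largeDifferences F R.toFinset (hitSize c m) with h𝒟
      set φ : ℝ := 𝒟.card * Real.exp (-hitSize c m / m) ^ sampleSize k m with hφ
      have hφ' : φ ≤ 1 / (64 * m) := by
        refine fail_bound hA.one_le hk8 hA.le_mul ht ?_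
        have h1 : (𝒟.card : ℝ) ≤ (shatterFunction F m : ℝ) ^ 2 := by
          rw [← hRc]
          exact_mod_cast card_largeDifferences_le F R.toFinset (hitSize c m)
        refine h1.trans (pow_le_pow_left₀ (Nat.cast_nonneg _) (hA.primal m (by omega)) 2)
      -- If the budget has already been exceeded, nothing is promised and the bound has to stay
      -- zero.
      let g : ℝ := if p = 0 then 0 else halvedBound m
      have hg0 : 0 ≤ g := by
        simp only [g]; split_ifs
        · exact le_rfl
        · exact halvedBound_nonneg m
      have hpg : p ≤ g * (1 - φ) := by
        simp only [g]; split_ifs with h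
        · simp [h]
        · refine le_trans ?_ (successBound_le_halvedBound hR2 hφ')
          rw [hp, guarantee]
          split_ifs
          · exact le_rfl
          · have := two_thirds_le_successBound m
            linarith
      refine Spec.mono_prob ?_ hpg
      refine (sampleAndClassify_spec (f := f) hA.represents hA.one_le hA.primal hA.dual hA.eight_le
        hg0 hs1 hR1 hnd hlen1 ht (by omega) hmark hel hset hlel1 hlset1 (by omega)
        (by rw [hseen1]; exact hseen) (by omega)).mono le_rfl ?_
      rintro s2 p2 ⟨hl2, hl2', hf2, hf2', hfE, hseen2, hKc, B, rfl, hcls⟩ - -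
      refine ⟨hl2, hl2', by omega, by omega, hfE, hseen2, ?_⟩
      intro K τ hK hK0 hKE hτE hτR
      have hKm : 2 * K.length ≤ m := by
        refine two_mul_le_of_le_sampleSize hA.one_le hk8 ?_
        have := hKc K.toFinset fun x hx y hy h => hKE x (by simpa using hx) y (by simpa using hy) h
        rwa [List.toFinset_card_of_nodup hK] at this
      have hK1 : 1 ≤ K.length := List.length_pos_iff.2 hK0
      refine ⟨hKm, ?_⟩
      by_cases hmiss : misses 𝒟 B = 0
      · rw [hmiss, Nat.cast_zero, sub_zero, mul_one]
        by_cases hp0 : p = 0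
        · simp only [g, if_pos hp0]
          exact guarantee_nonneg _ _
        · have hcr : ∀ X ∈ F, cyclicCrossings σ X + budget c m ≤ budget c n := by
            by_contra hcr
            exact hp0 (by rw [hp, guarantee, if_neg hcr])
          simp only [g, if_neg hp0]
          rw [guarantee, if_pos]
          · exact halvedBound_le_successBound hK1 hKm
          intro X hX
          obtain ⟨Y, hY, hXY, hYE⟩ := hcls X hX
          have h1 : (cyclicCrossings (σ * τ) X : ℝ) ≤
              cyclicCrossings σ X + 2 * (symmDiff X Y ∩ R.toFinset).card := by
            have h2 := cyclicCrossings_mul_le σ τ X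
            have h3 : cyclicCrossings τ X ≤ 2 * (symmDiff X Y ∩ R.toFinset).card := by
              refine cyclicCrossings_le_symmDiff fun x hx => ?_
              have hxR : x ∈ R := by
                by_contra hxR
                exact hx (hτR x hxR)
              have hτxR : τ x ∈ R := by
                by_contra hxR
                exact hx (τ.injective (hτR _ hxR))
              exact ⟨by simpa using hxR, by simpa using hτxR, hYE _ _ (hτE x).symm⟩
            exact_mod_cast h2.trans (by omega)
          have h4 := card_symmDiff_le_of_misses_eq_zero hmiss hX hY hXY
          have h5 := budget_step (c := c) hK1 hKm
          have h6 := hcr X hX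
          linarith
      -- With a missed difference the factor 1 - `misses` is at most zero, so a failed sample needs
      -- no analysis.
      · refine le_trans ?_ (guarantee_nonneg _ _)
        have : (1 : ℝ) ≤ misses 𝒟 B := by exact_mod_cast Nat.one_le_iff_ne_zero.2 hmiss
        exact mul_nonpos_of_nonneg_of_nonpos hg0 (by linarith)
  rintro s2 p2 ⟨hlel2, hlset2, hf2, hf2', hfE, hseen2, hgood⟩ - hF2
  have hs2 : Tables L k M s2 := hs1.frame hF2 (by decide)
  have hlen2 : s2.var v_cycles = R.length := (hF2.var _ rfl).trans hlen1
  have hR2' : s2.HasReps R := by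
    unfold State.HasReps State.Lists; rw [hF2.arr a_rep rfl]; exact hR1
  have hnext2 : ∀ x : Fin n, s2.arr a_next x = σ x := by
    rw [hF2.arr a_next rfl, hF1.arr a_next rfl]; exact hnext
  have hlead2 : ∀ l, f ≤ l → s2.arr a_lead l = 0 := by
    rw [hF2.arr a_lead rfl, hF1.arr a_lead rfl]; exact hlead
  refine Spec.cons (30 * R.length + 20) 1 _
    (mergeCycles_spec hR2' hnd hlen2 (by omega) hnext2 hcyc hfE hlead2) ?_ (by omega)
  rintro s3 p3 ⟨rfl, K, τ, hK1, hK2, hKnd, hKR, hKE, hnx, hcy, hτE, hτR, hld⟩ - hF3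
  have hK0 : K ≠ [] := by
    obtain ⟨f, -, -, hf⟩ := hcy
    have := (hf (R[0]'(by omega))).1
    rintro rfl
    simp at this
  obtain ⟨h1, h2⟩ := hgood K τ hKnd hK0 hKE hτE hτR
  have hfr3 : s3.var v_fresh = s2.var v_fresh := hF3.var _ rfl
  refine Spec.nil ⟨K, σ * τ, ⟨hs2.frame hF3 (by decide), hK2, hKnd, hK1, hnx, hcy,
    hlel2.congr (hF3.arr _ rfl) (hF3.arr _ rfl) hfr3,
    hlset2.congr (hF3.arr _ rfl) (hF3.arr _ rfl) hfr3, ?_, ?_, ?_⟩,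
    List.length_pos_iff.2 hK0, h1, h2⟩ le_rfl
  · rw [hfr3, hF3.arr a_seen rfl]; exact hseen2
  · intro l hl
    rw [hld l fun x => (hlel2.label x).trans_le (by omega)]
    exact hlead2 l (by omega)
  -- A round issues at most 1 + 2 · `total L` labels and removes at least one cycle, so a reserve of
  -- one such batch per cycle lasts.
  · have : (K.length + 1) * (1 + 2 * total L) ≤ R.length * (1 + 2 * total L) :=
      Nat.mul_le_mul_right _ (by omega)
    rw [add_mul] at this
    omega

theorem mainLoop_spec (hA : Admissible c k M L F) {s : State} {R : List (Fin n)}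
    {σ : Equiv.Perm (Fin n)} (hI : Cycles L k M R σ s) :
    Spec c M (.loop (.lt (.const 1) (.var v_cycles)) mergeRound) s (guarantee c F σ R.length)
      ((200 * (n + L.length + total L) + 201) * Nat.log 2 R.length + 1) fun s' p' =>
      ∃ (R' : List (Fin n)) (σ' : Equiv.Perm (Fin n)), Cycles L k M R' σ' s' ∧ R'.length ≤ 1 ∧
        p' ≤ guarantee c F σ' R'.length := by
  induction hm : R.length using Nat.strong_induction_on generalizing s R σ with
  | _ m ih =>
    subst hm
    by_cases hR : 2 ≤ R.length
    · have hlog : Nat.log 2 R.length = Nat.log 2 (R.length / 2) + 1 := by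
        rw [Nat.log_div_base, Nat.sub_add_cancel (Nat.log_pos (by norm_num) hR)]
      refine (Spec.loop_true ?_ (mergeRound_spec hA hI hR)
        (t₂ := (200 * (n + L.length + total L) + 201) * Nat.log 2 (R.length / 2) + 1) ?_).le_trans ?_
      · simp [Test.Holds, Operand.eval, hI.count]; omega
      · rintro s' p' ⟨R', σ', hI', h1, h2, h3⟩ -
        refine Spec.mono_prob ((ih R'.length (by omega) hI' rfl).le_trans ?_) h3
        gcongr
        omega
      · rw [hlog, Nat.mul_succ]
        generalize (200 * (n + L.length + total L) + 201) * Nat.log 2 (R.length / 2) = q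
        omega
    · refine (Spec.loop_false ?_ ⟨R, σ, hI, by omega, le_rfl⟩).le_trans (by omega)
      simp [Test.Holds, Operand.eval, hI.count]; omega

/-- The first representative is quantified, because an empty ground set has none. -/
theorem writeOrder_spec {s : State} {p : ℝ} {σ : Equiv.Perm (Fin n)} (hn : s.var v_n = n)
    (hnext : ∀ x : Fin n, s.arr a_next x = σ x) :
    Spec c M writeOrder s p (10 * n + 10) fun s' p' => p' = p ∧
      ∀ r : Fin n, s.arr a_rep 0 = r → ∀ i < n, s'.arr a_out i = (σ ^ i) r := by
  refine Spec.cons_wp (10 * n + 7) ?_ (by simp only [Cmd.cost]; omega)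
  simp [Cmd.wp, Operand.eval]
  refine Spec.cons (10 * n + 3) 1 _ (Spec.for_le (R := n) (fun j s' p' => p' = p ∧
    ∀ r : Fin n, s.arr a_rep 0 = r → s'.var v_x = (σ ^ j) r ∧
      ∀ i < j, s'.arr a_out i = (σ ^ i) r)
    (fun _ => 7) rfl rfl (by decide) (by simpa using hn) (by simp; omega) ?_ ?_ ?_)
    (fun _ _ h _ _ => Spec.nil h le_rfl) (by omega)
  · refine ⟨rfl, fun r hr => ⟨by simp [hr], by simp⟩⟩
  · rintro j hj s1 p1 ⟨rfl, h1⟩ hji hw hF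
    have hnx : s1.arr a_next = s.arr a_next := hF.arr _ rfl
    refine Spec.of_wp_le ?_ (by decide)
    simp [Cmd.wp, Cmd.block, Operand.eval, Operand.ConstLE, hji, hnx]
    intro r hr
    obtain ⟨h2, h3⟩ := h1 r hr
    refine ⟨?_, fun i hi => ?_⟩
    · rw [h2, hnext, pow_succ', Equiv.Perm.mul_apply]
    · by_cases hij : i = j
      · simp [hij, h2]
      · simpa [hij] using h3 i (by omega)
  · rintro s1 p1 ⟨rfl, h1⟩ - -
    exact ⟨rfl, fun r hr => (h1 r hr).2⟩

end MainLoop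

/-! ### Reading the input -/

section Input

variable {c : ℝ} {n k M : ℕ} {L : List (List (Fin n))}

/-- The position in the input of the cardinality of the set number `i`. -/
def setPos (L : List (List (Fin n))) (i : ℕ) : ℕ :=
  2 + ∑ j ∈ Finset.range i, ((row L j).length + 1)

theorem setPos_succ (L : List (List (Fin n))) (i : ℕ) :
    setPos L (i + 1) = setPos L i + 1 + (row L i).length := by
  rw [setPos, Finset.sum_range_succ, setPos]; ring

theorem setPos_length (L : List (List (Fin n))) :
    setPos L L.length = 2 + L.length + total L := by
  rw [setPos, Finset.sum_add_distrib, ← total]; simp; ring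

theorem setPos_mono (L : List (List (Fin n))) : Monotone (setPos L) :=
  monotone_nat_of_le_succ fun i => by rw [setPos_succ]; omega

theorem flatMap_getD (L : List (List (Fin n))) {i : ℕ} (hi : i < L.length) {j : ℕ}
    (hj : j < (row L i).length + 1) :
    (L.flatMap fun l => l.length :: l.map Fin.val).getD
      ((∑ j ∈ Finset.range i, ((row L j).length + 1)) + j) 0 =
    ((row L i).length :: row L i).getD j 0 := by
  induction L generalizing i with
  | nil => simp at hi
  | cons l L ih =>
    rw [List.flatMap_cons]
    cases i with
    | zero =>
      have h0 : row (l :: L) 0 = l.map Fin.val := rfl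
      rw [h0] at hj ⊢
      rw [Finset.range_zero, Finset.sum_empty, zero_add, List.getD_append _ _ _ _ (by simpa using hj)]
      simp
    | succ i =>
      have h0 : row (l :: L) 0 = l.map Fin.val := rfl
      have h1 : ∀ i, row (l :: L) (i + 1) = row L i := fun i => rfl
      rw [Finset.sum_range_succ', List.getD_append_right]
      · simp only [h1] at hj ⊢
        rw [← ih (by simpa using hi) hj]
        congr 1
        simp [h0]
        omega
      · simp [h0]; omega

theorem encode_getD_setPos {i : ℕ} (hi : i < L.length) :
    (encode L).getD (setPos L i) 0 = (row L i).length := by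
  have := flatMap_getD L hi (j := 0) (by omega)
  rw [encode, setPos, add_comm 2]
  simpa using this

theorem encode_getD_row {i : ℕ} (hi : i < L.length) {j : ℕ} (hj : j < (row L i).length) :
    (encode L).getD (setPos L i + 1 + j) 0 = (row L i)[j] := by
  have := flatMap_getD L hi (j := j + 1) (by omega)
  have e : setPos L i + 1 + j = (∑ j ∈ Finset.range i, ((row L j).length + 1)) + (j + 1) + 2 := by
    rw [setPos]; ring
  rw [encode, e, List.getD_cons_succ, List.getD_cons_succ, this, List.getD_cons_succ,
    List.getD_eq_getElem _ _ hj]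

/-- The numbers of the sets among the first `i` ones that contain `u`. -/
def colUpTo (L : List (List (Fin n))) (i u : ℕ) : List ℕ :=
  (List.range i).filter fun i => u ∈ row L i

theorem colUpTo_succ (L : List (List (Fin n))) (i u : ℕ) :
    colUpTo L (i + 1) u = colUpTo L i u ++ if u ∈ row L i then [i] else [] := by
  rw [colUpTo, List.range_succ, List.filter_append, colUpTo]
  congr 1
  by_cases h : u ∈ row L i <;> simp [h]

theorem length_colUpTo_le (L : List (List (Fin n))) (i u : ℕ) : (colUpTo L i u).length ≤ i :=
  (List.length_filter_le _ _).trans (by simp)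

/-- The incidence lists are `P`. -/
def State.HasCols (s : State) (n N : ℕ) (P : ℕ → List ℕ) : Prop :=
  ∀ u < n, s.arr a_deg u = (P u).length ∧ s.Lists a_inc (u * N) (P u)

theorem row_lt (L : List (List (Fin n))) (i : ℕ) {u : ℕ} (hu : u ∈ row L i) : u < n := by
  obtain ⟨v, -, rfl⟩ := List.mem_map.1 hu
  exact v.2

/-- Every element owns a block of `L.length` cells for its incidence list. Unused cells cost no
time, only addresses of size at most `n * L.length`. -/
theorem parseSet_spec (hL : ∀ l ∈ L, l.Nodup) {i : ℕ} (hi : i < L.length) {s : State} {p : ℝ}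
    (hin : ∀ j, s.arr a_in j = (encode L).getD j 0) (hsets : s.var v_sets = L.length)
    (hlen : s.var v_len = (row L i).length) (hpos : s.var v_pos = setPos L i + 1)
    (hvi : s.var v_i = i) (hM : setPos L L.length ≤ M) (hM' : n * L.length ≤ M)
    (hcols : s.HasCols n L.length (colUpTo L i)) :
    Spec c M (.forLoop v_j v_len (.block [
        .op v_t .add (.var v_pos) (.var v_j),
        .load v_u a_in (.var v_t),
        .load v_d a_deg (.var v_u),
        .op v_t .mul (.var v_u) (.var v_sets),
        .op v_t .add (.var v_t) (.var v_d),
        .store a_inc (.var v_t) (.var v_i),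
        .op v_d .add (.var v_d) (.const 1),
        .store a_deg (.var v_u) (.var v_d)])) s p (20 * (row L i).length + 3) fun s' p' => p' = p ∧
      s'.HasCols n L.length (colUpTo L (i + 1)) := by
  have hsucc := setPos_succ L i
  have hle : setPos L (i + 1) ≤ setPos L L.length := setPos_mono L hi
  let P : ℕ → ℕ → List ℕ := fun j u =>
    colUpTo L i u ++ if u ∈ (row L i).take j then [i] else []
  refine Spec.for_le (R := (row L i).length) (fun j s' p' => p' = p ∧ s'.HasCols n L.length (P j))
    (fun _ => 17) rfl rfl (by decide) hlen (by simp; omega) ?_ ?_ ?_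
  · refine ⟨rfl, ?_⟩
    have : P 0 = colUpTo L i := by funext u; simp [P]
    rw [this]
    exact hcols
  · rintro j hj s1 p1 ⟨rfl, hc1⟩ hjv hw hF
    have hin1 : s1.arr a_in (setPos L i + 1 + j) = (row L i)[j] := by
      rw [hF.arr a_in rfl, hin, encode_getD_row hi hj]
    have hpos1 : s1.var v_pos = setPos L i + 1 := (hF.var _ rfl).trans hpos
    have hsets1 : s1.var v_sets = L.length := (hF.var _ rfl).trans hsets
    have hvi1 : s1.var v_i = i := (hF.var _ rfl).trans hvi
    set u := (row L i)[j] with hu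
    have hun : u < n := row_lt L i (List.getElem_mem hj)
    have hnotin : u ∉ (row L i).take j := by
      intro hmem
      obtain ⟨i', hi', hij⟩ := List.getElem_of_mem hmem
      rw [List.getElem_take, hu] at hij
      have := (List.Nodup.getElem_inj_iff (row_nodup hL i)).1 hij
      simp at hi'
      omega
    have htake : ∀ x, x ∈ (row L i).take (j + 1) ↔ x ∈ (row L i).take j ∨ x = u := by
      intro x
      rw [← List.take_append_getElem hj, List.mem_append, List.mem_singleton]
    have hPu : P j u = colUpTo L i u := by simp [P, hnotin]
    have hPu' : P (j + 1) u = colUpTo L i u ++ [i] := by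
      have : u ∈ (row L i).take (j + 1) := (htake u).2 (Or.inr rfl)
      simp only [P, this, if_true]
    have hPne : ∀ x, x ≠ u → P (j + 1) x = P j x := by
      intro x hx
      have : x ∈ (row L i).take (j + 1) ↔ x ∈ (row L i).take j := by rw [htake]; tauto
      simp only [P, this]
    have hlenu := length_colUpTo_le L i u
    have hdeg : s1.arr a_deg u = (colUpTo L i u).length := by rw [(hc1 u hun).1, hPu]
    have hmul : u * L.length + L.length ≤ M :=
      le_trans (by rw [← Nat.succ_mul]; exact Nat.mul_le_mul_right _ hun) hM'
    refine Spec.of_wp_le ?_ (by decide)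
    simp [Cmd.wp, Cmd.block, Operand.eval, Operand.ConstLE, BinOp.eval, hjv, hin1, hpos1, hsets1,
      hvi1, hdeg]
    refine ⟨by omega, by omega, by omega, by omega, fun x hx => ?_⟩
    obtain ⟨h1, h2⟩ := hc1 x hx
    by_cases hxu : x = u
    · subst hxu
      rw [hPu']
      refine ⟨by simp, fun d hd => ?_⟩
      by_cases hdl : d = (colUpTo L i u).length
      · subst hdl
        simp
      · have hd' : d < (colUpTo L i u).length := by simp at hd; omega
        rw [List.getElem_append_left hd']
        have := h2 d (by rw [hPu]; exact hd')
        simp only [hPu] at this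
        simpa [hdl] using this
    · rw [hPne x hxu]
      refine ⟨by simpa [hxu] using h1, fun d hd => ?_⟩
      have hd' : d < L.length := by
        have h3 := length_colUpTo_le L (i + 1) x
        have h4 : (P j x).length ≤ i + 1 := by
          have := length_colUpTo_le L i x
          simp only [P]
          split_ifs <;> simp <;> omega
        omega
      have hne : x * L.length + d ≠ u * L.length + (colUpTo L i u).length := by
        intro h
        refine hxu ?_
        -- Both offsets are smaller than the block length, so dividing an address by it recovers the
        -- element.
        have h3 := congrArg (· / L.length) h
        rwa [Nat.mul_comm x, Nat.mul_comm u, Nat.mul_add_div (by omega),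
          Nat.mul_add_div (by omega), Nat.div_eq_of_lt hd', Nat.div_eq_of_lt (by omega)] at h3
      simpa [hne] using h2 d hd
  · rintro s1 p1 ⟨rfl, hc1⟩ - -
    refine ⟨rfl, ?_⟩
    have : P (row L i).length = colUpTo L (i + 1) := by
      funext u
      rw [colUpTo_succ]
      simp [P]
    rwa [this] at hc1

theorem parseInput_spec (hL : ∀ l ∈ L, l.Nodup) {s : State} {p : ℝ}
    (hin : ∀ j, s.arr a_in j = (encode L).getD j 0) (hsets : s.var v_sets = L.length)
    (hdeg : ∀ u, s.arr a_deg u = 0)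
    (hM : setPos L L.length ≤ M) (hM' : n * L.length ≤ M) :
    Spec c M parseInput s p (20 * total L + 40 * L.length + 20) fun s' p' => p' = p ∧
      s'.HasCols n L.length (col L) ∧ ∀ i < L.length, s'.arr a_len i = (row L i).length ∧
        s'.arr a_off i = setPos L i + 1 := by
  refine Spec.cons_wp (20 * total L + 40 * L.length + 10) ?_ (by simp only [Cmd.cost]; omega)
  simp [Cmd.wp, Operand.eval, BinOp.eval]
  have h2 : 2 ≤ setPos L L.length := by rw [setPos]; omega
  refine ⟨by omega, ?_⟩
  refine Spec.cons (20 * total L + 40 * L.length + 3) 1 _ (Spec.for_le (R := L.length)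
    (fun i s' p' => p' = p ∧ s'.var v_pos = setPos L i ∧ s'.HasCols n L.length (colUpTo L i) ∧
      ∀ j < i, s'.arr a_len j = (row L j).length ∧ s'.arr a_off j = setPos L j + 1)
    (fun i => 20 * (row L i).length + 30) rfl rfl (by decide) (by simpa using hsets) ?_ ?_ ?_
    fun _ _ h _ _ => ?_) (fun _ _ h _ _ => Spec.nil h le_rfl) (by omega)
  · rw [Finset.sum_add_distrib, Finset.sum_add_distrib, ← Finset.mul_sum, ← total]
    simp; omega
  · refine ⟨rfl, by simp [setPos], fun u _ => ⟨by simp [colUpTo, hdeg], ?_⟩, by simp⟩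
    intro d hd
    simp [colUpTo] at hd
  · rintro i hi s1 p1 ⟨rfl, hpos, hcols, hrows⟩ hvi hw hF
    have hin1 : ∀ j, s1.arr a_in j = (encode L).getD j 0 := by rw [hF.arr a_in rfl]; exact hin
    have hsets1 : s1.var v_sets = L.length := (hF.var _ rfl).trans (by simpa using hsets)
    have hsucc := setPos_succ L i
    have hle : setPos L (i + 1) ≤ setPos L L.length := setPos_mono L hi
    have hlen1 : s1.arr a_in (setPos L i) = (row L i).length := by
      rw [hin1, encode_getD_setPos hi]
    refine Spec.cons_wp (20 * (row L i).length + 28) ?_ (by simp only [Cmd.cost]; omega)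
    simp only [Cmd.wp, Operand.eval, hpos, hlen1]
    refine Spec.cons_wp (20 * (row L i).length + 25) ?_ (by simp only [Cmd.cost]; omega)
    simp [Cmd.wp, Operand.eval, Operand.ConstLE, hvi]
    refine Spec.cons_wp (20 * (row L i).length + 20) ?_ (by simp only [Cmd.cost]; omega)
    simp [Cmd.wp, Operand.eval, BinOp.eval, hpos]
    refine ⟨by omega, ?_⟩
    refine Spec.cons_wp (20 * (row L i).length + 15) ?_ (by simp only [Cmd.cost]; omega)
    simp [Cmd.wp, Operand.eval, Operand.ConstLE, hvi]
    refine Spec.cons (20 * (row L i).length + 3) 3 _ ((parseSet_spec (i := i) hL hi (by simpa using hin1)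
      (by simpa using hsets1) (by simp) (by simp) (by simpa using hvi) hM hM' ?_).mono le_rfl
      fun s2 p2 h _ hF2 => And.intro h hF2) ?_ (by omega)
    · intro u hu
      obtain ⟨h3, h4⟩ := hcols u hu
      exact ⟨by simpa using h3, fun d hd => by simpa using h4 d hd⟩
    rintro s2 p2 ⟨⟨rfl, hcols2⟩, hF2⟩ - -
    have hp2 : s2.var v_pos = setPos L i + 1 := (hF2.var _ rfl).trans (by simp)
    have hl2 : s2.var v_len = (row L i).length := (hF2.var _ rfl).trans (by simp)
    have ha2 : s2.arr a_len = Function.update (s1.arr a_len) i (row L i).length :=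
      (hF2.arr _ rfl).trans (by simp)
    have ho2 : s2.arr a_off = Function.update (s1.arr a_off) i (setPos L i + 1) :=
      (hF2.arr _ rfl).trans (by simp)
    refine Spec.of_wp_le ?_ (by decide)
    simp [Cmd.wp, Cmd.block, Operand.eval, BinOp.eval, hp2, hl2, ha2, ho2]
    refine ⟨by omega, by omega, fun u hu => ⟨by simpa using (hcols2 u hu).1, fun d hd => by
      simpa using (hcols2 u hu).2 d hd⟩, fun j hj => ?_⟩
    by_cases hji : j = i
    · simp [hji]
    · simpa [hji] using hrows j (by omega)
  · exact ⟨h.1, h.2.2.1, h.2.2.2⟩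

/-- Counting up from 8 while k ≤ 8c, at most n times, keeps k ≤ 8c + 1 ≤ 9c and the time linear even
for huge c. -/
theorem approximateParam_spec (hc : 1 ≤ c) {s : State} {p : ℝ} (hn : s.var v_n = n)
    (hM : (n + 8) * (n + 8) ≤ M) :
    Spec c M approximateParam s p (10 * n + 20) fun s' p' => p' = p ∧ ∃ k : ℕ,
      s'.var v_square = k * k ∧ (8 * c < k ∨ n + 8 ≤ k) ∧ (k : ℝ) ≤ 9 * c ∧ 8 ≤ k := by
  have hM8 : n + 8 ≤ M := le_trans (by nlinarith) hM
  refine Spec.cons_wp (10 * n + 15) ?_ (by simp only [Cmd.cost]; omega)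
  simp [Cmd.wp, Operand.eval, BinOp.eval]
  refine ⟨by omega, ?_⟩
  refine Spec.cons (10 * n + 3) 5 (fun s' p' => p' = p ∧ 8 ≤ s'.var v_k ∧ s'.var v_k ≤ 8 + n ∧
    (s'.var v_k : ℝ) ≤ 8 * c + 1 ∧ (8 * c < s'.var v_k ∨ s'.var v_k = 8 + n)) (Spec.for_le (R := n)
    (fun j s' p' => p' = p ∧ 8 ≤ s'.var v_k ∧ s'.var v_k ≤ 8 + j ∧
    (s'.var v_k : ℝ) ≤ 8 * c + 1 ∧ (8 * c < s'.var v_k ∨ s'.var v_k = 8 + j)) (fun _ => 6) rfl rfl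
    (by decide) (by simpa using hn) (by simp; omega) ?_ ?_ fun _ _ h _ _ => h) ?_ (by omega)
  · simp
    linarith
  · rintro j hj s1 p1 ⟨rfl, h1, h2, h3, h4⟩ hji hw hF
    refine Spec.of_wp_le ?_ (by decide)
    simp [Cmd.wp, Operand.eval, BinOp.eval, Test.Holds]
    refine ⟨fun h => ⟨by omega, by omega, by omega, by linarith, ?_⟩,
      fun h => ⟨h1, by omega, h3, Or.inl (by linarith)⟩⟩
    rcases h4 with h4 | h4
    · linarith
    · right; omega
  · rintro s1 p1 ⟨rfl, h1, h2, h3, h4⟩ - -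
    refine Spec.of_wp_le ?_ (by decide)
    simp [Cmd.wp, Cmd.block, Operand.eval, BinOp.eval]
    refine ⟨le_trans (Nat.mul_le_mul (by omega) (by omega)) hM, s1.var v_k, rfl, ?_, by linarith, h1⟩
    exact h4.imp id fun h => by omega

theorem initCycles_spec {s : State} {p : ℝ} (hn : s.var v_n = n) (hM : n + 1 ≤ M) :
    Spec c M initCycles s p (10 * n + 20) fun s' p' => p' = p ∧ s'.HasReps (List.finRange n) ∧
      (∀ x : Fin n, s'.arr a_next x = x) ∧ s'.var v_cycles = n ∧ s'.var v_fresh = 1 := by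
  refine Spec.cons (10 * n + 3) 10 (fun s' p' => p' = p ∧
    ∀ i < n, s'.arr a_rep i = i ∧ s'.arr a_next i = i) (Spec.for_le (R := n)
    (fun j s' p' => p' = p ∧ ∀ i < j, s'.arr a_rep i = i ∧ s'.arr a_next i = i) (fun _ => 7)
    rfl rfl (by decide) hn (by simp; omega) ?_ ?_ fun _ _ h _ _ => h) ?_ (by omega)
  · simp
  · rintro j hj s1 p1 ⟨rfl, h1⟩ hji hw hF
    refine Spec.of_wp_le ?_ (by decide)
    simp [Cmd.wp, Cmd.block, Operand.eval, Operand.ConstLE, hji]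
    intro i hi
    by_cases hij : i = j
    · simp [hij]
    · simpa [hij] using h1 i (by omega)
  · rintro s1 p1 ⟨rfl, h1⟩ - hF
    have hn1 : s1.var v_n = n := (hF.var _ rfl).trans hn
    refine Spec.of_wp_le ?_ (by decide)
    simp [Cmd.wp, Cmd.block, Operand.eval, BinOp.eval, hn1]
    refine ⟨by omega, by omega, fun i hi => ?_, fun x => (h1 x x.2).2⟩
    simp at hi
    simpa using (h1 i hi).1

end Input

/-! ### The algorithm -/

section Main

variable {c : ℝ} {n k M : ℕ} {L : List (List (Fin n))} {F : Finset (Finset (Fin n))}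

theorem sum_represents (hL : Represents L F) {β : Type*} [AddCommMonoid β]
    (f : Finset (Fin n) → β) :
    ∑ X ∈ F, f X = ∑ i ∈ Finset.range L.length, f (L.getD i []).toFinset := by
  symm
  refine Finset.sum_bij (fun i _ => (L.getD i []).toFinset) ?_ ?_ ?_ fun _ _ => rfl
  · intro i hi
    have hi' := Finset.mem_range.1 hi
    rw [List.getD_eq_getElem _ _ hi']
    exact mem_of_represents hL hi'
  · intro i hi j hj h
    have hi' := Finset.mem_range.1 hi
    have hj' := Finset.mem_range.1 hj
    rw [List.getD_eq_getElem _ _ hi', List.getD_eq_getElem _ _ hj'] at h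
    refine (List.Nodup.getElem_inj_iff hL.2.1 (i := i) (j := j) (hi := by simpa using hi')
      (hj := by simpa using hj')).1 ?_
    simpa using h
  · intro X hX
    obtain ⟨i, hi, rfl⟩ := exists_of_represents hL hX
    exact ⟨i, Finset.mem_range.2 hi, by rw [List.getD_eq_getElem _ _ hi]⟩

theorem length_eq_card (hL : Represents L F) : L.length = F.card := by
  rw [Finset.card_eq_sum_ones, sum_represents hL]; simp

theorem total_eq (hL : Represents L F) : total L = ∑ X ∈ F, X.card := by
  rw [sum_represents hL, total]
  refine Finset.sum_congr rfl fun i hi => ?_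
  have hi' := Finset.mem_range.1 hi
  rw [row, List.getD_eq_getElem _ _ hi', List.length_map,
    List.toFinset_card_of_nodup (hL.1 _ (List.getElem_mem hi'))]

/-- Only the empty set contributes nothing to the total, and it is listed at most once. -/
theorem length_le_total (hL : Represents L F) : L.length ≤ total L + 1 := by
  rw [length_eq_card hL, total_eq hL]
  have h1 : (F.erase ∅).card ≤ ∑ X ∈ F.erase ∅, X.card := by
    rw [Finset.card_eq_sum_ones]
    refine Finset.sum_le_sum fun X hX => ?_
    exact Finset.card_pos.2 (Finset.nonempty_iff_ne_empty.2 (Finset.ne_of_mem_erase hX))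
  have h2 : ∑ X ∈ F.erase ∅, X.card ≤ ∑ X ∈ F, X.card :=
    Finset.sum_le_sum_of_subset (Finset.erase_subset _ _)
  have h3 : F.card - 1 ≤ (F.erase ∅).card := Finset.pred_card_le_card_erase
  omega

/-- An upper bound for the number of steps. -/
def runningTime (n N S : ℕ) : ℕ :=
  300 * (n + N + S) + 300 + (200 * (n + N + S) + 201) * Nat.log 2 n

/-- The word bounds serve, in this order, the product in the sample size, the square of k, the
incidence table, the positions in the input, and the labels. -/
theorem orderProgram_spec (hc : 1 ≤ c) (hL : Represents L F)
    (hF : ∀ k : ℕ, 1 ≤ k → (shatterFunction F k : ℝ) ≤ c * k)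
    (hF' : ∀ k : ℕ, 1 ≤ k → (dualShatterFunction F k : ℝ) ≤ c * k)
    (hM1 : 32 * n + 1 ≤ M) (hM2 : (n + 8) * (n + 8) ≤ M) (hM3 : n * L.length ≤ M)
    (hM4 : 2 + L.length + total L ≤ M) (hM5 : 1 + n * (1 + 2 * total L) ≤ M) :
    Spec c M orderProgram (initial orderProgram (encode L)).state (2 / 3)
      (runningTime n L.length (total L)) fun s' p' =>
        ∃ (σ : Equiv.Perm (Fin n)) (m : ℕ), m ≤ 1 ∧ p' ≤ guarantee c F σ m ∧
          ∃ e : Equiv.Perm (Fin n), (∀ i : Fin n, s'.arr a_out i = e i) ∧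
            ∀ X, crossings e X ≤ cyclicCrossings σ X := by
  have hpos := setPos_length L
  set s := (initial orderProgram (encode L)).state with hs
  have hsin : ∀ j, s.arr a_in j = (encode L).getD j 0 := fun j => by simp [hs, initial]
  have hs0 : ∀ a, a ≠ a_in → ∀ i, s.arr a i = 0 := fun a ha i => by simp [hs, initial, ha]
  set T := (200 * (n + L.length + total L) + 201) * Nat.log 2 n with hT
  rw [runningTime, ← hT]
  refine Spec.cons_wp (300 * (n + L.length + total L) + 295 + T) ?_ (by simp only [Cmd.cost]; omega)
  simp only [Cmd.wp, Operand.eval]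
  refine Spec.cons_wp (300 * (n + L.length + total L) + 290 + T) ?_ (by simp only [Cmd.cost]; omega)
  simp only [Cmd.wp, Operand.eval, State.setVar_arr]
  set s0 := (s.setVar v_n (s.arr a_in 0)).setVar v_sets (s.arr a_in 1) with hs0'
  have h0n : s0.var v_n = n := by simp [hs0', hsin, encode]
  have h0N : s0.var v_sets = L.length := by simp [hs0', hsin, encode]
  have h0a : s0.arr = s.arr := rfl
  refine Spec.cons (10 * n + 20) (290 * (n + L.length + total L) + 269 + T) _
    (approximateParam_spec hc h0n hM2) ?_ (by omega)
  rintro s1 p1 ⟨rfl, k, hsq, hk1, hk2, hk3⟩ - hF1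
  have h1n : s1.var v_n = n := (hF1.var _ rfl).trans h0n
  have h1N : s1.var v_sets = L.length := (hF1.var _ rfl).trans h0N
  refine Spec.cons (10 * n + 20) (280 * (n + L.length + total L) + 248 + T) _
    (initCycles_spec h1n (by omega)) ?_ (by omega)
  rintro s2 p2 ⟨rfl, hreps, hnext, hcount, hfresh⟩ - hF2
  have h2n : s2.var v_n = n := (hF2.var _ rfl).trans h1n
  have h2N : s2.var v_sets = L.length := (hF2.var _ rfl).trans h1N
  have h2z : ∀ a, a ≠ a_in → a ≠ a_rep → a ≠ a_next → ∀ i, s2.arr a i = 0 := by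
    intro a ha h6 h7 i
    rw [hF2.arr a, hF1.arr a rfl, h0a, hs0 a ha]
    simp [initCycles, Cmd.block, Cmd.forLoop, Cmd.writesArr, h6.symm, h7.symm]
  refine Spec.cons (20 * total L + 40 * L.length + 20)
    (240 * (n + L.length + total L) + 227 + T) _ (parseInput_spec hL.1 (s := s2) (L := L) (M := M)
      (fun j => ?_) h2N (h2z _ (by decide) (by decide) (by decide)) (by omega) hM3) ?_ (by omega)
  · rw [hF2.arr a_in rfl, hF1.arr a_in rfl, h0a, hsin]
  rintro s3 p3 ⟨rfl, hcols, hrows⟩ - hF3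
  have h3n : s3.var v_n = n := (hF3.var _ rfl).trans h2n
  have h3z : ∀ a ∈ [a_elemLabel, a_setLabel, a_newLabel, a_seen, a_lead], ∀ i, s3.arr a i = 0 := by
    intro a ha i
    have : parseInput.writesArr a = false ∧ a ≠ a_in ∧ a ≠ a_rep ∧ a ≠ a_next := by
      fin_cases ha <;> decide
    rw [hF3.arr a this.1, h2z a this.2.1 this.2.2.1 this.2.2.2]
  have h3f : s3.var v_fresh = 1 := (hF3.var _ rfl).trans hfresh
  have h3in : ∀ j, s3.arr a_in j = (encode L).getD j 0 := by
    intro j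
    rw [hF3.arr a_in rfl, hF2.arr a_in rfl, hF1.arr a_in rfl, h0a, hsin]
  have htab : Tables L k M s3 := by
    refine ⟨h3n, (hF3.var _ rfl).trans h2N, ?_, fun i hi => (hrows i hi).1, fun i hi => ?_,
      fun i hi j hj => ?_, fun u hu => (hcols u hu).1, fun u hu => (hcols u hu).2, hM3⟩
    · rw [hF3.var v_square rfl, hF2.var v_square rfl, hsq]
    · rw [(hrows i hi).2, ← setPos_succ]
      exact (setPos_mono L hi).trans (by omega)
    · rw [(hrows i hi).2, h3in, encode_getD_row hi hj]
  have hcyc : Cycles L k M (List.finRange n) 1 s3 := by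
    have hrep3 : s3.arr a_rep = s2.arr a_rep := hF3.arr _ rfl
    refine ⟨htab, ?_, List.nodup_finRange n, ?_, fun x => ?_, ?_, ⟨?_, ?_⟩, ⟨?_, ?_⟩, ?_, ?_, ?_⟩
    · unfold State.HasReps State.Lists; rw [hrep3]; exact hreps
    · rw [List.length_finRange, hF3.var v_cycles rfl, hcount]
    · rw [hF3.arr a_next rfl, hnext]; rfl
    · have : {x : Fin n | x ∈ List.finRange n} = Set.univ := by ext; simp
      rw [this]
      exact cycleReps_one
    · intro x; rw [h3z _ (by decide), h3f]; exact one_pos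
    · intro x; rw [h3z _ (by decide), h3f]; exact one_pos
    · intro x; rw [h3z _ (by decide), h3f]; exact one_pos
    · intro x; rw [h3z _ (by decide), h3f]; exact one_pos
    · exact fun l _ => h3z _ (by decide) l
    · exact fun l _ => h3z _ (by decide) l
    · rw [h3f, List.length_finRange]; exact hM5
  have hA : Admissible c k M L F := ⟨hc, hL, hF, hF', hk1, hk2, hk3, hM1⟩
  have hstart : (2 / 3 : ℝ) ≤ guarantee c F 1 (List.finRange n).length := by
    rw [List.length_finRange, guarantee, if_pos]
    · exact two_thirds_le_successBound n
    · intro X _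
      rw [cyclicCrossings_one]; simp
  refine Spec.cons (T + 1) (240 * (n + L.length + total L) + 225) _
    ((mainLoop_spec hA hcyc).mono_prob hstart |>.le_trans (by rw [List.length_finRange])) ?_
    (by omega)
  rintro s4 p4 ⟨R, σ, hI, hR1, hp4⟩ - -
  refine Spec.cons (10 * n + 10) 1 _ (writeOrder_spec hI.tables.n_eq hI.next) ?_ (by omega)
  rintro s5 p5 ⟨rfl, hout⟩ - -
  refine Spec.nil ⟨σ, R.length, hR1, hp4, ?_⟩ le_rfl
  rcases Nat.eq_zero_or_pos n with h0 | h0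
  · subst h0
    exact ⟨1, fun i => i.elim0, fun X => by simp [crossings]⟩
  have hRpos : 0 < R.length := by
    obtain ⟨f, -, -, hf⟩ := hI.cycleReps
    exact List.length_pos_of_mem (hf ⟨0, h0⟩).1
  obtain ⟨e, he, hcr⟩ := exists_order_of_sameCycle (σ := σ) (r := R[0]) fun x => by
    refine hI.cycleReps.sameCycle ?_ (List.getElem_mem hRpos) x
    intro x hx y hy
    obtain ⟨i, hi, rfl⟩ := List.getElem_of_mem hx
    obtain ⟨j, hj, rfl⟩ := List.getElem_of_mem hy
    have : i = j := by omega
    subst this; rfl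
  refine ⟨e, fun i => ?_, hcr⟩
  rw [hout R[0] (hI.reps.get hRpos) i i.2, he]

theorem mem_encode_le (hL : ∀ l ∈ L, l.Nodup) {x : ℕ} (hx : x ∈ encode L) : x ≤ n + L.length := by
  simp only [encode, List.mem_cons, List.mem_flatMap, List.mem_map] at hx
  rcases hx with rfl | rfl | ⟨l, hl, rfl | ⟨u, -, rfl⟩⟩
  · omega
  · omega
  · have : l.length ≤ n := by simpa using (hL l hl).length_le_card
    omega
  · have := u.2
    omega

theorem initial_wordsLE (hL : ∀ l ∈ L, l.Nodup) (hM : n + L.length ≤ M) :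
    (initial orderProgram (encode L)).state.WordsLE M := by
  refine ⟨fun i => Nat.zero_le _, fun a i => ?_⟩
  simp only [initial]
  split_ifs
  · by_cases hi : i < (encode L).length
    · rw [List.getD_eq_getElem _ _ hi]
      exact (mem_encode_le hL (List.getElem_mem hi)).trans hM
    · rw [List.getD_eq_default _ _ (by omega)]
      exact Nat.zero_le _
  · exact Nat.zero_le _

/-- It remains to see that a bad output forces a zero guarantee: a positive one keeps all crossings
within the initial budget. -/
theorem orderProgram_ensures (hc : 1 ≤ c) (hL : Represents L F)
    (hF : ∀ k : ℕ, 1 ≤ k → (shatterFunction F k : ℝ) ≤ c * k)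
    (hF' : ∀ k : ℕ, 1 ≤ k → (dualShatterFunction F k : ℝ) ≤ c * k)
    (hM : 100 * (size F + 1) ^ 2 ≤ M) :
    Ensures c M (fun s => ∃ e : Equiv.Perm (Fin n), (∀ i : Fin n, s.arr a_out i = e i) ∧
      (crossingNumber F e : ℝ) ≤ 12 * c ^ 2 * Real.logb 2 n ^ 2)
      (runningTime n L.length (total L)) (2 / 3) (initial orderProgram (encode L)) := by
  have hsize : size F = n + total L := by rw [size, total_eq hL]
  have hlen := length_le_total hL
  rw [hsize] at hM
  have hspec := orderProgram_spec (M := M) hc hL hF hF' (by nlinarith) (by nlinarith)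
    (by nlinarith) (by nlinarith) (by nlinarith)
  refine (hspec (initial_wordsLE hL.1 (by nlinarith)) _ 0 [] ?_).mono_time (by omega)
  rintro s' p' ⟨σ, m, hm, hp, e, he, hcr⟩ hw -
  -- For m = 0 division by zero gives the success bound 2/3, so this case is harmless too.
  have hp1 : guarantee c F σ m ≤ 1 ∨ m = 0 := by
    rw [guarantee]
    split_ifs
    · rcases Nat.eq_zero_or_pos m with h | h
      · exact Or.inr h
      · exact Or.inl (successBound_le_one h)
    · exact Or.inl zero_le_one
  refine Ensures.of_halted hw ?_ ?_
  · rcases hp1 with h | rfl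
    · exact hp.trans h
    · refine hp.trans ?_
      rw [guarantee]
      split_ifs
      · norm_num [successBound]
      · exact zero_le_one
  by_cases hgood : (crossingNumber F e : ℝ) ≤ 12 * c ^ 2 * Real.logb 2 n ^ 2
  · exact Or.inl ⟨e, he, hgood⟩
  right
  refine hp.trans ?_
  rw [guarantee, if_neg]
  intro hcross
  refine hgood ?_
  have hle : crossingNumber F e ≤ n - 1 := Finset.sup_le fun X _ => crossings_le e X
  -- A missed target lies below n - 1, which is exactly what `budget_le` needs.
  have hbud := budget_le (lt_of_lt_of_le (not_le.1 hgood) (by exact_mod_cast hle)) hc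
  refine le_trans ?_ hbud
  have h0 : budget c m = 0 := by rw [budget, if_pos hm]
  rw [h0] at hcross
  have hbn : 0 ≤ budget c n := by
    rw [budget]
    split_ifs with h
    · exact le_rfl
    · have : 0 ≤ Real.logb 2 n :=
        Real.logb_nonneg (by norm_num) (by exact_mod_cast (by omega : 1 ≤ n))
      positivity
  have : crossingNumber F e ≤ ⌊budget c n⌋₊ := by
    refine Finset.sup_le fun X hX => Nat.le_floor ?_
    have h1 : (crossings e X : ℝ) ≤ cyclicCrossings σ X := by exact_mod_cast hcr X
    have h2 := hcross X hX
    linarith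
  exact (Nat.le_floor_iff hbn).1 this

theorem size_mul_logb_nonneg (F : Finset (Finset (Fin n))) :
    0 ≤ (size F : ℝ) * Real.logb 2 n + 1 := by
  rcases Nat.eq_zero_or_pos n with rfl | hn
  · simp
  · have : 0 ≤ Real.logb 2 n := Real.logb_nonneg (by norm_num) (by exact_mod_cast hn)
    positivity

theorem runningTime_le (hL : Represents L F) :
    (runningTime n L.length (total L) : ℝ) ≤
      (10000 : ℕ) * ((size F : ℝ) * Real.logb 2 n + 1) := by
  have hsize : size F = n + total L := by rw [size, total_eq hL]
  have hlen := length_le_total hL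
  -- For n < 2 the logarithm vanishes and the additive constant must suffice: there are at most two
  -- sets. For n ≥ 2 the logarithm is at least 1 and absorbs the linear terms.
  rcases Nat.lt_or_ge n 2 with hn | hn
  · have hN : L.length ≤ 2 := by
      rw [length_eq_card hL]
      refine (Finset.card_le_univ F).trans ?_
      rw [Fintype.card_finset, Fintype.card_fin]
      interval_cases n <;> norm_num
    have ht : total L ≤ 2 := by
      rw [total_eq hL]
      refine (Finset.sum_le_card_nsmul F _ 1 fun X _ => ?_).trans ?_
      · exact (Finset.card_le_univ X).trans (by simp; omega)
      · rw [smul_eq_mul, mul_one, ← length_eq_card hL]; exact hN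
    have hlog : Nat.log 2 n = 0 := Nat.log_of_lt hn
    have hT : runningTime n L.length (total L) ≤ 10000 := by
      rw [runningTime, hlog]; omega
    have h0 : 0 ≤ Real.logb 2 n := by
      interval_cases n <;> simp
    have h1 : (runningTime n L.length (total L) : ℝ) ≤ 10000 := by exact_mod_cast hT
    have h2 : 0 ≤ (size F : ℝ) * Real.logb 2 n := by positivity
    push_cast
    linarith
  · have hn0 : (0 : ℝ) < n := by exact_mod_cast (by omega : 0 < n)
    have hlog : (Nat.log 2 n : ℝ) ≤ Real.logb 2 n := Real.natLog_le_logb n 2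
    have hlog1 : 1 ≤ Real.logb 2 n := by
      rw [Real.le_logb_iff_rpow_le (by norm_num) hn0, Real.rpow_one]
      exact_mod_cast hn
    have h1 : n + L.length + total L ≤ 2 * size F := by omega
    have h2 : 1 ≤ size F := by omega
    have hT : runningTime n L.length (total L) ≤ 900 * size F + 601 * size F * Nat.log 2 n := by
      rw [runningTime]
      refine Nat.add_le_add (by omega) (Nat.mul_le_mul_right _ (by omega))
    have h3 : (runningTime n L.length (total L) : ℝ) ≤
        900 * size F + 601 * size F * Nat.log 2 n := by exact_mod_cast hT
    have h4 : (0 : ℝ) ≤ size F := Nat.cast_nonneg _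
    have h5 := mul_le_mul_of_nonneg_left hlog h4
    have h6 := mul_le_mul_of_nonneg_left hlog1 h4
    push_cast
    nlinarith

end Main

end WelzlOrder

/-- One program `P` and one constant `K` serve all set systems and all `c`. For the inputs in
question, every run halts within `T ≤ K * (‖S‖ * log₂ |U| + 1)` steps, uses only words of
`O(log ‖S‖)` bits, and the output is with probability at least `2/3` a total order with the
required crossing number. -/
theorem theorem2 :
    ∃ (P : WelzlOrder.Cmd) (K : ℕ),
      ∀ (n : ℕ) (F : Finset (Finset (Fin n))) (c : ℝ), 1 ≤ c →
        (∀ k : ℕ, 1 ≤ k → (WelzlOrder.shatterFunction F k : ℝ) ≤ c * k) →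
        (∀ k : ℕ, 1 ≤ k → (WelzlOrder.dualShatterFunction F k : ℝ) ≤ c * k) →
        ∀ L : List (List (Fin n)), WelzlOrder.Represents L F →
          ∃ T : ℕ,
            (T : ℝ) ≤ K * ((WelzlOrder.size F : ℝ) * Real.logb 2 n + 1) ∧
            (∀ x ∈ (WelzlOrder.run P c (WelzlOrder.encode L) T).support, x.Halted) ∧
            (∀ t : ℕ, ∀ x ∈ (WelzlOrder.run P c (WelzlOrder.encode L) t).support,
              x.WordsLE (K * (WelzlOrder.size F + 1) ^ K)) ∧
            2 / 3 ≤ (WelzlOrder.run P c (WelzlOrder.encode L) T).toOuterMeasure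
              {x | ∃ e : Equiv.Perm (Fin n), x.Outputs e ∧
                (WelzlOrder.crossingNumber F e : ℝ) ≤ 12 * c ^ 2 * Real.logb 2 n ^ 2} := by
  -- `K` is both a factor and an exponent; keeping it opaque prevents the evaluation of a huge
  -- power.
  obtain ⟨K, hK⟩ : ∃ K : ℕ, 10000 ≤ K := ⟨_, le_rfl⟩
  refine ⟨WelzlOrder.orderProgram, K, fun n F c hc hF hF' L hL =>
    ⟨WelzlOrder.runningTime n L.length (WelzlOrder.total L), ?_, ?_⟩⟩
  · exact (WelzlOrder.runningTime_le hL).trans (mul_le_mul_of_nonneg_right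
      (by exact_mod_cast hK) (WelzlOrder.size_mul_logb_nonneg F))
  have hM : 100 * (WelzlOrder.size F + 1) ^ 2 ≤ K * (WelzlOrder.size F + 1) ^ K :=
    Nat.mul_le_mul (by omega) (Nat.pow_le_pow_right (by omega) (by omega))
  have h := WelzlOrder.orderProgram_ensures hc hL hF hF' hM
  simp only [WelzlOrder.run_eq_runFrom]
  refine ⟨h.halts, h.words, ?_⟩
  have h1 := h.prob
  have h2 : (2 / 3 : ENNReal) = ENNReal.ofReal (2 / 3) := by
    rw [ENNReal.ofReal_div_of_pos (by norm_num)]; simp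
  rw [h2]
  exact ENNReal.ofReal_le_of_le_toReal h1
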